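/- Let $K=\mathbb{Q}(q)$ and let $O_q(M(n))$ be the associative $K$-algebra with generators $Z_{ij}$, $1\le i,j\le n$, and relations $$Z_{ij}Z_{ik}=q^2Z_{ik}Z_{ij}\ (j<k),\qquad Z_{ij}Z_{kj}=q^2Z_{kj}Z_{ij}\ (i<k),$$ $$Z_{ij}Z_{st}=Z_{st}Z_{ij}\ (i>s,\ j<t),\qquad Z_{ij}Z_{st}=Z_{st}Z_{ij}+(q^2-q^{-2})Z_{it}Z_{sj}\ (i<s,\ j<t).$$ Let $x\mapsto\overline{x}$ be the $\mathbb{Q}$-algebra anti-automorphism of $O_q(M(n))$ with $\overline{Z_{ij}}=Z_{ij}$, $\overline{q}=q^{-1}$, and $\sigma$ the $K$-algebra automorphism with $\sigma(Z_{ij})=Z_{ji}$. For $A=(a_{ij})\in M_n(\mathbb{Z}_{\ge 0})$ let $r_i=\sum_j a_{ij}$ and $c_j=\sum_i a_{ij}$ be its row and column sums, and let $$Z(A)=q^{-\sum_i\sum_{j>k}a_{ij}a_{ik}-\sum_i\sum_{j>k}a_{ji}a_{ki}}\prod_{i,j}Z_{ij}^{a_{ij}},$$ where the factors are in the lexicographic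 order of $(i,j)$; let $L^*$ be the $\mathbb{Z}[q]$-span of all $Z(A)$. There is a unique $\mathbb{Z}[q]$-basis $B^*=\{b(A)\mid A\in M_n(\mathbb{Z}_{\ge 0})\}$ of $L^*$ such that, for all $A$, $\overline{b(A)}=b(A)$ and $b(A)=Z(A)+\sum_{B<A}h_B(A)Z(B)$ with $h_B(A)\in q\mathbb{Z}[q]$, where the sum is over matrices $B$ with the same row sums and column sums as $A$ that are smaller than $A$ in the lexicographic order of the entries. For $1\le t\le n$ let $$\det\nolimits_q(t)=\sum_{w\in S_t}(-q^2)^{\ell(w)}Z_{1,\,n-t+w(1)}Z_{2,\,n-t+w(2)}\cdots Z_{t,\,n-t+w(t)}$$ be the quantum minor with rows $1,\dots,t$ and columns $n-t+1,\dots,n$ ($\ell(w)$ is the number of inversions of $w$), and let $E_t$ be the $n\times n$ matrix whose upper right $t\times t$ block is the identity matrix and whose other entries are $0$. **Theorem.** The set $q^{\mathbb{Z}}B^*=\{q^a b(A)\mid a\in\mathbb{Z},\ A\in M_n(\mathbb{Z}_{\ge 0})\}$ is stable under (left and right) multiplication by $\det_q(t)$ and by $\sigma(\det_q(t))$, for every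 $1\le t\le n$. More precisely, for every $A\in M_n(\mathbb{Z}_{\ge 0})$ with row sums $r_i$ and column sums $c_j$, $$b(A)\det\nolimits_q(t)=q^{r_1+\dots+r_t-c_{n-t+1}-\dots-c_n}\,b(A+E_t),$$ $$b(A)\,\sigma(\det\nolimits_q(t))=q^{c_1+\dots+c_t-r_{n-t+1}-\dots-r_n}\,b(A+E_t^T).$$ -/

import Mathlib

namespace QuantumMatrix

noncomputable section

/-- The base field `K = ℚ(q)`. -/
def K : Type := RatFunc ℚ

instance : Field K := inferInstanceAs (Field (RatFunc ℚ))

/-- The indeterminate `q`. -/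
def q : K := (RatFunc.X : RatFunc ℚ)

theorem q_ne_zero : q ≠ 0 := RatFunc.X_ne_zero (K := ℚ)

/-- The subring `ℤ[q]` of `K`. -/
def Zq : Subalgebra ℤ K := Algebra.adjoin ℤ {q}

/-- The index set `M_n(ℤ₊)`. -/
abbrev Mat (n : ℕ) : Type := Matrix (Fin n) (Fin n) ℕ

/-- The defining relations of `O_q(M(n))`, imposed on the free `K`-algebra on symbols `Z_{ij}`. -/
inductive Rel (n : ℕ) :
    FreeAlgebra K (Fin n × Fin n) → FreeAlgebra K (Fin n × Fin n) → Prop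
  | row (i j k : Fin n) (hjk : j < k) :
      Rel n (FreeAlgebra.ι K (i, j) * FreeAlgebra.ι K (i, k))
        (q ^ 2 • (FreeAlgebra.ι K (i, k) * FreeAlgebra.ι K (i, j)))
  | col (i j k : Fin n) (hik : i < k) :
      Rel n (FreeAlgebra.ι K (i, j) * FreeAlgebra.ι K (k, j))
        (q ^ 2 • (FreeAlgebra.ι K (k, j) * FreeAlgebra.ι K (i, j)))
  | anti (i j s t : Fin n) (his : s < i) (hjt : j < t) :
      Rel n (FreeAlgebra.ι K (i, j) * FreeAlgebra.ι K (s, t))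
        (FreeAlgebra.ι K (s, t) * FreeAlgebra.ι K (i, j))
  | diag (i j s t : Fin n) (his : i < s) (hjt : j < t) :
      Rel n (FreeAlgebra.ι K (i, j) * FreeAlgebra.ι K (s, t))
        (FreeAlgebra.ι K (s, t) * FreeAlgebra.ι K (i, j)
          + (q ^ 2 - (q⁻¹) ^ 2) • (FreeAlgebra.ι K (i, t) * FreeAlgebra.ι K (s, j)))

/-- The quantum matrix algebra `O_q(M(n))`. -/
def Oq (n : ℕ) : Type := RingQuot (Rel n)

instance (n : ℕ) : Ring (Oq n) := inferInstanceAs (Ring (RingQuot (Rel n)))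

instance (n : ℕ) : Algebra K (Oq n) := inferInstanceAs (Algebra K (RingQuot (Rel n)))

/-- The quotient map from the free algebra. -/
def mk (n : ℕ) : FreeAlgebra K (Fin n × Fin n) →ₐ[K] Oq n := RingQuot.mkAlgHom K (Rel n)

theorem mk_rel {n : ℕ} {x y : FreeAlgebra K (Fin n × Fin n)} (h : Rel n x y) :
    mk n x = mk n y :=
  RingQuot.mkAlgHom_rel K h

theorem mk_surjective (n : ℕ) : Function.Surjective (mk n) :=
  RingQuot.mkAlgHom_surjective K (Rel n)

/-- The universal property of `O_q(M(n))`. -/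
def lift {n : ℕ} {R : Type} [Ring R] [Algebra K R] (f : FreeAlgebra K (Fin n × Fin n) →ₐ[K] R)
    (hf : ∀ ⦃x y⦄, Rel n x y → f x = f y) : Oq n →ₐ[K] R :=
  RingQuot.liftAlgHom K ⟨f, hf⟩

theorem lift_mk {n : ℕ} {R : Type} [Ring R] [Algebra K R]
    (f : FreeAlgebra K (Fin n × Fin n) →ₐ[K] R) (hf : ∀ ⦃x y⦄, Rel n x y → f x = f y)
    (x : FreeAlgebra K (Fin n × Fin n)) : lift f hf (mk n x) = f x :=
  RingQuot.liftAlgHom_mkAlgHom_apply K f hf x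

/-- The generator `Z_{ij}` of `O_q(M(n))`. -/
def Z {n : ℕ} (i j : Fin n) : Oq n :=
  mk n (FreeAlgebra.ι K (i, j))

theorem Z_row {n : ℕ} (i j k : Fin n) (h : j < k) :
    (Z i j * Z i k : Oq n) = q ^ 2 • (Z i k * Z i j) := by
  simpa [Z] using mk_rel (Rel.row i j k h)

theorem Z_col {n : ℕ} (i j k : Fin n) (h : i < k) :
    (Z i j * Z k j : Oq n) = q ^ 2 • (Z k j * Z i j) := by
  simpa [Z] using mk_rel (Rel.col i j k h)

theorem Z_anti {n : ℕ} (i j s t : Fin n) (h : s < i) (h' : j < t) :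
    (Z i j * Z s t : Oq n) = Z s t * Z i j := by
  simpa [Z] using mk_rel (Rel.anti i j s t h h')

theorem Z_diag {n : ℕ} (i j s t : Fin n) (h : i < s) (h' : j < t) :
    (Z i j * Z s t : Oq n)
      = Z s t * Z i j + (q ^ 2 - (q⁻¹) ^ 2) • (Z i t * Z s j) := by
  have := mk_rel (Rel.diag i j s t h h')
  simpa only [Z, map_mul, map_add, map_smul] using this

/-! ### The transposition automorphism -/

/-- The `K`-algebra endomorphism `Z_{ij} ↦ Z_{ji}`. -/
def sigmaHom (n : ℕ) : Oq n →ₐ[K] Oq n :=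
  lift (FreeAlgebra.lift K (fun p : Fin n × Fin n => (Z p.2 p.1 : Oq n))) <| by
      intro x y h
      cases h with
      | row i j k h => simpa using Z_col j i k h
      | col i j k h => simpa using Z_row j i k h
      | anti i j s t h h' => simpa using (Z_anti t s j i h' h).symm
      | diag i j s t h h' =>
        simp only [map_mul, map_add, map_smul, FreeAlgebra.lift_ι_apply]
        rw [Z_diag j i t s h' h, Z_anti t i j s h' h]

theorem sigmaHom_Z {n : ℕ} (i j : Fin n) : sigmaHom n (Z i j) = Z j i := by
  rw [sigmaHom, Z, lift_mk, FreeAlgebra.lift_ι_apply]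

theorem sigmaHom_comp (n : ℕ) : (sigmaHom n).comp (sigmaHom n) = AlgHom.id K (Oq n) := by
  have h : ((sigmaHom n).comp (sigmaHom n)).comp (mk n) = (AlgHom.id K (Oq n)).comp (mk n) := by
    apply FreeAlgebra.hom_ext
    funext p
    change sigmaHom n (sigmaHom n (Z p.1 p.2)) = Z p.1 p.2
    rw [sigmaHom_Z, sigmaHom_Z]
  ext x
  obtain ⟨y, rfl⟩ := mk_surjective n x
  exact AlgHom.congr_fun h y

/-- The automorphism `σ` of the `K`-algebra `O_q(M(n))`, `σ(Z_{ij}) = Z_{ji}`. -/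
def sigma (n : ℕ) : Oq n ≃ₐ[K] Oq n :=
  AlgEquiv.ofAlgHom (sigmaHom n) (sigmaHom n) (sigmaHom_comp n) (sigmaHom_comp n)

/-! ### The bar anti-automorphism -/

theorem eval_X_inv_injective (F : Type) [Field F] :
    Function.Injective (Polynomial.eval₂RingHom RatFunc.C (RatFunc.X⁻¹ : RatFunc F)) := by
  have h : Transcendental F (RatFunc.X⁻¹ : RatFunc F) := fun h =>
    RatFunc.transcendental_X (IsAlgebraic.inv_iff.mp h)
  intro x y hxy
  apply transcendental_iff_injective.mp h
  simpa [Polynomial.aeval_def, RatFunc.algebraMap_eq_C] using hxy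

/-- The field endomorphism of `ℚ(X)` with `X ↦ X⁻¹`. -/
def barRatFunc : RatFunc ℚ →+* RatFunc ℚ :=
  RatFunc.liftRingHom (Polynomial.eval₂RingHom RatFunc.C RatFunc.X⁻¹)
    (nonZeroDivisors_le_comap_nonZeroDivisors_of_injective _ (eval_X_inv_injective ℚ))

theorem barRatFunc_X : barRatFunc RatFunc.X = RatFunc.X⁻¹ := by
  simp [barRatFunc]

/-- The field endomorphism of `K = ℚ(q)` with `q ↦ q⁻¹`. -/
def barK : K →+* K := barRatFunc

theorem barK_q : barK q = q⁻¹ := barRatFunc_X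

/-- The opposite algebra `O_q(M(n))ᵒᵖ`, made into a `K`-algebra through `q ↦ q⁻¹`. -/
abbrev twistedAlgebra (n : ℕ) : Algebra K (Oq n)ᵐᵒᵖ :=
  Algebra.compHom (Oq n)ᵐᵒᵖ barK

/-- The ring homomorphism from the free algebra to `O_q(M(n))ᵒᵖ` with `Z_{ij} ↦ Z_{ij}`, `q ↦ q⁻¹`. -/
def barFree (n : ℕ) : FreeAlgebra K (Fin n × Fin n) →+* (Oq n)ᵐᵒᵖ :=
  letI := twistedAlgebra n
  (FreeAlgebra.lift K (fun p : Fin n × Fin n => MulOpposite.op (Z p.1 p.2 : Oq n)) :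
    FreeAlgebra K (Fin n × Fin n) →ₐ[K] (Oq n)ᵐᵒᵖ).toRingHom

theorem barFree_ι {n : ℕ} (p : Fin n × Fin n) :
    barFree n (FreeAlgebra.ι K p) = MulOpposite.op (Z p.1 p.2 : Oq n) :=
  letI := twistedAlgebra n
  FreeAlgebra.lift_ι_apply (R := K) (A := (Oq n)ᵐᵒᵖ) _ p

theorem barFree_algebraMap {n : ℕ} (c : K) :
    barFree n (algebraMap K _ c) = MulOpposite.op (algebraMap K (Oq n) (barK c)) :=
  letI := twistedAlgebra n
  AlgHom.commutes (FreeAlgebra.lift K (fun p : Fin n × Fin n => MulOpposite.op (Z p.1 p.2 : Oq n)) :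
    FreeAlgebra K (Fin n × Fin n) →ₐ[K] (Oq n)ᵐᵒᵖ) c

theorem barFree_smul {n : ℕ} (c : K) (x : FreeAlgebra K (Fin n × Fin n)) :
    barFree n (c • x) = barK c • barFree n x := by
  apply MulOpposite.unop_injective
  rw [Algebra.smul_def, map_mul, barFree_algebraMap, MulOpposite.unop_mul, MulOpposite.unop_smul,
    MulOpposite.unop_op, Algebra.smul_def, Algebra.commutes]

theorem barFree_rel {n : ℕ} ⦃x y : FreeAlgebra K (Fin n × Fin n)⦄ (h : Rel n x y) :
    barFree n x = barFree n y := by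
  have hq := q_ne_zero
  apply MulOpposite.unop_injective
  cases h with
  | row i j k h =>
    simp [barFree_ι, barFree_smul, barK_q, Z_row i j k h, smul_smul, hq]
  | col i j k h =>
    simp [barFree_ι, barFree_smul, barK_q, Z_col i j k h, smul_smul, hq]
  | anti i j s t h h' =>
    simp [barFree_ι, Z_anti i j s t h h']
  | diag i j s t h h' =>
    simp only [map_mul, map_add, barFree_smul, barFree_ι, map_sub, map_pow, map_inv₀, barK_q,
      MulOpposite.unop_mul, MulOpposite.unop_add, MulOpposite.unop_smul, MulOpposite.unop_op,
      inv_inv]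
    rw [Z_diag i j s t h h', Z_anti s j i t h h', add_assoc, ← add_smul]
    simp

/-- The bar map of `O_q(M(n))`, as a ring homomorphism to the opposite ring: the
anti-automorphism with `Z_{ij} ↦ Z_{ij}` and `q ↦ q⁻¹`. -/
def barOp (n : ℕ) : Oq n →+* (Oq n)ᵐᵒᵖ :=
  RingQuot.lift ⟨barFree n, barFree_rel⟩

/-- The bar map `x ↦ x̄` of `O_q(M(n))`. -/
def bar {n : ℕ} (x : Oq n) : Oq n := (barOp n x).unop

theorem bar_mul {n : ℕ} (x y : Oq n) : bar (x * y) = bar y * bar x := by simp [bar]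

theorem bar_add {n : ℕ} (x y : Oq n) : bar (x + y) = bar x + bar y := by simp [bar]

theorem bar_mk {n : ℕ} (x : FreeAlgebra K (Fin n × Fin n)) :
    bar (mk n x) = (barFree n x).unop := by
  have h : mk n x = RingQuot.mkRingHom (Rel n) x := by
    rw [← RingQuot.mkAlgHom_coe K (Rel n)]
    rfl
  rw [bar, barOp, h]
  exact congrArg MulOpposite.unop (RingQuot.lift_mkRingHom_apply (barFree n) barFree_rel x)

theorem bar_Z {n : ℕ} (i j : Fin n) : bar (Z i j) = Z i j := by
  rw [Z, bar_mk, barFree_ι, MulOpposite.unop_op, Z]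

theorem bar_smul {n : ℕ} (c : K) (x : Oq n) : bar (c • x) = barK c • bar x := by
  obtain ⟨y, rfl⟩ := mk_surjective n x
  rw [← map_smul, bar_mk, bar_mk, barFree_smul, MulOpposite.unop_smul]

/-! ### Monomials and the lattice -/

/-- The row sum `r_i` of `A`. -/
def rowSum {n : ℕ} (A : Mat n) (i : Fin n) : ℕ := ∑ j, A i j

/-- The column sum `c_j` of `A`. -/
def colSum {n : ℕ} (A : Mat n) (j : Fin n) : ℕ := ∑ i, A i j

/-- `B < A` in the lexicographic order on matrices: at the first position, in the lexicographic
order of the positions `(i, j)`, where the two differ, the entry of `B` is the smaller one. -/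
def LexLT {n : ℕ} (B A : Mat n) : Prop :=
  ∃ i j : Fin n, B i j < A i j ∧
    ∀ i' j' : Fin n, (i' < i ∨ (i' = i ∧ j' < j)) → B i' j' = A i' j'

/-- `Z^A = ∏ Z_{ij}^{a_{ij}}`, with the factors in the lexicographic order of `(i, j)`. -/
def monomial {n : ℕ} (A : Mat n) : Oq n :=
  ((List.finRange n).map fun i => ((List.finRange n).map fun j => Z i j ^ A i j).prod).prod

/-- `D(A) = q ^ (-∑_i ∑_{j>k} a_{ij} a_{ik} - ∑_i ∑_{j>k} a_{ji} a_{ki})`. -/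
def D {n : ℕ} (A : Mat n) : K :=
  q ^ (-(∑ i, ∑ j, ∑ k ∈ Finset.univ.filter (fun k => k < j), (A i j : ℤ) * (A i k : ℤ))
    - ∑ i, ∑ j, ∑ k ∈ Finset.univ.filter (fun k => k < j), (A j i : ℤ) * (A k i : ℤ))

/-- `Z(A) = D(A) Z^A`. -/
def ZN {n : ℕ} (A : Mat n) : Oq n := D A • monomial A

/-- The `ℤ[q]`-lattice `L^*` spanned by the `Z(A)`. -/
def Lstar (n : ℕ) : Submodule Zq (Oq n) := Submodule.span Zq (Set.range (ZN (n := n)))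

/-- The family `A ↦ b(A)` is the basis `B^*`: a `ℤ[q]`-basis of `L^*` of bar-invariant elements
such that `b(A) = Z(A) + ∑_{B < A} h_B(A) Z(B)` with all `h_B(A) ∈ q ℤ[q]`, the sum running over
matrices `B` with the same row and column sums as `A`. -/
structure IsDualCanonicalBasis {n : ℕ} (b : Mat n → Oq n) : Prop where
  linearIndependent : LinearIndependent Zq b
  span_eq : Submodule.span Zq (Set.range b) = Lstar n
  bar_eq : ∀ A, bar (b A) = b A
  expansion : ∀ A, ∃ h : Mat n →₀ K,
    (∀ B ∈ h.support, LexLT B A ∧ rowSum B = rowSum A ∧ colSum B = colSum A ∧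
      ∃ c ∈ Zq, h B = q * c) ∧
    b A = ZN A + h.sum fun B c => c • ZN B

/-- The set `q^ℤ B^* = {q^a b(A)}`. -/
def qPowMul {n : ℕ} (b : Mat n → Oq n) : Set (Oq n) :=
  {x | ∃ (a : ℤ) (A : Mat n), x = q ^ a • b A}

/-! ### Quantum minors -/

/-- The length `l(w)` of a permutation: its number of inversions. -/
def permLength {m : ℕ} (w : Equiv.Perm (Fin m)) : ℕ :=
  (Finset.univ.filter fun p : Fin m × Fin m => p.1 < p.2 ∧ w p.2 < w p.1).card

/-- The quantum minor `det_q(I, J)` for `I = {i_1 < ⋯ < i_m}` and `J = {j_1 < ⋯ < j_m}`: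
`∑_{w ∈ S_m} (-q^2)^{l(w)} Z_{i_1 j_{w(1)}} ⋯ Z_{i_m j_{w(m)}}`. -/
def quantumMinor {n m : ℕ} (I J : Finset (Fin n)) (hI : I.card = m) (hJ : J.card = m) : Oq n :=
  ∑ w : Equiv.Perm (Fin m), (-(q ^ 2)) ^ permLength w •
    ((List.finRange m).map fun k => Z (I.orderEmbOfFin hI k) (J.orderEmbOfFin hJ (w k))).prod

/-- `{1, …, t}`; elements of `Fin n` are numbered from `0`. -/
def firstIdx (n t : ℕ) : Finset (Fin n) := Finset.univ.filter fun i => i.val < t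

/-- `{n - t + 1, …, n}`; elements of `Fin n` are numbered from `0`. -/
def lastIdx (n t : ℕ) : Finset (Fin n) := Finset.univ.filter fun i => n - t ≤ i.val

theorem card_firstIdx {n t : ℕ} (ht : t ≤ n) : (firstIdx n t).card = t := by
  rw [firstIdx, Fin.card_filter_val_lt, min_eq_right ht]

theorem card_lastIdx {n t : ℕ} (ht : t ≤ n) : (lastIdx n t).card = t := by
  have h : (Finset.univ.filter fun i : Fin n => ¬ (n - t ≤ i.val)).card = n - t := by
    simp only [not_le]
    rw [Fin.card_filter_val_lt, min_eq_right (Nat.sub_le n t)]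
  have h2 := Finset.card_filter_add_card_filter_not (s := (Finset.univ : Finset (Fin n)))
    (fun i : Fin n => n - t ≤ i.val)
  rw [h, Finset.card_univ, Fintype.card_fin] at h2
  rw [lastIdx]
  omega

/-- `det_q(t) = det_q({1, …, t}, {n - t + 1, …, n})`. -/
def detq (n t : ℕ) (ht : t ≤ n) : Oq n :=
  quantumMinor (firstIdx n t) (lastIdx n t) (card_firstIdx ht) (card_lastIdx ht)

/-- The `n × n` block matrix `E_t` whose upper right `t × t` block is the identity and whose
other entries are `0` (for `t ≤ n`). -/
def E (n t : ℕ) : Mat n := Matrix.of fun i j => if j.val = i.val + (n - t) then 1 else 0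

end

end QuantumMatrix

/-! Let M = det_q(t), with rows I = {1,…,t} and columns J = {n-t+1,…,n}. Because M sits in the upper
right corner, it q-commutes with every generator: M Z_{ik} = q^{2([k∈J]-[i∈I])} Z_{ik} M. Hence it
q-commutes with everything homogeneous for row and column sums, and M b(A) = q^{2e} b(A) M with e =
∑_J c_j - ∑_I r_i. Since M and b(A) are bar-invariant and bar reverses products, q^{-e} M b(A) is
bar-invariant. A bar-invariant element congruent to Z(B) modulo qL^* equals b(B)
(`IsDualCanonicalBasis.eq_of_sub_mem`), so it remains to see that q^{-e} M b(A) ≡ Z(A+E_t) modulo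
qL^*.

The congruence rests on two statements about minors with rows r,…,t-1 (counted from 0) and matrices
A that vanish above row r. By `minor_mul_ZN_mem`, the normalized product of such a minor, with
arbitrary columns, and Z(A) lies in the lattice; by `corner_minor_mul_ZN`, for the last columns it
is Z(A + rows of E_t) modulo q. Both go by downward induction on r. Up to a power of q, Z(A) is a
monomial in row r times Z(A'), with A' supported below row r. The minor is moved past the row
monomial, expanded along row r, and the smaller minors act on Z(A'). Moving past the monomial uses
the exchange rule `exchange_insert_min` in general, and plain q-commutation for the last columns. In
the corner case only the smallest column contributes modulo q, every other term of the expansion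
carrying a further factor q^2.

Existence and uniqueness of B^* follow the Kazhdan–Lusztig pattern: the Z(A) are independent because
the algebra is an iterated Ore extension (`exists_coeff_monomial`), bar is unitriangular on them
(`bar_ZN_sub_mem`), and a Laurent polynomial antisymmetric under q ↦ q^{-1} has the form d - \bar d
with d in qℤ[q] (`exists_sub_barK`). The statements for σ follow by transposition, since σ(b(A)) =
b(A^T). -/

namespace QuantumMatrix
noncomputable section

/-! ### Reordering relations and the data of one Ore extension -/

/-- A family `z` of elements of a `K`-algebra satisfies the relations of `O_q(M(n))` between
those pairs of generators whose positions both lie in `S`. -/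
structure QRel {n : ℕ} {R : Type} [Ring R] [Algebra K R] (S : Fin n → Fin n → Prop)
    (z : Fin n → Fin n → R) : Prop where
  row : ∀ i j k, j < k → S i j → S i k → z i k * z i j = (q⁻¹) ^ 2 • (z i j * z i k)
  col : ∀ i j k, i < k → S i j → S k j → z k j * z i j = (q⁻¹) ^ 2 • (z i j * z k j)
  anti : ∀ i j s t, s < i → j < t → S i j → S s t → z i j * z s t = z s t * z i j
  diag : ∀ i j s t, i < s → j < t → S i j → S s t →
    z s t * z i j = z i j * z s t - (q ^ 2 - (q⁻¹) ^ 2) • (z i t * z s j)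

/-- The positions that precede `(s, t)` in the lexicographic order. -/
def Before {n : ℕ} (s t i j : Fin n) : Prop := i < s ∨ i = s ∧ j < t

set_option linter.unusedSimpArgs false

section Ore

variable {n : ℕ} {R : Type} [Ring R] [Algebra K R] {S : Fin n → Fin n → Prop}
  {z : Fin n → Fin n → R}

theorem QRel.row_assoc (h : QRel S z) (i j k) (hjk : j < k) (h₁ : S i j) (h₂ : S i k) (w : R) :
    z i k * (z i j * w) = (q⁻¹) ^ 2 • (z i j * (z i k * w)) := by
  rw [← mul_assoc, h.row i j k hjk h₁ h₂, smul_mul_assoc, mul_assoc]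

theorem QRel.col_assoc (h : QRel S z) (i j k) (hik : i < k) (h₁ : S i j) (h₂ : S k j) (w : R) :
    z k j * (z i j * w) = (q⁻¹) ^ 2 • (z i j * (z k j * w)) := by
  rw [← mul_assoc, h.col i j k hik h₁ h₂, smul_mul_assoc, mul_assoc]

/-- The scalar `1` makes the commutation an oriented rule like the other three; a bare commutation
has two sides that differ only by renaming. -/
theorem QRel.anti_assoc (h : QRel S z) (i j s t) (hs : s < i) (ht : j < t) (h₁ : S i j)
    (h₂ : S s t) (w : R) : z i j * (z s t * w) = (1 : K) • (z s t * (z i j * w)) := by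
  rw [← mul_assoc, h.anti i j s t hs ht h₁ h₂, mul_assoc, one_smul]

theorem QRel.anti_smul (h : QRel S z) (i j s t) (hs : s < i) (ht : j < t) (h₁ : S i j)
    (h₂ : S s t) : z i j * z s t = (1 : K) • (z s t * z i j) := by
  rw [h.anti i j s t hs ht h₁ h₂, one_smul]

theorem QRel.diag_assoc (h : QRel S z) (i j s t) (hs : i < s) (ht : j < t) (h₁ : S i j)
    (h₂ : S s t) (w : R) : z s t * (z i j * w) =
      z i j * (z s t * w) - (q ^ 2 - (q⁻¹) ^ 2) • (z i t * (z s j * w)) := by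
  rw [← mul_assoc, h.diag i j s t hs ht h₁ h₂, sub_mul, smul_mul_assoc, mul_assoc, mul_assoc]


/-- The scalar by which the automorphism of the Ore extension by `Z_{st}` acts on `Z_{ij}`. -/
def oreTau (s t i j : Fin n) : K :=
  (if i = s then (q⁻¹) ^ 2 else 1) * (if j = t then (q⁻¹) ^ 2 else 1)

/-- The value at `Z_{ij}` of the skew derivation of the Ore extension by `Z_{st}`. -/
def oreDelta (s t : Fin n) (z : Fin n → Fin n → R) (i j : Fin n) : R :=
  if i < s ∧ j < t then -((q ^ 2 - (q⁻¹) ^ 2) • (z i t * z s j)) else 0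

variable {s t : Fin n}

-- A τ-derivation satisfies δ(fg) = τ(f)δ(g) + δ(f)g. This lemma and the next three check that the
-- values prescribed on generators are compatible with the four kinds of relation; the cases are the
-- positions of the letters relative to row s and column t.
set_option maxHeartbeats 1000000 in
theorem oreDelta_row (h : QRel (Before s t) z) (i j k : Fin n) (hjk : j < k)
    (hik : Before s t i k) :
    oreTau s t i k • (z i k * oreDelta s t z i j) + oreDelta s t z i k * z i j =
      (q⁻¹) ^ 2 • (oreTau s t i j • (z i j * oreDelta s t z i k) +
        oreDelta s t z i j * z i k) := by
  have hq := q_ne_zero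
  rcases hik with hi | ⟨hi, hk⟩ <;> rcases lt_trichotomy k t with hk | hk | hk <;> rcases lt_trichotomy j t with hj | hj | hj <;>
    simp only [oreTau, oreDelta] <;> repeat' split_ifs
  all_goals first
    | omega
    | simp only [mul_zero, zero_mul, add_zero, smul_zero, sub_zero]; done
    | (subst_vars
       try simp (disch := first | omega | (unfold Before; omega)) only [h.row, h.col,
        h.anti_smul, h.diag, h.row_assoc, h.col_assoc, h.anti_assoc, h.diag_assoc, mul_neg,
        neg_mul, mul_assoc, smul_mul_assoc, mul_smul_comm, sub_mul, mul_sub, mul_zero, zero_mul]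
       try (match_scalars <;> field_simp <;> ring))

set_option maxHeartbeats 1000000 in
theorem oreDelta_col (h : QRel (Before s t) z) (i j k : Fin n) (hik : i < k)
    (hkj : Before s t k j) :
    oreTau s t k j • (z k j * oreDelta s t z i j) + oreDelta s t z k j * z i j =
      (q⁻¹) ^ 2 • (oreTau s t i j • (z i j * oreDelta s t z k j) +
        oreDelta s t z i j * z k j) := by
  have hq := q_ne_zero
  rcases hkj with hi | ⟨hi, hk⟩ <;> rcases lt_trichotomy j t with hj | hj | hj <;>
    simp only [oreTau, oreDelta] <;> repeat' split_ifs
  all_goals first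
    | omega
    | simp only [mul_zero, zero_mul, add_zero, smul_zero, sub_zero]; done
    | (subst_vars
       try simp (disch := first | omega | (unfold Before; omega)) only [h.row, h.col,
        h.anti_smul, h.diag, h.row_assoc, h.col_assoc, h.anti_assoc, h.diag_assoc, mul_neg,
        neg_mul, mul_assoc, smul_mul_assoc, mul_smul_comm, sub_mul, mul_sub, mul_zero, zero_mul]
       try (match_scalars <;> field_simp <;> ring))

set_option maxHeartbeats 1000000 in
theorem oreDelta_anti (h : QRel (Before s t) z) (i j k l : Fin n) (hki : k < i) (hjl : j < l)
    (hij : Before s t i j) :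
    oreTau s t i j • (z i j * oreDelta s t z k l) + oreDelta s t z i j * z k l =
      oreTau s t k l • (z k l * oreDelta s t z i j) + oreDelta s t z k l * z i j := by
  have hq := q_ne_zero
  rcases hij with hi | ⟨hi, hk⟩ <;> rcases lt_trichotomy j t with hj | hj | hj <;>
    rcases lt_trichotomy l t with hl | hl | hl <;>
    simp only [oreTau, oreDelta] <;> repeat' split_ifs
  all_goals first
    | omega
    | simp only [mul_zero, zero_mul, add_zero, smul_zero, sub_zero]; done
    | (subst_vars
       try simp (disch := first | omega | (unfold Before; omega)) only [h.row, h.col,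
        h.anti_smul, h.diag, h.row_assoc, h.col_assoc, h.anti_assoc, h.diag_assoc, mul_neg,
        neg_mul, mul_assoc, smul_mul_assoc, mul_smul_comm, sub_mul, mul_sub, mul_zero, zero_mul]
       try (match_scalars <;> field_simp))

set_option maxHeartbeats 1000000 in
theorem oreDelta_diag (h : QRel (Before s t) z) (i j k l : Fin n) (hik : i < k) (hjl : j < l)
    (hkl : Before s t k l) :
    oreTau s t k l • (z k l * oreDelta s t z i j) + oreDelta s t z k l * z i j =
      oreTau s t i j • (z i j * oreDelta s t z k l) + oreDelta s t z i j * z k l -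
      (q ^ 2 - (q⁻¹) ^ 2) • (oreTau s t i l • (z i l * oreDelta s t z k j) +
        oreDelta s t z i l * z k j) := by
  have hq := q_ne_zero
  rcases hkl with hi | ⟨hi, hk⟩ <;> rcases lt_trichotomy j t with hj | hj | hj <;>
    rcases lt_trichotomy l t with hl | hl | hl <;>
    simp only [oreTau, oreDelta] <;> repeat' split_ifs
  all_goals first
    | omega
    | simp only [mul_zero, zero_mul, add_zero, smul_zero, sub_zero]; done
    | (subst_vars
       try simp (disch := first | omega | (unfold Before; omega)) only [h.row, h.col,
        h.anti_smul, h.diag, h.row_assoc, h.col_assoc, h.anti_assoc, h.diag_assoc, mul_neg,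
        neg_mul, mul_assoc, smul_mul_assoc, mul_smul_comm, sub_mul, mul_sub, mul_zero, zero_mul]
       try (match_scalars <;> field_simp <;> ring))
end Ore
end
end QuantumMatrix

/-! ### Algebras presented by part of the relations, and the triangular representation on pairs -/

namespace QuantumMatrix
noncomputable section

section Presented

variable {n : ℕ} {R : Type} [Ring R] [Algebra K R] {S : Fin n → Fin n → Prop}
  {z : Fin n → Fin n → R}

/-- The relations of `QRel S` on the free algebra. -/
inductive RelOn (S : Fin n → Fin n → Prop) :
    FreeAlgebra K (Fin n × Fin n) → FreeAlgebra K (Fin n × Fin n) → Prop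
  | row (i j k : Fin n) (h : j < k) (h₁ : S i j) (h₂ : S i k) :
      RelOn S (FreeAlgebra.ι K (i, k) * FreeAlgebra.ι K (i, j))
        ((q⁻¹) ^ 2 • (FreeAlgebra.ι K (i, j) * FreeAlgebra.ι K (i, k)))
  | col (i j k : Fin n) (h : i < k) (h₁ : S i j) (h₂ : S k j) :
      RelOn S (FreeAlgebra.ι K (k, j) * FreeAlgebra.ι K (i, j))
        ((q⁻¹) ^ 2 • (FreeAlgebra.ι K (i, j) * FreeAlgebra.ι K (k, j)))
  | anti (i j s t : Fin n) (h : s < i) (h' : j < t) (h₁ : S i j) (h₂ : S s t) :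
      RelOn S (FreeAlgebra.ι K (i, j) * FreeAlgebra.ι K (s, t))
        (FreeAlgebra.ι K (s, t) * FreeAlgebra.ι K (i, j))
  | diag (i j s t : Fin n) (h : i < s) (h' : j < t) (h₁ : S i j) (h₂ : S s t) :
      RelOn S (FreeAlgebra.ι K (s, t) * FreeAlgebra.ι K (i, j))
        (FreeAlgebra.ι K (i, j) * FreeAlgebra.ι K (s, t)
          - (q ^ 2 - (q⁻¹) ^ 2) • (FreeAlgebra.ι K (i, t) * FreeAlgebra.ι K (s, j)))

variable (S) in
/-- The algebra presented by the relations between the generators in `S`. -/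
def QAlg : Type := RingQuot (RelOn S)

instance : Ring (QAlg S) := inferInstanceAs (Ring (RingQuot (RelOn S)))

instance : Algebra K (QAlg S) := inferInstanceAs (Algebra K (RingQuot (RelOn S)))

namespace QAlg

variable (S) in
/-- The quotient map from the free algebra. -/
def mk : FreeAlgebra K (Fin n × Fin n) →ₐ[K] QAlg S := RingQuot.mkAlgHom K (RelOn S)

variable (S) in
/-- The generators. -/
def gen (i j : Fin n) : QAlg S := mk S (FreeAlgebra.ι K (i, j))

theorem mk_rel {x y : FreeAlgebra K (Fin n × Fin n)} (h : RelOn S x y) : mk S x = mk S y :=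
  RingQuot.mkAlgHom_rel K h

theorem gen_qRel : QRel S (gen S) where
  row i j k h h₁ h₂ := by simpa [gen] using mk_rel (RelOn.row i j k h h₁ h₂)
  col i j k h h₁ h₂ := by simpa [gen] using mk_rel (RelOn.col i j k h h₁ h₂)
  anti i j s t h h' h₁ h₂ := by simpa [gen] using mk_rel (RelOn.anti i j s t h h' h₁ h₂)
  diag i j s t h h' h₁ h₂ := by
    simpa only [gen, map_mul, map_sub, map_smul] using mk_rel (RelOn.diag i j s t h h' h₁ h₂)

/-- The universal property. -/
def lift (h : QRel S z) : QAlg S →ₐ[K] R :=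
  RingQuot.liftAlgHom K ⟨FreeAlgebra.lift K fun p => z p.1 p.2, by
    intro x y r
    cases r with
    | row i j k h' h₁ h₂ => simpa using h.row i j k h' h₁ h₂
    | col i j k h' h₁ h₂ => simpa using h.col i j k h' h₁ h₂
    | anti i j s t h' h'' h₁ h₂ => simpa using h.anti i j s t h' h'' h₁ h₂
    | diag i j s t h' h'' h₁ h₂ =>
      simpa only [map_mul, map_sub, map_smul, FreeAlgebra.lift_ι_apply]
        using h.diag i j s t h' h'' h₁ h₂⟩

theorem lift_gen (h : QRel S z) (i j : Fin n) : lift h (gen S i j) = z i j := by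
  have : lift h (mk S (FreeAlgebra.ι K (i, j))) =
      FreeAlgebra.lift K (fun p : Fin n × Fin n => z p.1 p.2) (FreeAlgebra.ι K (i, j)) :=
    RingQuot.liftAlgHom_mkAlgHom_apply K _ _ _
  rw [gen, this, FreeAlgebra.lift_ι_apply]

theorem induction {P : QAlg S → Prop} (algebraMap : ∀ c : K, P (algebraMap K _ c))
    (gen : ∀ i j, P (gen S i j)) (mul : ∀ a b, P a → P b → P (a * b))
    (add : ∀ a b, P a → P b → P (a + b)) (x : QAlg S) : P x := by
  obtain ⟨y, rfl⟩ := RingQuot.mkAlgHom_surjective K (RelOn S) x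
  change P (mk S y)
  induction y using FreeAlgebra.induction with
  | grade0 c => rw [AlgHom.commutes]; exact algebraMap c
  | grade1 p => exact gen p.1 p.2
  | mul a b ha hb => rw [map_mul]; exact mul _ _ ha hb
  | add a b ha hb => rw [map_add]; exact add _ _ ha hb

end QAlg

/-- All monomials of the diagonal relation have the same τ-weight, so τ respects that relation. -/
theorem oreTau_mul (s t i j k l : Fin n) :
    oreTau s t k l * oreTau s t i j = oreTau s t i l * oreTau s t k j := by
  unfold oreTau; ring

/-- The action of `Z_{ij}` on pairs through the matrix with rows `(τ z, δ)` and `(0, z)`. -/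
def orePair (s t : Fin n) (z : Fin n → Fin n → R) (i j : Fin n) : Module.End K (R × R) :=
  LinearMap.prod
    (oreTau s t i j • (LinearMap.mulLeft K (z i j)).comp (LinearMap.fst K R R) +
      (LinearMap.mulLeft K (oreDelta s t z i j)).comp (LinearMap.snd K R R))
    ((LinearMap.mulLeft K (z i j)).comp (LinearMap.snd K R R))

theorem orePair_apply (s t : Fin n) (z : Fin n → Fin n → R) (i j : Fin n) (u : R × R) :
    orePair s t z i j u =
      (oreTau s t i j • (z i j * u.1) + oreDelta s t z i j * u.2, z i j * u.2) := rfl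

/-- The matrix with rows (τ f, δ f) and (0, f) is multiplicative in f exactly when τ is
multiplicative and δ is a τ-derivation. A representation on pairs therefore extends τ and δ from the
generators at once, the off-diagonal entries being the identities for δ. -/
theorem orePair_qRel {s t : Fin n} (h : QRel (Before s t) z) :
    QRel (Before s t) (orePair s t z) where
  row i j k hjk h₁ h₂ := by
    refine LinearMap.ext fun u => ?_
    have e := congrArg (· * u.2) (oreDelta_row h i j k hjk h₂)
    have e' := h.row_assoc i j k hjk h₁ h₂
    simp only [Module.End.mul_apply, LinearMap.smul_apply, orePair_apply, Prod.smul_mk, e']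
    congr 1
    simp only [add_mul, smul_mul_assoc, mul_assoc, mul_add, mul_smul_comm, e'] at e ⊢
    linear_combination (norm := module) e
  col i j k hik h₁ h₂ := by
    refine LinearMap.ext fun u => ?_
    have e := congrArg (· * u.2) (oreDelta_col h i j k hik h₂)
    have e' := h.col_assoc i j k hik h₁ h₂
    simp only [Module.End.mul_apply, LinearMap.smul_apply, orePair_apply, Prod.smul_mk, e']
    congr 1
    simp only [add_mul, smul_mul_assoc, mul_assoc, mul_add, mul_smul_comm, e'] at e ⊢
    linear_combination (norm := module) e
  anti i j k l hki hjl h₁ h₂ := by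
    refine LinearMap.ext fun u => ?_
    have e := congrArg (· * u.2) (oreDelta_anti h i j k l hki hjl h₁)
    have e' : ∀ w, z i j * (z k l * w) = z k l * (z i j * w) := fun w => by
      rw [h.anti_assoc i j k l hki hjl h₁ h₂, one_smul]
    simp only [Module.End.mul_apply, orePair_apply, e']
    congr 1
    simp only [add_mul, smul_mul_assoc, mul_assoc, mul_add, mul_smul_comm, e'] at e ⊢
    linear_combination (norm := module) e
  diag i j k l hik hjl h₁ h₂ := by
    refine LinearMap.ext fun u => ?_
    have e := congrArg (· * u.2) (oreDelta_diag h i j k l hik hjl h₂)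
    have e' := h.diag_assoc i j k l hik hjl h₁ h₂
    have e'' := oreTau_mul s t i j k l
    simp only [Module.End.mul_apply, LinearMap.smul_apply, LinearMap.sub_apply, orePair_apply,
      Prod.smul_mk, Prod.mk_sub_mk, e']
    congr 1
    simp only [add_mul, sub_mul, smul_mul_assoc, mul_assoc, mul_add, mul_smul_comm, e', smul_add,
      smul_sub, smul_smul] at e ⊢
    linear_combination (norm := module) e - ((q ^ 2 - (q⁻¹) ^ 2) * e'') • (z i l * (z k j * u.1))

end Presented
end
end QuantumMatrix

/-! ### One step of the iterated Ore extension -/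

namespace QuantumMatrix
noncomputable section

section OreStep

variable {n : ℕ} (s t : Fin n)

/-- The homomorphism `f ↦ (τ f, δ f; 0, f)` to the endomorphisms of the module of pairs. -/
def orePairHom : QAlg (Before s t) →ₐ[K] Module.End K (QAlg (Before s t) × QAlg (Before s t)) :=
  QAlg.lift (orePair_qRel QAlg.gen_qRel)

/-- The automorphism (as a linear map) of the Ore extension by `Z_{st}`. -/
def oreAut : QAlg (Before s t) →ₗ[K] QAlg (Before s t) :=
  (LinearMap.fst K _ _).comp
    (((LinearMap.applyₗ (R := K) (1, 0)).comp (orePairHom s t).toLinearMap))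

/-- The skew derivation of the Ore extension by `Z_{st}`. -/
def oreDer : QAlg (Before s t) →ₗ[K] QAlg (Before s t) :=
  (LinearMap.fst K _ _).comp
    (((LinearMap.applyₗ (R := K) (0, 1)).comp (orePairHom s t).toLinearMap))

variable {s t}

theorem orePairHom_gen (i j : Fin n) :
    orePairHom s t (QAlg.gen _ i j) = orePair s t (QAlg.gen _) i j :=
  QAlg.lift_gen _ i j

/-- The lower row of the triangular matrix is left multiplication; with it the product rules for
`oreAut` and `oreDer` are read off the first coordinate. -/
theorem orePairHom_snd (f : QAlg (Before s t)) (u : QAlg (Before s t) × QAlg (Before s t)) :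
    (orePairHom s t f u).2 = f * u.2 := by
  induction f using QAlg.induction generalizing u with
  | algebraMap c => rw [AlgHom.commutes]; exact Algebra.smul_def c u.2
  | gen i j => rw [orePairHom, QAlg.lift_gen]; rfl
  | mul a b ha hb => rw [map_mul, Module.End.mul_apply, ha, hb, mul_assoc]
  | add a b ha hb => rw [map_add, LinearMap.add_apply, Prod.snd_add, ha, hb, add_mul]

theorem oreAut_one : oreAut s t 1 = 1 := by
  change (orePairHom s t 1 (1, 0)).1 = _
  rw [map_one]; rfl

theorem oreDer_one : oreDer s t 1 = 0 := by
  change (orePairHom s t 1 (0, 1)).1 = _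
  rw [map_one]; rfl

theorem oreAut_gen_mul (i j : Fin n) (f : QAlg (Before s t)) :
    oreAut s t (QAlg.gen _ i j * f) = oreTau s t i j • (QAlg.gen _ i j * oreAut s t f) := by
  change (orePairHom s t (_ * f) (1, 0)).1 = _ • (_ * (orePairHom s t f (1, 0)).1)
  rw [map_mul, Module.End.mul_apply, orePairHom_gen, orePair_apply, orePairHom_snd, mul_zero,
    mul_zero, add_zero]

theorem oreDer_gen_mul (i j : Fin n) (f : QAlg (Before s t)) :
    oreDer s t (QAlg.gen _ i j * f) = oreTau s t i j • (QAlg.gen _ i j * oreDer s t f) +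
      oreDelta s t (QAlg.gen _) i j * f := by
  change (orePairHom s t (_ * f) (0, 1)).1 = _ • (_ * (orePairHom s t f (0, 1)).1) + _
  rw [map_mul, Module.End.mul_apply, orePairHom_gen, orePair_apply, orePairHom_snd, mul_one]

variable (s t) in
/-- The action of the new variable on the Ore extension, realised on finitely supported
sequences of coefficients. -/
def oreX : Module.End K (ℕ →₀ QAlg (Before s t)) :=
  Finsupp.lsum K fun m =>
    (Finsupp.lsingle (m + 1)).comp (oreAut s t) + (Finsupp.lsingle m).comp (oreDer s t)

theorem oreX_single (m : ℕ) (a : QAlg (Before s t)) :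
    oreX s t (Finsupp.single m a) =
      Finsupp.single (m + 1) (oreAut s t a) + Finsupp.single m (oreDer s t a) := by
  simp [oreX]

/-- The left regular action on coefficients. -/
def oreL {A : Type} [Ring A] [Algebra K A] : A →ₐ[K] Module.End K (ℕ →₀ A) :=
  AlgHom.ofLinearMap
    { toFun := fun a => Finsupp.mapRange.linearMap (LinearMap.mulLeft K a)
      map_add' := fun a b => LinearMap.ext fun f => Finsupp.ext fun m => by simp [add_mul]
      map_smul' := fun c a => LinearMap.ext fun f => Finsupp.ext fun m => by simp }
    (LinearMap.ext fun f => Finsupp.ext fun m => by simp)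
    (fun a b => LinearMap.ext fun f => Finsupp.ext fun m => by simp)

theorem oreL_single {A : Type} [Ring A] [Algebra K A] (a : A) (m : ℕ) (b : A) :
    oreL a (Finsupp.single m b) = Finsupp.single m (a * b) := by
  change Finsupp.mapRange.linearMap (LinearMap.mulLeft K a) _ = _
  simp

/-- This is the Ore rule X f = τ(f) X + δ(f) for a generator f, in the module whose coefficients
stand to the left of the powers of X. -/
theorem oreX_mul_oreL (i j : Fin n) :
    oreX s t * oreL (QAlg.gen _ i j) =
      oreTau s t i j • (oreL (QAlg.gen _ i j) * oreX s t) +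
        oreL (oreDelta s t (QAlg.gen _) i j) := by
  refine Finsupp.lhom_ext fun m a => ?_
  simp only [Module.End.mul_apply, LinearMap.add_apply, LinearMap.smul_apply, oreL_single,
    oreX_single, oreAut_gen_mul, oreDer_gen_mul, map_add, Finsupp.single_add, smul_add,
    Finsupp.smul_single]
  abel

variable (s t) in
/-- The generators of the Ore extension by `Z_{st}`. -/
def oreGen (i j : Fin n) : Module.End K (ℕ →₀ QAlg (Before s t)) :=
  if i = s ∧ j = t then oreX s t else oreL (QAlg.gen _ i j)

theorem oreGen_self : oreGen s t s t = oreX s t := by simp [oreGen]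

theorem oreGen_of_before {i j : Fin n} (h : Before s t i j) :
    oreGen s t i j = oreL (QAlg.gen _ i j) := by
  rw [oreGen, if_neg]
  rintro ⟨rfl, rfl⟩
  simp [Before] at h

/-- Relations without the new letter hold among the coefficients; those with it are the Ore rule
with the values of `oreTau` and `oreDelta` inserted. -/
theorem oreGen_qRel : QRel (fun i j => Before s t i j ∨ i = s ∧ j = t) (oreGen s t) := by
  have hg := QAlg.gen_qRel (S := Before s t)
  constructor
  · intro i j k hjk h₁ h₂
    have h₃ : Before s t i j := by simp only [Before] at *; omega
    rw [oreGen_of_before h₃]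
    rcases h₂ with h₂ | ⟨rfl, rfl⟩
    · rw [oreGen_of_before h₂, ← map_mul, hg.row i j k hjk h₃ h₂, map_smul, map_mul]
    · rw [oreGen_self, oreX_mul_oreL]
      simp [oreTau, oreDelta, hjk.ne]
  · intro i j k hjk h₁ h₂
    have h₃ : Before s t i j := by simp only [Before] at *; omega
    rw [oreGen_of_before h₃]
    rcases h₂ with h₂ | ⟨rfl, rfl⟩
    · rw [oreGen_of_before h₂, ← map_mul, hg.col i j k hjk h₃ h₂, map_smul, map_mul]
    · rw [oreGen_self, oreX_mul_oreL]
      simp [oreTau, oreDelta, hjk.ne]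
  · intro i j k l hki hjl h₂ h₁
    have h₃ : Before s t k l := by simp only [Before] at *; omega
    rw [oreGen_of_before h₃]
    rcases h₂ with h₂ | ⟨rfl, rfl⟩
    · rw [oreGen_of_before h₂, ← map_mul, hg.anti i j k l hki hjl h₂ h₃, map_mul]
    · rw [oreGen_self, oreX_mul_oreL]
      simp [oreTau, oreDelta, hki.ne, hjl.ne', hjl.not_gt]
  · intro i j k l hik hjl h₁ h₂
    have h₃ : Before s t i j := by simp only [Before] at *; omega
    have h₄ : Before s t i l := by simp only [Before] at *; omega
    have h₅ : Before s t k j := by simp only [Before] at *; omega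
    rw [oreGen_of_before h₃, oreGen_of_before h₄, oreGen_of_before h₅]
    rcases h₂ with h₂ | ⟨rfl, rfl⟩
    · rw [oreGen_of_before h₂, ← map_mul, hg.diag i j k l hik hjl h₃ h₂, map_sub, map_smul,
        map_mul, map_mul]
    · rw [oreGen_self, oreX_mul_oreL]
      simp only [oreTau, hik.ne, hjl.ne, if_false, one_mul, one_smul, oreDelta, hik, hjl,
        and_self, if_true, map_neg, map_smul, map_mul, sub_eq_add_neg]

theorem oreX_pow_one (m : ℕ) :
    (oreX s t ^ m) (Finsupp.single 0 1) = Finsupp.single m 1 := by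
  induction m with
  | zero => rfl
  | succ m ih => rw [pow_succ', Module.End.mul_apply, ih, oreX_single, oreAut_one, oreDer_one]; simp

end OreStep

/-! ### Linear independence of the ordered monomials -/

section Monomials

variable {n : ℕ}

/-- The ordered product of the powers `z_{ij}^{a_{ij}}` over the first `k` positions `(i, j)` in
the lexicographic order. -/
def monomialUpTo {R : Type} [Monoid R] (z : Fin n → Fin n → R) (A : Mat n) (k : ℕ) : R :=
  ((List.range k).map fun m => if h : m < n * n then
    z (finProdFinEquiv.symm ⟨m, h⟩).1 (finProdFinEquiv.symm ⟨m, h⟩).2 ^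
      A (finProdFinEquiv.symm ⟨m, h⟩).1 (finProdFinEquiv.symm ⟨m, h⟩).2 else 1).prod

theorem before_iff (s t i j : Fin n) :
    Before s t i j ↔ (finProdFinEquiv (i, j) : ℕ) < finProdFinEquiv (s, t) := by
  simp only [finProdFinEquiv_apply_val, Before, Fin.lt_def, Fin.ext_iff]
  have := i.2; have := j.2; have := s.2; have := t.2
  constructor
  · rintro (h | ⟨h, h'⟩)
    · nlinarith
    · rw [h]; omega
  · intro h
    rcases lt_trichotomy i.val s.val with h' | h' | h'
    · exact Or.inl h'
    · rw [h'] at h; exact Or.inr ⟨h', by omega⟩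
    · nlinarith

theorem monomialUpTo_succ {R : Type} [Monoid R] (z : Fin n → Fin n → R) (A : Mat n) (s t : Fin n) :
    monomialUpTo z A ((finProdFinEquiv (s, t) : ℕ) + 1) =
      monomialUpTo z A (finProdFinEquiv (s, t)) * z s t ^ A s t := by
  rw [monomialUpTo, List.range_succ, List.map_append, List.prod_append, List.map_singleton,
    List.prod_singleton, dif_pos (finProdFinEquiv (s, t)).2]
  simp only [Fin.eta, Equiv.symm_apply_apply]
  rfl

theorem monomialUpTo_congr {R R' : Type} [Monoid R] [Monoid R'] (f : R →* R')
    (z : Fin n → Fin n → R) (z' : Fin n → Fin n → R') (A A' : Mat n) (k : ℕ)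
    (h : ∀ i j, (finProdFinEquiv (i, j) : ℕ) < k → f (z i j) = z' i j ∧ A i j = A' i j) :
    f (monomialUpTo z A k) = monomialUpTo z' A' k := by
  rw [monomialUpTo, monomialUpTo, map_list_prod, List.map_map]
  refine congrArg List.prod (List.map_congr_left fun m hm => ?_)
  rw [List.mem_range] at hm
  rw [Function.comp_apply]
  split_ifs with hm'
  · obtain ⟨h₁, h₂⟩ := h (finProdFinEquiv.symm ⟨m, hm'⟩).1 (finProdFinEquiv.symm ⟨m, hm'⟩).2
      (by rw [Prod.mk.eta, Equiv.apply_symm_apply]; exact hm)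
    rw [map_pow, h₁, h₂]
  · exact map_one f

/-- Induction on the number of positions, one Ore extension for each. Generators at positions from k
on are still present and free, but the monomials tested do not involve them. -/
theorem exists_coeff_monomialUpTo (k : ℕ) (hk : k ≤ n * n) :
    ∃ Ψ : QAlg (fun i j : Fin n => (finProdFinEquiv (i, j) : ℕ) < k) →ₗ[K] (Mat n →₀ K),
      ∀ A : Mat n, (∀ i j, k ≤ (finProdFinEquiv (i, j) : ℕ) → A i j = 0) →
        Ψ (monomialUpTo (QAlg.gen _) A k) = Finsupp.single A 1 := by
  induction k with
  | zero =>
    -- No relation is in force, so every generator may be sent to 0, which leaves the constant term.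
    have h : QRel (fun i j : Fin n => (finProdFinEquiv (i, j) : ℕ) < 0) (fun _ _ => (0 : K)) := by
      constructor <;> simp
    refine ⟨(Finsupp.lsingle (0 : Mat n)).comp (QAlg.lift h).toLinearMap, fun A hA => ?_⟩
    have hA' : A = 0 := Matrix.ext fun i j => hA i j (Nat.zero_le _)
    subst hA'
    simp [monomialUpTo]
  | succ k ih =>
    obtain ⟨⟨s, t⟩, hst⟩ := finProdFinEquiv.surjective (⟨k, hk⟩ : Fin (n * n))
    have hkst : k = (finProdFinEquiv (s, t) : ℕ) := by rw [hst]
    obtain ⟨Ψ, hΨ⟩ := ih (by omega)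
    have hS : (fun i j : Fin n => (finProdFinEquiv (i, j) : ℕ) < k) = Before s t := by
      funext i j
      rw [eq_iff_iff, before_iff, hkst]
    have hS' : (fun i j : Fin n => (finProdFinEquiv (i, j) : ℕ) < k + 1) =
        fun i j => Before s t i j ∨ i = s ∧ j = t := by
      funext i j
      rw [eq_iff_iff, before_iff, ← hkst, Nat.lt_succ_iff, Nat.le_iff_lt_or_eq, hkst,
        Fin.val_inj, finProdFinEquiv.apply_eq_iff_eq, Prod.mk.injEq]
    have hB : ∀ i j, (finProdFinEquiv (i, j) : ℕ) < k ↔ Before s t i j := fun i j => by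
      rw [before_iff, hkst]
    have hB' : ∀ i j, k + 1 ≤ (finProdFinEquiv (i, j) : ℕ) → ¬ Before s t i j ∧ ¬ (i = s ∧ j = t) := by
      intro i j hij
      have := congrFun (congrFun hS' i) j
      simp only [eq_iff_iff] at this
      rw [← not_or, ← this]
      omega
    rw [hS'] 
    revert Ψ
    rw [hS]
    intro Ψ hΨ
    let F := QAlg.lift (oreGen_qRel (s := s) (t := t))
    -- Acting on the constant 1 turns the ordered monomial into (earlier monomial)·X^m with m =
    -- a_{st}. The old functional is applied to the coefficient, and m is put back at position (s,
    -- t).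
    refine ⟨(Finsupp.lsum K fun m => (Finsupp.lmapDomain K K
      (fun A : Mat n => A + Matrix.single s t m)).comp Ψ).comp
        ((LinearMap.applyₗ (R := K) (Finsupp.single 0 1)).comp F.toLinearMap), fun A hA => ?_⟩
    have h₁ : F (monomialUpTo (QAlg.gen _) A (k + 1)) (Finsupp.single 0 1) =
        Finsupp.single (A s t) (monomialUpTo (QAlg.gen (Before s t))
          (A - Matrix.single s t (A s t)) k) := by
      rw [hkst, monomialUpTo_succ, map_mul, map_pow, QAlg.lift_gen, oreGen_self,
        Module.End.mul_apply, oreX_pow_one]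
      have h₂ : F (monomialUpTo (QAlg.gen _) A (finProdFinEquiv (s, t))) =
          monomialUpTo (oreGen s t) (A - Matrix.single s t (A s t)) (finProdFinEquiv (s, t)) := by
        refine monomialUpTo_congr F.toRingHom.toMonoidHom _ _ _ _ _ fun i j hij => ?_
        refine ⟨QAlg.lift_gen _ i j, ?_⟩
        rw [← hkst, hB] at hij
        have : ¬ (s = i ∧ t = j) := by
          rintro ⟨rfl, rfl⟩; simp [Before] at hij
        simp [this]
      have h₃ : oreL (monomialUpTo (QAlg.gen (Before s t)) (A - Matrix.single s t (A s t))
          (finProdFinEquiv (s, t))) =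
          monomialUpTo (oreGen s t) (A - Matrix.single s t (A s t)) (finProdFinEquiv (s, t)) := by
        refine monomialUpTo_congr (oreL (A := QAlg (Before s t))).toRingHom.toMonoidHom _ _ _ _ _ fun i j hij => ?_
        rw [← hkst, hB] at hij
        exact ⟨(oreGen_of_before hij).symm, rfl⟩
      rw [h₂, ← h₃, oreL_single, mul_one]
    simp only [LinearMap.comp_apply, AlgHom.toLinearMap_apply, LinearMap.applyₗ_apply_apply, h₁,
      Finsupp.lsum_single]
    rw [hΨ]
    · rw [Finsupp.lmapDomain_apply, Finsupp.mapDomain_single]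
      congr 1
      ext i j
      by_cases h : s = i ∧ t = j
      · obtain ⟨rfl, rfl⟩ := h; simp
      · simp [h]
    · intro i j hij
      by_cases h : s = i ∧ t = j
      · obtain ⟨rfl, rfl⟩ := h; simp
      · have : A i j = 0 := by
          apply hA
          rcases hij.lt_or_eq with h' | h'
          · exact h'
          · exfalso; apply h
            rw [hkst, Fin.val_inj, finProdFinEquiv.apply_eq_iff_eq, Prod.mk.injEq] at h'
            exact h'
        simp [this]


theorem list_prod_range_mul {R : Type} [Monoid R] (f : ℕ → R) (m n : ℕ) :
    ((List.range (m * n)).map f).prod =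
      ((List.range m).map fun i => ((List.range n).map fun j => f (i * n + j)).prod).prod := by
  induction m with
  | zero => simp
  | succ m ih =>
    rw [Nat.succ_mul, List.range_add, List.map_append, List.prod_append, ih, List.range_succ,
      List.map_append, List.prod_append, List.map_map]
    simp [Function.comp_def]

theorem list_map_finRange {R : Type} (f : ℕ → R) (n : ℕ) :
    (List.finRange n).map (fun i : Fin n => f i) = (List.range n).map f := by
  rw [← List.map_coe_finRange_eq_range, List.map_map]; rfl

theorem monomial_eq_monomialUpTo (A : Mat n) : monomial A = monomialUpTo Z A (n * n) := by
  rw [monomial, monomialUpTo, list_prod_range_mul, ← list_map_finRange]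
  refine congrArg List.prod (List.map_congr_left fun i _ => ?_)
  rw [← list_map_finRange]
  refine congrArg List.prod (List.map_congr_left fun j _ => ?_)
  have h : (i : ℕ) * n + j = (finProdFinEquiv (i, j) : ℕ) := by
    rw [finProdFinEquiv_apply_val]; ring
  rw [dif_pos (h ▸ (finProdFinEquiv (i, j)).2)]
  simp only [h, Fin.eta, Equiv.symm_apply_apply]

variable (n) in
/-- The identification of `O_q(M(n))` with the algebra with all the relations of `QRel`. -/
def toQAlg {S : Fin n → Fin n → Prop} (hS : ∀ i j, S i j) : Oq n →ₐ[K] QAlg S :=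
  lift (FreeAlgebra.lift K (fun p : Fin n × Fin n => QAlg.gen S p.1 p.2)) <| by
    have h := QAlg.gen_qRel (S := S)
    have hq := q_ne_zero
    intro x y r
    cases r with
    | row i j k h' => simp [h.row i j k h' (hS _ _) (hS _ _), smul_smul, hq]
    | col i j k h' => simp [h.col i j k h' (hS _ _) (hS _ _), smul_smul, hq]
    | anti i j s t h' h'' => simp [h.anti i j s t h' h'' (hS _ _) (hS _ _)]
    | diag i j s t h' h'' =>
      simp only [map_mul, map_add, map_smul, FreeAlgebra.lift_ι_apply,
        h.diag i j s t h' h'' (hS _ _) (hS _ _), sub_add_cancel]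

theorem toQAlg_Z {S : Fin n → Fin n → Prop} (hS : ∀ i j, S i j) (i j : Fin n) :
    toQAlg n hS (Z i j) = QAlg.gen S i j := by
  rw [toQAlg, Z, lift_mk, FreeAlgebra.lift_ι_apply]

/-- The ordered monomials are linearly independent: there are coefficient functionals. -/
theorem exists_coeff_monomial (n : ℕ) :
    ∃ Ψ : Oq n →ₗ[K] (Mat n →₀ K), ∀ A, Ψ (monomial A) = Finsupp.single A 1 := by
  obtain ⟨Ψ, hΨ⟩ := exists_coeff_monomialUpTo (n := n) (n * n) le_rfl
  refine ⟨Ψ.comp (toQAlg n fun i j => (finProdFinEquiv (i, j)).2).toLinearMap, fun A => ?_⟩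
  rw [← hΨ A fun i j h => absurd (finProdFinEquiv (i, j)).2 h.not_gt, LinearMap.comp_apply,
    monomial_eq_monomialUpTo]
  congr 1
  exact monomialUpTo_congr (toQAlg n _).toRingHom.toMonoidHom _ _ _ _ _
    fun i j _ => ⟨toQAlg_Z _ i j, rfl⟩

end Monomials
end
end QuantumMatrix

/-! ### The quantum exterior algebra, on coefficients -/

namespace QuantumMatrix
noncomputable section

section Wedge

variable {n : ℕ}

/-- Left multiplication by `∑_j f_j ξ_j` in the quantum exterior algebra, on coefficients. -/
def wedgeL (f : Fin n → Oq n) (N : Finset (Fin n) → Oq n) (J : Finset (Fin n)) : Oq n :=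
  ∑ j ∈ J, (-q ^ 2) ^ (J.filter (· < j)).card • (f j * N (J.erase j))

/-- Right multiplication by `∑_j f_j ξ_j` in the quantum exterior algebra, on coefficients. -/
def wedgeR (N : Finset (Fin n) → Oq n) (f : Fin n → Oq n) (J : Finset (Fin n)) : Oq n :=
  ∑ j ∈ J, (-q ^ 2) ^ (J.filter (j < ·)).card • (N (J.erase j) * f j)

theorem card_filter_lt_erase_of_lt {J : Finset (Fin n)} {j l : Fin n} (hj : j ∈ J) (h : j < l) :
    (J.filter (· < l)).card = ((J.erase j).filter (· < l)).card + 1 := by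
  rw [Finset.filter_erase, Finset.card_erase_add_one (by simp [hj, h])]

theorem card_filter_lt_erase_of_le {J : Finset (Fin n)} {j l : Fin n} (h : l ≤ j) :
    ((J.erase j).filter (· < l)).card = (J.filter (· < l)).card := by
  rw [Finset.filter_erase, Finset.erase_eq_of_notMem (by simp [h])]

theorem card_filter_gt_erase_of_lt {J : Finset (Fin n)} {j l : Fin n} (hj : j ∈ J) (h : l < j) :
    (J.filter (l < ·)).card = ((J.erase j).filter (l < ·)).card + 1 := by
  rw [Finset.filter_erase, Finset.card_erase_add_one (by simp [hj, h])]

theorem card_filter_gt_erase_of_le {J : Finset (Fin n)} {j l : Fin n} (h : j ≤ l) :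
    ((J.erase j).filter (l < ·)).card = (J.filter (l < ·)).card := by
  rw [Finset.filter_erase, Finset.erase_eq_of_notMem (by simp [h])]

theorem sum_erase_comm {M : Type*} [AddCommMonoid M] (J : Finset (Fin n))
    (F : Fin n → Fin n → M) :
    ∑ j ∈ J, ∑ l ∈ J.erase j, F j l = ∑ l ∈ J, ∑ j ∈ J.erase l, F j l := by
  refine Finset.sum_comm' fun j l => ?_
  simp only [Finset.mem_erase, ne_eq]
  constructor
  · rintro ⟨h, h', h''⟩; exact ⟨⟨fun e => h' e.symm, h⟩, h''⟩
  · rintro ⟨⟨h, h'⟩, h''⟩; exact ⟨h', fun e => h e.symm, h''⟩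

theorem sum_erase_eq_sum_lt {M : Type*} [AddCommMonoid M] (J : Finset (Fin n))
    (F : Fin n → Fin n → M) :
    ∑ j ∈ J, ∑ l ∈ J.erase j, F j l = ∑ j ∈ J, ∑ l ∈ J.filter (j < ·), (F j l + F l j) := by
  have h : ∀ j ∈ J, ∑ l ∈ J.erase j, F j l =
      ∑ l ∈ J.filter (j < ·), F j l + ∑ l ∈ J.filter (· < j), F j l := by
    intro j _
    rw [← Finset.sum_union]
    · refine Finset.sum_congr ?_ fun _ _ => rfl
      ext l
      simp only [Finset.mem_erase, Finset.mem_union, Finset.mem_filter]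
      constructor
      · rintro ⟨h, h'⟩
        rcases lt_or_gt_of_ne h with h | h
        · exact Or.inr ⟨h', h⟩
        · exact Or.inl ⟨h', h⟩
      · rintro (⟨h, h'⟩ | ⟨h, h'⟩)
        · exact ⟨h'.ne', h⟩
        · exact ⟨h'.ne, h⟩
    · rw [Finset.disjoint_filter]
      exact fun _ _ h => h.not_gt
  rw [Finset.sum_congr rfl h, Finset.sum_add_distrib]
  simp only [Finset.sum_add_distrib]
  congr 1
  refine Finset.sum_comm' fun j l => ?_
  simp only [Finset.mem_filter]
  tauto

/-- Associativity: the two forms multiply from opposite sides, and for each pair of chosen columns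
the exponents of -q² agree whichever column is larger. -/
theorem wedgeL_wedgeR (f g : Fin n → Oq n) (N : Finset (Fin n) → Oq n) :
    wedgeR (wedgeL f N) g = wedgeL f (wedgeR N g) := by
  funext J
  simp only [wedgeL, wedgeR, Finset.mul_sum, Finset.sum_mul, Finset.smul_sum, smul_mul_assoc,
    mul_smul_comm, smul_smul, ← pow_add]
  rw [sum_erase_comm]
  refine Finset.sum_congr rfl fun j hj => Finset.sum_congr rfl fun l hl => ?_
  rw [Finset.erase_right_comm, mul_assoc]
  congr 2
  obtain ⟨hlj, hl⟩ := Finset.mem_erase.1 hl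
  rcases lt_or_gt_of_ne hlj with h | h
  · rw [card_filter_gt_erase_of_lt hj h, card_filter_lt_erase_of_lt hl h]
    ring
  · rw [card_filter_gt_erase_of_le h.le, card_filter_lt_erase_of_le h.le, add_comm]

/-- For j < l one has ξ_l ξ_j = -q² ξ_j ξ_l, so a product of two forms has coefficient f_j g_l - q²
f_l g_j at ξ_j ξ_l and depends on nothing else about f and g. -/
theorem wedgeL_wedgeL_congr {f g f' g' : Fin n → Oq n} (N : Finset (Fin n) → Oq n) (a : K)
    (h : ∀ j l, j < l → f j * g l - q ^ 2 • (f l * g j) =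
      a • (f' j * g' l - q ^ 2 • (f' l * g' j))) :
    wedgeL f (wedgeL g N) = a • wedgeL f' (wedgeL g' N) := by
  have key : ∀ (f g : Fin n → Oq n) J, wedgeL f (wedgeL g N) J =
      ∑ j ∈ J, ∑ l ∈ J.filter (j < ·), (-q ^ 2) ^ ((J.filter (· < j)).card +
        ((J.erase j).filter (· < l)).card) •
          ((f j * g l - q ^ 2 • (f l * g j)) * N ((J.erase j).erase l)) := by
    intro f g J
    simp only [wedgeL, Finset.mul_sum, Finset.smul_sum, mul_smul_comm, smul_smul, ← pow_add]
    rw [sum_erase_eq_sum_lt]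
    refine Finset.sum_congr rfl fun j hj => Finset.sum_congr rfl fun l hl => ?_
    obtain ⟨hl, hjl⟩ := Finset.mem_filter.1 hl
    rw [Finset.erase_right_comm (a := l), card_filter_lt_erase_of_lt hj hjl,
      card_filter_lt_erase_of_le hjl.le, sub_mul, smul_sub, smul_mul_assoc, smul_smul, mul_assoc,
      mul_assoc, sub_eq_add_neg, ← neg_smul]
    congr 2
    ring
  funext J
  rw [key, Pi.smul_apply, key, Finset.smul_sum]
  refine Finset.sum_congr rfl fun j hj => ?_
  rw [Finset.smul_sum]
  refine Finset.sum_congr rfl fun l hl => ?_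
  rw [h j l (Finset.mem_filter.1 hl).2, smul_mul_assoc, smul_comm]

theorem wedgeL_smul (f : Fin n → Oq n) (N : Finset (Fin n) → Oq n) (a : K) :
    wedgeL f (a • N) = a • wedgeL f N := by
  funext J
  simp only [wedgeL, Pi.smul_apply, Finset.smul_sum, mul_smul_comm]
  exact Finset.sum_congr rfl fun j _ => smul_comm _ _ _

theorem wedgeL_zero (f : Fin n → Oq n) : wedgeL f 0 = 0 := by
  funext J
  simp [wedgeL]

end Wedge

/-! ### Quantum minors as products of row forms -/

section Minor

variable {n : ℕ}

/-- The quantum minors with rows in a list, by expansion along the first row. -/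
def minorList : List (Fin n) → Finset (Fin n) → Oq n
  | [] => fun J => if J = ∅ then 1 else 0
  | i :: l => wedgeL (Z i) (minorList l)

/-- The quantum minor with rows `I` and columns `J`. -/
def minor (I : Finset (Fin n)) : Finset (Fin n) → Oq n := minorList (I.sort (· ≤ ·))

theorem minor_empty (J : Finset (Fin n)) : minor ∅ J = if J = ∅ then 1 else 0 := by
  simp [minor, minorList]

theorem minor_insert_min {a : Fin n} {I : Finset (Fin n)} (h : ∀ b ∈ I, a < b) :
    minor (insert a I) = wedgeL (Z a) (minor I) := by
  rw [minor, Finset.sort_insert (· ≤ ·) (fun b hb => (h b hb).le) fun ha => (h a ha).false]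
  rfl

/-- Associativity carries the last row form through the expansion along the earlier rows, so the
same minor also expands on the right along its last row. -/
theorem minor_insert_max {a : Fin n} {I : Finset (Fin n)} (h : ∀ b ∈ I, b < a) :
    minor (insert a I) = wedgeR (minor I) (Z a) := by
  induction I using Finset.induction_on_min with
  | empty =>
    rw [minor_insert_min (by simp)]
    funext J
    simp only [wedgeL, wedgeR, minor_empty]
    refine Finset.sum_congr rfl fun j hj => ?_
    split_ifs with h
    · have : J = {j} := by
        rw [← Finset.insert_erase hj, h]; rfl
      subst this
      simp [Finset.filter_singleton]
    · simp
  | insert b I hb ih =>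
    rw [Finset.insert_comm, minor_insert_min, ih, minor_insert_min hb, wedgeL_wedgeR]
    · exact fun x hx => h x (Finset.mem_insert_of_mem hx)
    · intro x hx
      rcases Finset.mem_insert.1 hx with rfl | hx
      · exact h b (Finset.mem_insert_self _ _)
      · exact hb x hx

theorem minor_eq_zero {I J : Finset (Fin n)} (h : I.card ≠ J.card) : minor I J = 0 := by
  induction I using Finset.induction_on_min generalizing J with
  | empty => rw [minor_empty, if_neg]; rintro rfl; simp at h
  | insert a I ha ih =>
    rw [minor_insert_min ha, wedgeL]
    refine Finset.sum_eq_zero fun j hj => ?_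
    rw [ih, mul_zero, smul_zero]
    rw [Finset.card_insert_of_notMem fun h' => (ha a h').false] at h
    rw [Finset.card_erase_of_mem hj]
    have := Finset.card_pos.2 ⟨j, hj⟩
    omega

/-- The row forms ω_i = ∑_j Z_{ij} ξ_j satisfy ω_i ω_s = -q² ω_s ω_i for s < i, and ω_i² = 0 by the
next lemma. The alternating identities for the rows of a minor all come from these two facts. -/
theorem wedgeL_Z_Z_of_lt {s i : Fin n} (h : s < i) (N : Finset (Fin n) → Oq n) :
    wedgeL (Z i) (wedgeL (Z s) N) = (-q ^ 2) • wedgeL (Z s) (wedgeL (Z i) N) := by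
  have hq := q_ne_zero
  refine wedgeL_wedgeL_congr N _ fun j l hjl => ?_
  rw [Z_anti i j s l h hjl, Z_diag s j i l h hjl]
  match_scalars <;> field_simp
  ring

theorem wedgeL_Z_Z_self (i : Fin n) (N : Finset (Fin n) → Oq n) :
    wedgeL (Z i) (wedgeL (Z i) N) = 0 := by
  rw [wedgeL_wedgeL_congr (f' := 0) (g' := 0) N 0, zero_smul]
  intro j l hjl
  rw [Z_row i j l hjl, sub_self, zero_smul]

theorem wedgeL_minor_of_mem {i : Fin n} {I : Finset (Fin n)} (hi : i ∈ I) :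
    wedgeL (Z i) (minor I) = 0 := by
  induction I using Finset.induction_on_min with
  | empty => simp at hi
  | insert a I ha ih =>
    rw [minor_insert_min ha]
    rcases Finset.mem_insert.1 hi with rfl | hi
    · exact wedgeL_Z_Z_self _ _
    · rw [wedgeL_Z_Z_of_lt (ha i hi), ih hi, wedgeL_zero, smul_zero]

theorem wedgeL_minor_erase {i : Fin n} {I : Finset (Fin n)} (hi : i ∈ I) :
    wedgeL (Z i) (minor (I.erase i)) = (-q ^ 2) ^ (I.filter (· < i)).card • minor I := by
  induction I using Finset.induction_on_min with
  | empty => simp at hi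
  | insert a I ha ih =>
    have haI : a ∉ I := fun h' => (ha a h').false
    rcases Finset.mem_insert.1 hi with rfl | hi
    · rw [Finset.erase_insert haI, minor_insert_min ha]
      rw [Finset.filter_eq_empty_iff.2, Finset.card_empty, pow_zero, one_smul]
      intro x hx
      rcases Finset.mem_insert.1 hx with rfl | hx
      · simp
      · simpa using (ha x hx).le
    · rw [Finset.erase_insert_of_ne (ha i hi).ne, minor_insert_min ha, minor_insert_min,
        wedgeL_Z_Z_of_lt (ha i hi), ih hi, wedgeL_smul, smul_smul, ← pow_succ', Finset.filter_insert,
        if_pos (ha i hi), Finset.card_insert_of_notMem (by simp [haI])]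
      exact fun b hb => ha b (Finset.mem_of_mem_erase hb)

/-- Each row form that ω_i passes on its way to the front contributes one factor -q². -/
theorem wedgeR_minor_of_lt {i : Fin n} {I : Finset (Fin n)} (hi : ∀ s ∈ I, i < s) :
    wedgeR (minor I) (Z i) = (-q ^ 2) ^ I.card • minor (insert i I) := by
  induction I using Finset.induction_on_min with
  | empty => rw [← minor_insert_max (by simp)]; simp
  | insert a I ha ih =>
    have haI : a ∉ I := fun h' => (ha a h').false
    have hia := hi a (Finset.mem_insert_self a I)
    have hi' : ∀ s ∈ I, i < s := fun s hs => hi s (Finset.mem_insert_of_mem hs)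
    rw [minor_insert_min hi, minor_insert_min ha, wedgeL_wedgeR, ih hi', wedgeL_smul,
      minor_insert_min hi', wedgeL_Z_Z_of_lt hia, smul_smul, ← pow_succ,
      Finset.card_insert_of_notMem haI]

theorem wedgeR_minor_of_mem {i : Fin n} {I : Finset (Fin n)} (hi : i ∈ I) :
    wedgeR (minor I) (Z i) = 0 := by
  induction I using Finset.induction_on_min with
  | empty => simp at hi
  | insert a I ha ih =>
    rw [minor_insert_min ha, wedgeL_wedgeR]
    rcases Finset.mem_insert.1 hi with rfl | hi
    · rw [wedgeR_minor_of_lt ha, wedgeL_smul, minor_insert_min ha, wedgeL_Z_Z_self, smul_zero]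
    · rw [ih hi, wedgeL_zero]

end Minor
end
end QuantumMatrix

/-! ### Bar-invariance and transposition of minors -/

namespace QuantumMatrix
noncomputable section

variable {n : ℕ}

theorem bar_one : bar (1 : Oq n) = 1 := by simp [bar]

theorem bar_zero : bar (0 : Oq n) = 0 := by simp [bar]

theorem bar_sum {ι : Type*} (s : Finset ι) (f : ι → Oq n) :
    bar (∑ i ∈ s, f i) = ∑ i ∈ s, bar (f i) := by
  classical
  induction s using Finset.induction_on with
  | empty => simp [bar_zero]
  | insert a s ha ih => rw [Finset.sum_insert ha, bar_add, ih, Finset.sum_insert ha]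

theorem neg_q_sq_ne_zero : -q ^ 2 ≠ 0 := neg_ne_zero.2 (pow_ne_zero 2 q_ne_zero)

theorem barK_neg_q_sq_pow (m : ℕ) : barK ((-q ^ 2) ^ m) = ((-q ^ 2) ^ m)⁻¹ := by
  rw [map_pow, map_neg, map_pow, barK_q, ← inv_pow, inv_neg, inv_pow]

theorem card_filter_lt_add_card_filter_gt {J : Finset (Fin n)} {j : Fin n} (hj : j ∈ J) :
    (J.filter (· < j)).card + (J.filter (j < ·)).card + 1 = J.card := by
  rw [← Finset.card_erase_add_one hj, ← Finset.card_union_of_disjoint]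
  · congr 2
    ext l
    simp only [Finset.mem_union, Finset.mem_filter, Finset.mem_erase, ne_iff_lt_or_gt]
    tauto
  · rw [Finset.disjoint_filter]
    exact fun _ _ h => h.not_gt

/-- Among the m other columns, the larger ones number m minus the smaller ones. Up to a global
power, the right expansion therefore has the bar conjugates of the coefficients of the left
expansion. -/
theorem wedgeR_eq_sum_inv (N : Finset (Fin n) → Oq n) (f : Fin n → Oq n) {J : Finset (Fin n)}
    {m : ℕ} (hJ : J.card = m + 1) :
    wedgeR N f J = (-q ^ 2) ^ m •
      ∑ j ∈ J, ((-q ^ 2) ^ (J.filter (· < j)).card)⁻¹ • (N (J.erase j) * f j) := by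
  rw [wedgeR, Finset.smul_sum]
  refine Finset.sum_congr rfl fun j hj => ?_
  have h := card_filter_lt_add_card_filter_gt hj
  rw [smul_smul]
  congr 1
  rw [eq_mul_inv_iff_mul_eq₀ (pow_ne_zero _ neg_q_sq_ne_zero), ← pow_add]
  congr 1
  omega

/-- Quantum minors are bar-invariant. -/
theorem bar_minor (I J : Finset (Fin n)) : bar (minor I J) = minor I J := by
  induction I using Finset.induction_on_min generalizing J with
  | empty => rw [minor_empty]; split_ifs <;> simp [bar_one, bar_zero]
  | insert a I ha ih =>
    by_cases hc : (insert a I).card = J.card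
    · rw [Finset.card_insert_of_notMem fun h => (ha a h).false] at hc
      -- Multiplying by the first row on the wrong side gives, once (-q²)^{|I|} is cancelled, the
      -- bar image of the expansion along that row.
      have h := congrFun (wedgeR_minor_of_lt ha) J
      rw [wedgeR_eq_sum_inv _ _ hc.symm, Pi.smul_apply] at h
      refine Eq.trans ?_ (smul_right_injective _ (pow_ne_zero I.card neg_q_sq_ne_zero) h)
      rw [minor_insert_min ha, wedgeL, bar_sum]
      exact Finset.sum_congr rfl fun j _ => by
        rw [bar_smul, bar_mul, ih, bar_Z, barK_neg_q_sq_pow]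
    · rw [minor_eq_zero hc, bar_zero]

/-- Expansion of a quantum minor along its first column. -/
theorem minor_insert_min_col {b : Fin n} {I J : Finset (Fin n)} (h : ∀ j ∈ J, b < j) :
    minor I (insert b J) = wedgeL (fun i => Z i b) (fun I => minor I J) I := by
  have hb : b ∉ J := fun h' => (h b h').false
  induction I using Finset.induction_on_min generalizing J with
  | empty => rw [minor_empty, if_neg (Finset.insert_ne_empty b J)]; simp [wedgeL]
  | insert a I ha ih =>
    have ha' : a ∉ I := fun h' => (ha a h').false
    rw [minor_insert_min ha, wedgeL, Finset.sum_insert hb, wedgeL, Finset.sum_insert ha',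
      Finset.erase_insert hb, Finset.erase_insert ha']
    congr 1
    · rw [Finset.filter_insert, if_neg (lt_irrefl _), Finset.filter_insert, if_neg (lt_irrefl _),
        Finset.filter_eq_empty_iff.2, Finset.filter_eq_empty_iff.2]
      · exact fun x hx => (ha x hx).not_gt
      · exact fun x hx => (h x hx).not_gt
    -- Apart from the term of Z_{ab}, expanding along row a and then column b, or the other way
    -- round, gives the same double sum, because Z_{ib} and Z_{aj} commute.
    · have e₁ : ∀ j ∈ J, (-q ^ 2) ^ ((insert b J).filter (· < j)).card •
          (Z a j * minor I ((insert b J).erase j)) = ∑ i ∈ I,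
          ((-q ^ 2) ^ ((J.filter (· < j)).card + (I.filter (· < i)).card + 1)) •
            (Z a j * (Z i b * minor (I.erase i) (J.erase j))) := by
        intro j hj
        rw [Finset.erase_insert_of_ne (h j hj).ne, ih
          (fun x hx => h x (Finset.mem_of_mem_erase hx)) (fun hx => hb (Finset.mem_of_mem_erase hx)),
          Finset.filter_insert, if_pos (h j hj), Finset.card_insert_of_notMem (by simp [hb]),
          wedgeL, Finset.mul_sum, Finset.smul_sum]
        refine Finset.sum_congr rfl fun i hi => ?_
        rw [mul_smul_comm, smul_smul, ← pow_add]
        congr 2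
        ring
      have e₂ : ∀ i ∈ I, (-q ^ 2) ^ ((insert a I).filter (· < i)).card •
          (Z i b * minor ((insert a I).erase i) J) = ∑ j ∈ J,
          ((-q ^ 2) ^ ((J.filter (· < j)).card + (I.filter (· < i)).card + 1)) •
            (Z i b * (Z a j * minor (I.erase i) (J.erase j))) := by
        intro i hi
        rw [Finset.erase_insert_of_ne (ha i hi).ne,
          minor_insert_min fun x hx => ha x (Finset.mem_of_mem_erase hx),
          Finset.filter_insert, if_pos (ha i hi), Finset.card_insert_of_notMem (by simp [ha']),
          wedgeL, Finset.mul_sum, Finset.smul_sum]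
        refine Finset.sum_congr rfl fun j hj => ?_
        rw [mul_smul_comm, smul_smul, ← pow_add]
        congr 2
        ring
      rw [Finset.sum_congr rfl e₁, Finset.sum_congr rfl e₂, Finset.sum_comm]
      refine Finset.sum_congr rfl fun i hi => Finset.sum_congr rfl fun j hj => ?_
      rw [← mul_assoc, ← mul_assoc, Z_anti i b a j (ha i hi) (h j hj)]

theorem sigma_Z (i j : Fin n) : sigma n (Z i j) = Z j i := sigmaHom_Z i j

/-- Transposition of quantum minors. -/
theorem sigma_minor (I J : Finset (Fin n)) : sigma n (minor I J) = minor J I := by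
  induction J using Finset.induction_on_min generalizing I with
  | empty =>
    rw [minor_empty]
    split_ifs with h
    · rw [h, minor_empty, if_pos rfl, map_one]
    · rw [minor_eq_zero, map_zero]
      simpa using h
  | insert b J hb ih =>
    rw [minor_insert_min_col hb, minor_insert_min hb, wedgeL, wedgeL, map_sum]
    refine Finset.sum_congr rfl fun i _ => ?_
    rw [map_smul, map_mul, sigma_Z, ih]

end
end QuantumMatrix

/-! ### Commutation of minors with single entries -/

namespace QuantumMatrix
noncomputable section

variable {n : ℕ}

/-- A quantum minor commutes with the entries of its submatrix. -/
theorem minor_commute {i k : Fin n} {I J : Finset (Fin n)} (hi : i ∈ I) (hk : k ∈ J) :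
    minor I J * Z i k = Z i k * minor I J := by
  by_cases hc : I.card = J.card
  swap
  · rw [minor_eq_zero hc, zero_mul, mul_zero]
  have hq := neg_q_sq_ne_zero
  have hrow : ∀ i' ∈ I, ∑ j ∈ J, (-q ^ 2) ^ (J.filter (· < j)).card •
      (Z i j * minor (I.erase i') (J.erase j)) =
        if i' = i then (-q ^ 2) ^ (I.filter (· < i)).card • minor I J else 0 := by
    intro i' hi'
    split_ifs with h
    · rw [h]; exact congrFun (wedgeL_minor_erase hi) J
    · exact congrFun (wedgeL_minor_of_mem (Finset.mem_erase.2 ⟨fun e => h e.symm, hi⟩)) J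
  have hcol' : ∀ j ∈ J, ∑ i' ∈ I, (-q ^ 2) ^ (I.filter (· < i')).card •
      (Z i' k * minor (I.erase i') (J.erase j)) =
        if j = k then (-q ^ 2) ^ (J.filter (· < k)).card • minor I J else 0 := by
    intro j hj
    have h : ∀ N, sigma n (wedgeL (Z k) N I) = ∑ i' ∈ I, (-q ^ 2) ^ (I.filter (· < i')).card •
        (Z i' k * sigma n (N (I.erase i'))) := by
      intro N
      simp only [wedgeL, map_sum, map_smul, map_mul, sigma_Z]
    simp only [← sigma_minor (J.erase j)]
    rw [← h]
    split_ifs with h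
    · rw [h, wedgeL_minor_erase hk, Pi.smul_apply, map_smul, sigma_minor]
    · rw [wedgeL_minor_of_mem (Finset.mem_erase.2 ⟨fun e => h e.symm, hk⟩), Pi.zero_apply, map_zero]
  -- Bar moves the entries to the right of the cofactors and inverts the powers of -q².
  have hcol : ∀ j ∈ J, ∑ i' ∈ I, ((-q ^ 2) ^ (I.filter (· < i')).card)⁻¹ •
      (minor (I.erase i') (J.erase j) * Z i' k) =
        if j = k then ((-q ^ 2) ^ (J.filter (· < k)).card)⁻¹ • minor I J else 0 := by
    intro j hj
    have h := congrArg bar (hcol' j hj)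
    rw [bar_sum, apply_ite bar, bar_smul, bar_minor, bar_zero, barK_neg_q_sq_pow] at h
    rw [← h]
    exact Finset.sum_congr rfl fun i' _ => by
      rw [bar_smul, bar_mul, bar_minor, bar_Z, barK_neg_q_sq_pow]
  -- With the cofactor matrix in the middle, (Z · cofactors) · Z and Z · (cofactors · Z) are the
  -- same double sum. `hrow` evaluates the first as minor times entry, `hcol` the second as entry
  -- times minor.
  have key : ∑ i' ∈ I, ((-q ^ 2) ^ (I.filter (· < i')).card)⁻¹ •
      ((∑ j ∈ J, (-q ^ 2) ^ (J.filter (· < j)).card •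
        (Z i j * minor (I.erase i') (J.erase j))) * Z i' k) =
      ∑ j ∈ J, (-q ^ 2) ^ (J.filter (· < j)).card • (Z i j * ∑ i' ∈ I,
        ((-q ^ 2) ^ (I.filter (· < i')).card)⁻¹ • (minor (I.erase i') (J.erase j) * Z i' k)) := by
    simp only [Finset.sum_mul, Finset.mul_sum, Finset.smul_sum]
    rw [Finset.sum_comm]
    refine Finset.sum_congr rfl fun j _ => Finset.sum_congr rfl fun i' _ => ?_
    rw [smul_mul_assoc, mul_smul_comm, smul_comm, mul_assoc]
  rw [Finset.sum_congr rfl fun i' hi' => by rw [hrow i' hi'],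
    Finset.sum_congr (s₁ := J) rfl fun j hj => by rw [hcol j hj]] at key
  simp only [ite_mul, zero_mul, smul_ite, smul_zero, Finset.sum_ite_eq', hi, hk, if_true,
    mul_ite, mul_zero, smul_mul_assoc, mul_smul_comm, smul_smul] at key
  rwa [inv_mul_cancel₀ (pow_ne_zero _ hq), one_smul, mul_inv_cancel₀ (pow_ne_zero _ hq),
    one_smul] at key

theorem minor_singleton (i : Fin n) (J : Finset (Fin n)) :
    minor {i} J = ∑ j ∈ J, if J = {j} then Z i j else 0 := by
  have h : ({i} : Finset (Fin n)) = insert i ∅ := rfl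
  rw [h, minor_insert_min (by simp), wedgeL]
  refine Finset.sum_congr rfl fun j hj => ?_
  rw [minor_empty]
  have : J.erase j = ∅ ↔ J = {j} := by
    constructor
    · intro h; rw [← Finset.insert_erase hj, h]; rfl
    · rintro rfl; simp
  simp only [this]
  split_ifs with h
  · subst h; simp [Finset.filter_singleton]
  · simp

theorem minor_singleton_singleton (i k : Fin n) : minor {i} {k} = Z i k := by
  simp [minor_singleton]

/-- Entries of the earlier rows are up and to the right of Z_{ik} and commute with it; only the
letter of row i contributes q². -/
theorem minor_insert_max_mul_comm_aux {i k : Fin n} {I J : Finset (Fin n)}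
    (hi : ∀ s ∈ I, s < i) (hk : ∀ j ∈ J, k < j) :
    Z i k * minor (insert i I) J = q ^ 2 • (minor (insert i I) J * Z i k) := by
  induction I using Finset.induction_on_min generalizing J with
  | empty =>
    rw [show insert i (∅ : Finset (Fin n)) = {i} from rfl, minor_singleton, Finset.mul_sum,
      Finset.sum_mul, Finset.smul_sum]
    refine Finset.sum_congr rfl fun j hj => ?_
    split_ifs
    · rw [Z_row i k j (hk j hj)]
    · simp
  | insert a I ha ih =>
    have hai := hi a (Finset.mem_insert_self a I)
    have hi' : ∀ s ∈ I, s < i := fun s hs => hi s (Finset.mem_insert_of_mem hs)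
    rw [Finset.insert_comm, minor_insert_min, wedgeL, Finset.mul_sum,
      Finset.sum_mul, Finset.smul_sum]
    · refine Finset.sum_congr rfl fun j hj => ?_
      rw [mul_smul_comm, ← mul_assoc, Z_anti i k a j hai (hk j hj), mul_assoc,
        ih hi' fun x hx => hk x (Finset.mem_of_mem_erase hx), mul_smul_comm, smul_mul_assoc,
        mul_assoc, smul_comm]
    · intro x hx
      rcases Finset.mem_insert.1 hx with rfl | hx
      · exact hai
      · exact ha x hx

/-- A quantum minor `q`-commutes with an entry in one of its rows to the left of its columns. -/
theorem Z_mul_minor_of_lt {i k : Fin n} {I J : Finset (Fin n)}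
    (hi : i ∈ I) (hk : ∀ j ∈ J, k < j) :
    Z i k * minor I J = q ^ 2 • (minor I J * Z i k) := by
  induction I using Finset.induction_on_max generalizing J with
  | empty => simp at hi
  | insert s I hs ih =>
    rcases Finset.mem_insert.1 hi with rfl | hi
    · exact minor_insert_max_mul_comm_aux hs hk
    have e : ∀ j ∈ J, (-q ^ 2) ^ (J.filter (j < ·)).card • (Z i k * (minor I (J.erase j) * Z s j)) =
        q ^ 2 • ((-q ^ 2) ^ (J.filter (j < ·)).card • (minor I (J.erase j) * Z s j * Z i k)) +
        (q ^ 2 * (q ^ 2 - (q⁻¹) ^ 2)) •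
        ((-q ^ 2) ^ (J.filter (j < ·)).card • (minor I (J.erase j) * Z i j) * Z s k) := by
      intro j hj
      rw [← mul_assoc, ih hi fun x hx => hk x (Finset.mem_of_mem_erase hx), smul_mul_assoc,
        mul_assoc, Z_diag i k s j (hs i hi) (hk j hj)]
      simp only [mul_add, mul_smul_comm, smul_mul_assoc, mul_assoc]
      module
    -- The corrections from the diagonal relation add up to a minor with row i repeated, which
    -- vanishes.
    have h0 := congrFun (wedgeR_minor_of_mem hi) J
    rw [wedgeR, Pi.zero_apply] at h0
    rw [minor_insert_max hs, wedgeR, Finset.mul_sum]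
    simp only [mul_smul_comm]
    rw [Finset.sum_congr rfl e, Finset.sum_add_distrib, ← Finset.smul_sum, ← Finset.smul_sum,
      ← Finset.sum_mul, h0, zero_mul, smul_zero, add_zero, Finset.sum_mul]
    simp only [smul_mul_assoc]

theorem minor_mul_Z_of_gt_aux {i k : Fin n} {I J : Finset (Fin n)}
    (hi : ∀ s ∈ I, i < s) (hk : ∀ j ∈ J, j < k) :
    minor (insert i I) J * Z i k = q ^ 2 • (Z i k * minor (insert i I) J) := by
  induction I using Finset.induction_on_max generalizing J with
  | empty =>
    rw [show insert i (∅ : Finset (Fin n)) = {i} from rfl, minor_singleton, Finset.mul_sum,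
      Finset.sum_mul, Finset.smul_sum]
    refine Finset.sum_congr rfl fun j hj => ?_
    split_ifs
    · rw [Z_row i j k (hk j hj)]
    · simp
  | insert a I ha ih =>
    have hai := hi a (Finset.mem_insert_self a I)
    have hi' : ∀ s ∈ I, i < s := fun s hs => hi s (Finset.mem_insert_of_mem hs)
    rw [Finset.insert_comm, minor_insert_max, wedgeR, Finset.mul_sum,
      Finset.sum_mul, Finset.smul_sum]
    · refine Finset.sum_congr rfl fun j hj => ?_
      rw [smul_mul_assoc, mul_assoc, Z_anti a j i k hai (hk j hj), ← mul_assoc,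
        ih hi' fun x hx => hk x (Finset.mem_of_mem_erase hx), mul_smul_comm, smul_mul_assoc,
        mul_assoc, smul_comm]
    · intro x hx
      rcases Finset.mem_insert.1 hx with rfl | hx
      · exact hai
      · exact ha x hx

/-- A quantum minor `q`-commutes with an entry in one of its rows to the right of its columns. -/
theorem minor_mul_Z_of_gt {i k : Fin n} {I J : Finset (Fin n)}
    (hi : i ∈ I) (hk : ∀ j ∈ J, j < k) :
    minor I J * Z i k = q ^ 2 • (Z i k * minor I J) := by
  induction I using Finset.induction_on_min generalizing J with
  | empty => simp at hi
  | insert s I hs ih =>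
    rcases Finset.mem_insert.1 hi with rfl | hi
    · exact minor_mul_Z_of_gt_aux hs hk
    have e : ∀ j ∈ J, (-q ^ 2) ^ (J.filter (· < j)).card • (Z s j * minor I (J.erase j) * Z i k) =
        q ^ 2 • ((-q ^ 2) ^ (J.filter (· < j)).card • (Z i k * (Z s j * minor I (J.erase j)))) +
        (q ^ 2 * (q ^ 2 - (q⁻¹) ^ 2)) •
        (Z s k * ((-q ^ 2) ^ (J.filter (· < j)).card • (Z i j * minor I (J.erase j)))) := by
      intro j hj
      rw [mul_assoc, ih hi fun x hx => hk x (Finset.mem_of_mem_erase hx), mul_smul_comm,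
        ← mul_assoc, Z_diag s j i k (hs i hi) (hk j hj)]
      simp only [add_mul, mul_smul_comm, smul_mul_assoc, mul_assoc]
      module
    have h0 := congrFun (wedgeL_minor_of_mem hi) J
    rw [wedgeL, Pi.zero_apply] at h0
    rw [minor_insert_min hs, wedgeL, Finset.sum_mul]
    simp only [smul_mul_assoc]
    rw [Finset.sum_congr rfl e, Finset.sum_add_distrib, ← Finset.smul_sum, ← Finset.smul_sum,
      ← Finset.mul_sum, h0, mul_zero, smul_zero, add_zero, Finset.mul_sum]
    simp only [mul_smul_comm]

/-- A quantum minor `q`-commutes with an entry in one of its columns below its rows. -/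
theorem minor_mul_Z_of_row_gt {i k : Fin n} {I J : Finset (Fin n)}
    (hk : k ∈ J) (hi : ∀ s ∈ I, s < i) :
    minor I J * Z i k = q ^ 2 • (Z i k * minor I J) := by
  have h := congrArg (sigma n) (minor_mul_Z_of_gt hk hi)
  rwa [map_mul, map_smul, map_mul, sigma_minor, sigma_Z] at h

/-- A quantum minor commutes with the entries below and to the left of it. -/
theorem minor_commute_of_anti {i k : Fin n} {I J : Finset (Fin n)}
    (hi : ∀ s ∈ I, s < i) (hk : ∀ j ∈ J, k < j) :
    minor I J * Z i k = Z i k * minor I J := by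
  induction I using Finset.induction_on_min generalizing J with
  | empty => rw [minor_empty]; split_ifs <;> simp
  | insert a I ha ih =>
    rw [minor_insert_min ha, wedgeL, Finset.sum_mul, Finset.mul_sum]
    refine Finset.sum_congr rfl fun j hj => ?_
    rw [smul_mul_assoc, mul_assoc, ih (fun s hs => hi s (Finset.mem_insert_of_mem hs))
      (fun x hx => hk x (Finset.mem_of_mem_erase hx)), ← mul_assoc,
      ← Z_anti i k a j (hi a (Finset.mem_insert_self a I)) (hk j hj), mul_smul_comm, mul_assoc]

end
end QuantumMatrix

/-! ### The exchange rule for entries in the first row of a minor -/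

namespace QuantumMatrix
noncomputable section

variable {n : ℕ}

/-- `∑_{j ∈ C, j > k} (-q²)^{-|C ∩ (k, j)|} M_{C ∖ j} Z_{ij}`. -/
def exchangeL (I : Finset (Fin n)) (i k : Fin n) (C : Finset (Fin n)) : Oq n :=
  ∑ j ∈ C.filter (k < ·), ((-q ^ 2) ^ (C.filter fun x => k < x ∧ x < j).card)⁻¹ •
    (minor I (C.erase j) * Z i j)

/-- `∑_{j ∈ C, j > k} (-q²)^{|C ∩ (k, j)|} Z_{ij} M_{C ∖ j}`. -/
def exchangeR (I : Finset (Fin n)) (i k : Fin n) (C : Finset (Fin n)) : Oq n :=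
  ∑ j ∈ C.filter (k < ·), (-q ^ 2) ^ (C.filter fun x => k < x ∧ x < j).card •
    (Z i j * minor I (C.erase j))

/-- The commutation rule between the minors with rows `I` and the entries of row `i`. -/
def Exchange (I : Finset (Fin n)) (i : Fin n) : Prop :=
  ∀ (C : Finset (Fin n)), ∀ k ∈ C, minor I (C.erase k) * Z i k =
    q ^ 2 • (Z i k * minor I (C.erase k)) + (1 - q ^ 4) • exchangeR I i k C

theorem filter_gt_eq_insert {C : Finset (Fin n)} {k m : Fin n} (hm : m ∈ C) (hkm : k < m)
    (h : ∀ x ∈ C, k < x → m ≤ x) :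
    C.filter (k < ·) = insert m (C.filter (m < ·)) := by
  ext x
  simp only [Finset.mem_filter, Finset.mem_insert]
  constructor
  · rintro ⟨hx, hkx⟩
    rcases (h x hx hkx).lt_or_eq with h' | h'
    · exact Or.inr ⟨hx, h'⟩
    · exact Or.inl h'.symm
  · rintro (rfl | ⟨hx, hmx⟩)
    · exact ⟨hm, hkm⟩
    · exact ⟨hx, hkm.trans hmx⟩

theorem card_filter_between_of_min {C : Finset (Fin n)} {k m j : Fin n} (hm : m ∈ C)
    (hkm : k < m) (h : ∀ x ∈ C, k < x → m ≤ x) (hj : m < j) :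
    (C.filter fun x => k < x ∧ x < j).card = (C.filter fun x => m < x ∧ x < j).card + 1 := by
  rw [← Finset.card_insert_of_notMem (a := m) (by simp)]
  congr 1
  ext x
  simp only [Finset.mem_filter, Finset.mem_insert]
  constructor
  · rintro ⟨hx, hkx, hxj⟩
    rcases (h x hx hkx).lt_or_eq with h' | h'
    · exact Or.inr ⟨hx, h', hxj⟩
    · exact Or.inl h'.symm
  · rintro (rfl | ⟨hx, hmx, hxj⟩)
    · exact ⟨hm, hkm, hj⟩
    · exact ⟨hx, hkm.trans hmx, hxj⟩

theorem card_filter_between_min {C : Finset (Fin n)} {k m : Fin n}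
    (h : ∀ x ∈ C, k < x → m ≤ x) : (C.filter fun x => k < x ∧ x < m).card = 0 := by
  rw [Finset.card_eq_zero, Finset.filter_eq_empty_iff]
  rintro x hx ⟨h₁, h₂⟩
  exact (h x hx h₁).not_gt h₂

/-- Induction on the number of columns beyond k: the rule is applied to the smallest of them, and
the remaining sum gets the coefficient (1 - q⁴) - 1 = q²·(-q²), as required. -/
theorem Exchange.exchangeL_eq {I : Finset (Fin n)} {i : Fin n} (h : Exchange I i) (k : Fin n)
    (C : Finset (Fin n)) : exchangeL I i k C = q ^ 2 • exchangeR I i k C := by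
  induction hd : (C.filter (k < ·)).card generalizing k with
  | zero =>
    rw [Finset.card_eq_zero] at hd
    simp [exchangeL, exchangeR, hd]
  | succ d ih =>
    have hne : (C.filter (k < ·)).Nonempty := by rw [← Finset.card_pos]; omega
    obtain ⟨m, hm, hmin⟩ := Finset.exists_min_image _ id hne
    obtain ⟨hmC, hkm⟩ := Finset.mem_filter.1 hm
    have hmin' : ∀ x ∈ C, k < x → m ≤ x := fun x hx hkx => hmin x (by simp [hx, hkx])
    have hf := filter_gt_eq_insert hmC hkm hmin'
    have hd' : (C.filter (m < ·)).card = d := by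
      rw [hf, Finset.card_insert_of_notMem (by simp)] at hd
      omega
    have hq := neg_q_sq_ne_zero
    have hL : exchangeL I i k C =
        minor I (C.erase m) * Z i m + (-q ^ 2)⁻¹ • exchangeL I i m C := by
      rw [exchangeL, hf, Finset.sum_insert (by simp), card_filter_between_min hmin', pow_zero,
        inv_one, one_smul, exchangeL, Finset.smul_sum]
      congr 1
      refine Finset.sum_congr rfl fun j hj => ?_
      rw [card_filter_between_of_min hmC hkm hmin' (Finset.mem_filter.1 hj).2, smul_smul, pow_succ',
        mul_inv]
    have hR : exchangeR I i k C =
        Z i m * minor I (C.erase m) + (-q ^ 2) • exchangeR I i m C := by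
      rw [exchangeR, hf, Finset.sum_insert (by simp), card_filter_between_min hmin', pow_zero,
        one_smul, exchangeR, Finset.smul_sum]
      congr 1
      refine Finset.sum_congr rfl fun j hj => ?_
      rw [card_filter_between_of_min hmC hkm hmin' (Finset.mem_filter.1 hj).2, smul_smul, pow_succ']
    rw [hL, hR, ih m hd', h C m hmC]
    have hq' := q_ne_zero
    match_scalars <;> field_simp
    ring

theorem exchange_singleton (i : Fin n) : Exchange {i} i := by
  intro C k hk
  have hq := q_ne_zero
  by_cases hC : C.card = 2
  · obtain ⟨l, hl⟩ : ∃ l, C.erase k = {l} := by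
      rw [← Finset.card_eq_one, Finset.card_erase_of_mem hk, hC]
    have hlk : l ≠ k := (Finset.mem_erase.1 (hl ▸ Finset.mem_singleton_self l)).1
    have hC' : C = {k, l} := by rw [← Finset.insert_erase hk, hl]
    rw [hl, minor_singleton_singleton, exchangeR]
    rcases lt_or_gt_of_ne hlk with h | h
    · have : C.filter (k < ·) = ∅ := by
        rw [hC', Finset.filter_insert, Finset.filter_singleton]
        simp [h.le]
      rw [this, Finset.sum_empty, smul_zero, add_zero, Z_row i l k h]
    · have h₁ : C.filter (k < ·) = {l} := by
        rw [hC', Finset.filter_insert, Finset.filter_singleton]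
        simp [h]
      have h₂ : C.filter (fun x => k < x ∧ x < l) = ∅ := by
        rw [hC', Finset.filter_insert, Finset.filter_singleton]
        simp
      have h₃ : C.erase l = {k} := by
        rw [hC', Finset.pair_comm, Finset.erase_insert (by simpa using hlk)]
      rw [h₁, Finset.sum_singleton, h₂, h₃, minor_singleton_singleton, Finset.card_empty, pow_zero,
        one_smul, Z_row i k l h]
      module
  -- For any other size of C all the minors involved vanish.
  · have h0 : ∀ j ∈ C, minor {i} (C.erase j) = 0 := fun j hj => by
      rw [minor_eq_zero]
      rw [Finset.card_singleton, Finset.card_erase_of_mem hj]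
      omega
    rw [h0 k hk, exchangeR, Finset.sum_eq_zero]
    · simp
    · intro j hj
      rw [h0 j (Finset.mem_filter.1 hj).1, mul_zero, smul_zero]

/-- These are the exponents of -q² on the term of columns j and l: expanding along the last row and
then exchanging k for l, against the reverse order. -/
theorem card_filter_between_erase_add {C : Finset (Fin n)} {j k l : Fin n} (hj : j ∈ C)
    (hk : k ∈ C) (hl : l ∈ C) (hjk : j ≠ k) (hjl : j ≠ l) (hkl : k < l) :
    ((C.erase k).filter (j < ·)).card + ((C.erase j).filter fun x => k < x ∧ x < l).card =
      (C.filter fun x => k < x ∧ x < l).card + ((C.erase l).filter (j < ·)).card := by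
  have h₁ : ((C.erase j).filter fun x => k < x ∧ x < l) =
      (C.filter fun x => k < x ∧ x < l).erase j := Finset.filter_erase _ _ _
  rcases lt_or_gt_of_ne hjk with h | h
  · have h₂ := card_filter_gt_erase_of_lt hk h
    have h₃ := card_filter_gt_erase_of_lt hl (h.trans hkl)
    have h₄ : (C.filter fun x => k < x ∧ x < l).erase j = C.filter fun x => k < x ∧ x < l :=
      Finset.erase_eq_of_notMem (by simp [h.le])
    rw [h₁, h₄]
    omega
  · have h₂ := card_filter_gt_erase_of_le (J := C) h.le
    rcases lt_or_gt_of_ne hjl with h' | h'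
    · have h₃ := card_filter_gt_erase_of_lt hl h'
      have h₄ := Finset.card_erase_add_one (s := C.filter fun x => k < x ∧ x < l) (a := j)
        (by simp [hj, h, h'])
      rw [h₁]
      omega
    · have h₃ := card_filter_gt_erase_of_le (J := C) h'.le
      have h₄ : (C.filter fun x => k < x ∧ x < l).erase j = C.filter fun x => k < x ∧ x < l :=
        Finset.erase_eq_of_notMem (by simp [h'.le])
      rw [h₁, h₄]
      omega

/-- The left sum collects the corrections of the diagonal relation when a last row s is added.
`exchangeL_eq` moves its entries to the left, and q²(q² - q^{-2}) = -(1 - q⁴) turns it into the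
terms of column k in the expansions of the minors M_{C∖l} along row s. -/
theorem Exchange.sum_aux {I : Finset (Fin n)} {i : Fin n} (h : Exchange I i)
    (C : Finset (Fin n)) (k : Fin n) :
    (q ^ 2 - (q⁻¹) ^ 2) • ∑ j ∈ (C.erase k).filter (k < ·),
      (-q ^ 2) ^ ((C.erase k).filter (j < ·)).card • (minor I ((C.erase k).erase j) * Z i j) =
    -((1 - q ^ 4) • ∑ l ∈ C.filter (k < ·),
      (-q ^ 2) ^ ((C.filter fun x => k < x ∧ x < l).card + ((C.erase l).filter (k < ·)).card) •
        (Z i l * minor I ((C.erase l).erase k))) := by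
  have hf : (C.erase k).filter (k < ·) = C.filter (k < ·) := by
    rw [Finset.filter_erase, Finset.erase_eq_of_notMem (by simp)]
  have hf' : ∀ l, (C.erase k).filter (fun x => k < x ∧ x < l) =
      C.filter fun x => k < x ∧ x < l := fun l => by
    rw [Finset.filter_erase, Finset.erase_eq_of_notMem (by simp)]
  rcases (C.filter (k < ·)).eq_empty_or_nonempty with he | hne
  · rw [hf, he]; simp
  obtain ⟨m, hm⟩ : ∃ m, (C.filter (k < ·)).card = m + 1 :=
    Nat.exists_eq_succ_of_ne_zero (Finset.card_pos.2 hne).ne'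
  have hL : ∑ j ∈ (C.erase k).filter (k < ·), (-q ^ 2) ^ ((C.erase k).filter (j < ·)).card •
      (minor I ((C.erase k).erase j) * Z i j) = (-q ^ 2) ^ m • exchangeL I i k (C.erase k) := by
    rw [exchangeL, Finset.smul_sum]
    refine Finset.sum_congr rfl fun j hj => ?_
    rw [smul_smul]
    congr 1
    rw [eq_mul_inv_iff_mul_eq₀ (pow_ne_zero _ neg_q_sq_ne_zero), ← pow_add]
    congr 1
    have h₁ := card_filter_lt_add_card_filter_gt hj
    rw [hf, hm] at h₁
    rw [hf] at hj
    have hkj := (Finset.mem_filter.1 hj).2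
    rw [Finset.filter_filter, Finset.filter_filter] at h₁
    rw [hf', card_filter_gt_erase_of_le hkj.le]
    have h₂ : (C.filter fun x => k < x ∧ j < x) = C.filter (j < ·) :=
      Finset.filter_congr fun x _ => ⟨fun h => h.2, fun h => ⟨hkj.trans h, h⟩⟩
    rw [h₂] at h₁
    omega
  have hR : ∑ l ∈ C.filter (k < ·),
      (-q ^ 2) ^ ((C.filter fun x => k < x ∧ x < l).card + ((C.erase l).filter (k < ·)).card) •
        (Z i l * minor I ((C.erase l).erase k)) = (-q ^ 2) ^ m • exchangeR I i k (C.erase k) := by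
    rw [exchangeR, Finset.smul_sum, hf]
    refine Finset.sum_congr rfl fun l hl => ?_
    obtain ⟨hl, hkl⟩ := Finset.mem_filter.1 hl
    rw [smul_smul, ← pow_add, hf', Finset.erase_right_comm]
    congr 2
    have := card_filter_gt_erase_of_lt hl hkl
    omega
  rw [hL, hR, h.exchangeL_eq]
  have hq := q_ne_zero
  match_scalars
  field_simp
  ring

/-- Expansion along the new last row s reduces to the rule for I. Moving Z_{sj} past Z_{ik} is free
for j < k and leaves a correction in Z_{sk} for j > k; `sum_aux` identifies these corrections with
the terms still missing on the right. -/
theorem Exchange.insert_max {I : Finset (Fin n)} {i s : Fin n} (h : Exchange I i)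
    (hs : ∀ x ∈ I, x < s) (his : i < s) : Exchange (insert s I) i := by
  intro C k hk
  have e : ∀ j ∈ C.erase k, (-q ^ 2) ^ ((C.erase k).filter (j < ·)).card •
      (minor I ((C.erase k).erase j) * Z s j * Z i k) =
      (q ^ 2 • (Z i k * ((-q ^ 2) ^ ((C.erase k).filter (j < ·)).card •
        (minor I ((C.erase k).erase j) * Z s j))) +
      (1 - q ^ 4) • ((-q ^ 2) ^ ((C.erase k).filter (j < ·)).card •
        (exchangeR I i k (C.erase j) * Z s j))) -
      (q ^ 2 - (q⁻¹) ^ 2) • if k < j then ((-q ^ 2) ^ ((C.erase k).filter (j < ·)).card •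
        (minor I ((C.erase k).erase j) * Z i j)) * Z s k else 0 := by
    intro j hj
    obtain ⟨hjk, hj⟩ := Finset.mem_erase.1 hj
    have e₁ := h (C.erase j) k (Finset.mem_erase.2 ⟨hjk.symm, hk⟩)
    rw [Finset.erase_right_comm] at e₁
    rcases lt_or_gt_of_ne hjk with hlt | hlt
    · rw [if_neg hlt.not_gt, smul_zero, sub_zero, mul_assoc, Z_anti s j i k his hlt, ← mul_assoc,
        e₁]
      simp only [add_mul, smul_mul_assoc, mul_smul_comm, mul_assoc]
      module
    · have e₂ : (Z s j * Z i k : Oq n) = Z i k * Z s j - (q ^ 2 - (q⁻¹) ^ 2) • (Z i j * Z s k) := by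
        rw [Z_diag i k s j his hlt, add_sub_cancel_right]
      rw [if_pos hlt, mul_assoc, e₂, mul_sub, ← mul_assoc, e₁]
      simp only [add_mul, smul_mul_assoc, mul_smul_comm, mul_assoc]
      module
  rw [minor_insert_max hs, wedgeR, Finset.sum_mul]
  simp only [smul_mul_assoc]
  rw [Finset.sum_congr rfl e, Finset.sum_sub_distrib, Finset.sum_add_distrib, ← Finset.smul_sum,
    ← Finset.smul_sum, ← Finset.smul_sum, ← Finset.mul_sum, ← Finset.sum_filter, ← Finset.sum_mul,
    ← smul_mul_assoc (q ^ 2 - (q⁻¹) ^ 2), h.sum_aux C k, neg_mul, sub_neg_eq_add, smul_mul_assoc, add_assoc,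
    ← smul_add]
  congr 2
  simp only [exchangeR, minor_insert_max hs, wedgeR]
  have e₃ : ∀ l ∈ C.filter (k < ·), (-q ^ 2) ^ (C.filter fun x => k < x ∧ x < l).card •
      (Z i l * ∑ j ∈ C.erase l, (-q ^ 2) ^ ((C.erase l).filter (j < ·)).card •
        (minor I ((C.erase l).erase j) * Z s j)) =
      (∑ j ∈ (C.erase l).erase k, (-q ^ 2) ^ ((C.filter fun x => k < x ∧ x < l).card +
          ((C.erase l).filter (j < ·)).card) •
        (Z i l * minor I ((C.erase l).erase j) * Z s j)) +
      (-q ^ 2) ^ ((C.filter fun x => k < x ∧ x < l).card + ((C.erase l).filter (k < ·)).card) •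
        (Z i l * minor I ((C.erase l).erase k)) * Z s k := by
    intro l hl
    obtain ⟨hl, hkl⟩ := Finset.mem_filter.1 hl
    rw [← Finset.sum_erase_add _ _ (Finset.mem_erase.2 ⟨hkl.ne, hk⟩), mul_add, smul_add,
      Finset.mul_sum, Finset.smul_sum]
    congr 1
    · refine Finset.sum_congr rfl fun j _ => ?_
      rw [mul_smul_comm, smul_smul, ← pow_add, mul_assoc]
    · rw [mul_smul_comm, smul_smul, ← pow_add, smul_mul_assoc, mul_assoc]
  rw [Finset.sum_congr rfl e₃, Finset.sum_add_distrib, Finset.sum_mul]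
  congr 1
  simp only [Finset.sum_mul, Finset.smul_sum, smul_mul_assoc, smul_smul, ← pow_add]
  rw [Finset.sum_comm' (t' := C.filter (k < ·)) (s' := fun l => (C.erase l).erase k)]
  · refine Finset.sum_congr rfl fun l hl => Finset.sum_congr rfl fun j hj => ?_
    obtain ⟨hl, hkl⟩ := Finset.mem_filter.1 hl
    obtain ⟨hjk, hj⟩ := Finset.mem_erase.1 hj
    obtain ⟨hjl, hj⟩ := Finset.mem_erase.1 hj
    rw [card_filter_between_erase_add hj hk hl hjk hjl hkl, Finset.erase_right_comm]
  · intro j l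
    simp only [Finset.mem_erase, Finset.mem_filter, ne_eq]
    constructor
    · rintro ⟨⟨h₁, h₂⟩, ⟨h₃, h₄⟩, h₅⟩
      exact ⟨⟨h₁, fun e => h₃ e.symm, h₂⟩, h₄, h₅⟩
    · rintro ⟨⟨h₁, h₂, h₃⟩, h₄, h₅⟩
      exact ⟨⟨h₁, h₃⟩, ⟨fun e => h₂ e.symm, h₄⟩, h₅⟩

/-- The commutation rule between a quantum minor and the entries of its first row. -/
theorem exchange_insert_min {i : Fin n} {I : Finset (Fin n)} (hi : ∀ s ∈ I, i < s) :
    Exchange (insert i I) i := by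
  induction I using Finset.induction_on_max with
  | empty => exact exchange_singleton i
  | insert s I hs ih =>
    rw [Finset.insert_comm]
    refine (ih fun x hx => hi x (Finset.mem_insert_of_mem hx)).insert_max ?_
      (hi s (Finset.mem_insert_self s I))
    intro x hx
    rcases Finset.mem_insert.1 hx with rfl | hx
    · exact hi s (Finset.mem_insert_self s I)
    · exact hs x hx

end
end QuantumMatrix

/-! ### Normalized monomials in a single row -/

namespace QuantumMatrix
noncomputable section

variable {n : ℕ}

theorem mul_pow_of_q_commute {x y : Oq n} {c : K} (h : x * y = c • (y * x)) (m : ℕ) :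
    x * y ^ m = c ^ m • (y ^ m * x) := by
  induction m with
  | zero => simp
  | succ m ih =>
    rw [pow_succ y, ← mul_assoc, ih, smul_mul_assoc, mul_assoc, h, mul_smul_comm, smul_smul,
      mul_assoc, pow_succ]

theorem pow_mul_of_q_commute {x y : Oq n} {c : K} (h : y * x = c • (x * y)) (m : ℕ) :
    y ^ m * x = c ^ m • (x * y ^ m) := by
  induction m with
  | zero => simp
  | succ m ih =>
    rw [pow_succ' y, mul_assoc, ih, mul_smul_comm, ← mul_assoc, h, smul_mul_assoc, smul_smul,
      mul_assoc, pow_succ]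

theorem Z_row' {i j k : Fin n} (h : j < k) :
    (Z i k * Z i j : Oq n) = q ^ (-2 : ℤ) • (Z i j * Z i k) := by
  rw [Z_row i j k h, smul_smul]
  have : q ^ (-2 : ℤ) * q ^ 2 = 1 := by
    rw [← zpow_natCast, ← zpow_add₀ q_ne_zero]; simp
  rw [this, one_smul]

theorem Z_col' {i k j : Fin n} (h : i < k) :
    (Z k j * Z i j : Oq n) = q ^ (-2 : ℤ) • (Z i j * Z k j) := by
  rw [Z_col i j k h, smul_smul]
  have : q ^ (-2 : ℤ) * q ^ 2 = 1 := by
    rw [← zpow_natCast, ← zpow_add₀ q_ne_zero]; simp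
  rw [this, one_smul]

theorem map_prod_add_single_of_notMem (r k : Fin n) (a : Fin n → ℕ) {l : List (Fin n)}
    (h : k ∉ l) : (l.map fun j => (Z r j : Oq n) ^ (a + Pi.single k 1 : Fin n → ℕ) j).prod =
      (l.map fun j => Z r j ^ a j).prod := by
  congr 1
  refine List.map_congr_left fun j hj => ?_
  have : j ≠ k := fun e => h (e ▸ hj)
  simp [this]

theorem Z_mul_list_prod (r k : Fin n) (a : Fin n → ℕ) {l : List (Fin n)}
    (hl : l.Pairwise (· < ·)) (hk : k ∈ l) :
    Z r k * (l.map fun j => (Z r j : Oq n) ^ a j).prod =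
      q ^ (-2 * (l.map fun j => if j < k then (a j : ℤ) else 0).sum) •
        (l.map fun j => Z r j ^ (a + Pi.single k 1 : Fin n → ℕ) j).prod := by
  induction l with
  | nil => simp at hk
  | cons x l ih =>
    rw [List.pairwise_cons] at hl
    simp only [List.map_cons, List.prod_cons, List.sum_cons]
    by_cases hx : x = k
    · subst hx
      rw [map_prod_add_single_of_notMem _ _ _ fun h => (hl.1 x h).false]
      have : (l.map fun j => if j < x then (a j : ℤ) else 0).sum = 0 := by
        apply List.sum_eq_zero
        intro y hy
        obtain ⟨j, hj, rfl⟩ := List.mem_map.1 hy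
        rw [if_neg (hl.1 j hj).not_gt]
      rw [this, if_neg (lt_irrefl x), ← mul_assoc, ← pow_succ']
      simp
    · have hk' : k ∈ l := (List.mem_cons.1 hk).resolve_left fun h => hx h.symm
      have hxk := hl.1 k hk'
      rw [← mul_assoc, mul_pow_of_q_commute (Z_row' hxk), smul_mul_assoc, mul_assoc,
        ih hl.2 hk', if_pos hxk, mul_smul_comm, smul_smul, ← zpow_natCast, ← zpow_mul,
        ← zpow_add₀ q_ne_zero, mul_add]
      simp [hx]

theorem list_prod_mul_Z (r k : Fin n) (a : Fin n → ℕ) {l : List (Fin n)}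
    (hl : l.Pairwise (· < ·)) (hk : k ∈ l) :
    (l.map fun j => (Z r j : Oq n) ^ a j).prod * Z r k =
      q ^ (-2 * (l.map fun j => if k < j then (a j : ℤ) else 0).sum) •
        (l.map fun j => Z r j ^ (a + Pi.single k 1 : Fin n → ℕ) j).prod := by
  induction l using List.reverseRecOn with
  | nil => simp at hk
  | append_singleton l x ih =>
    rw [List.pairwise_append] at hl
    simp only [List.map_append, List.prod_append, List.sum_append, List.map_cons, List.map_nil,
      List.prod_cons, List.prod_nil, List.sum_cons, List.sum_nil, mul_one, add_zero]
    by_cases hx : x = k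
    · subst hx
      rw [map_prod_add_single_of_notMem _ _ _ fun h => (hl.2.2 x h x (by simp)).false]
      have : (l.map fun j => if x < j then (a j : ℤ) else 0).sum = 0 := by
        apply List.sum_eq_zero
        intro y hy
        obtain ⟨j, hj, rfl⟩ := List.mem_map.1 hy
        rw [if_neg (hl.2.2 j hj x (by simp)).not_gt]
      rw [this, if_neg (lt_irrefl x), mul_assoc, ← pow_succ]
      simp
    · have hk' : k ∈ l := by
        rcases List.mem_append.1 hk with h | h
        · exact h
        · exact absurd (List.mem_singleton.1 h).symm hx
      have hxk := hl.2.2 k hk' x (by simp)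
      rw [mul_assoc, pow_mul_of_q_commute (Z_row' hxk), mul_smul_comm, ← mul_assoc,
        ih hl.1 hk', if_pos hxk, smul_mul_assoc, smul_smul, ← zpow_natCast, ← zpow_mul,
        ← zpow_add₀ q_ne_zero, mul_add, add_comm (-2 * _)]
      simp [hx]

/-- `∑_{j > k} a_j a_k`. -/
def pairSum (a : Fin n → ℕ) : ℤ :=
  ∑ j, ∑ k ∈ Finset.univ.filter (fun k => k < j), (a j : ℤ) * (a k : ℤ)

/-- The normalized monomial `q^{-∑_{j>k} a_j a_k} ∏_j Z_{rj}^{a_j}`. -/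
def rowMonomial (r : Fin n) (a : Fin n → ℕ) : Oq n :=
  q ^ (-pairSum a) • ((List.finRange n).map fun j => Z r j ^ a j).prod

/-- `∑_{l < k} a_l`. -/
def sumLT (a : Fin n → ℕ) (k : Fin n) : ℤ := ∑ l ∈ Finset.univ.filter (· < k), (a l : ℤ)

/-- `∑_{l > k} a_l`. -/
def sumGT (a : Fin n → ℕ) (k : Fin n) : ℤ := ∑ l ∈ Finset.univ.filter (k < ·), (a l : ℤ)

theorem sumLT_nonneg (a : Fin n → ℕ) (k : Fin n) : 0 ≤ sumLT a k :=
  Finset.sum_nonneg fun _ _ => Int.natCast_nonneg _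

theorem sumGT_nonneg (a : Fin n → ℕ) (k : Fin n) : 0 ≤ sumGT a k :=
  Finset.sum_nonneg fun _ _ => Int.natCast_nonneg _

theorem sumLT_add_sumGT (a : Fin n → ℕ) (k : Fin n) :
    sumLT a k + a k + sumGT a k = ∑ l, (a l : ℤ) := by
  have : ∀ l, (a l : ℤ) = (if l < k then (a l : ℤ) else 0) + (if l = k then (a l : ℤ) else 0) +
      (if k < l then (a l : ℤ) else 0) := fun l => by
    rcases lt_trichotomy l k with h | h | h
    · simp [h, h.ne, h.not_gt]
    · simp [h]
    · simp [h, h.ne', h.not_gt]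
  rw [Finset.sum_congr rfl fun l _ => this l, Finset.sum_add_distrib, Finset.sum_add_distrib,
    Finset.sum_ite_eq', sumLT, sumGT, Finset.sum_filter, Finset.sum_filter]
  simp

theorem pairSum_add_single (a : Fin n → ℕ) (k : Fin n) :
    pairSum (a + Pi.single k 1) = pairSum a + sumLT a k + sumGT a k := by
  have h : ∀ j l : Fin n, l < j → (((a + Pi.single k 1 : Fin n → ℕ) j : ℕ) : ℤ) * ((a + Pi.single k 1 : Fin n → ℕ) l : ℕ) =
      a j * a l + (if j = k then (a l : ℤ) else 0) + (if l = k then (a j : ℤ) else 0) := by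
    intro j l hlj
    by_cases hj : j = k
    · subst hj
      simp [hlj.ne]; ring
    · by_cases hl : l = k
      · subst hl
        simp [hj]; ring
      · simp [hj, hl]
  unfold pairSum
  rw [Finset.sum_congr rfl fun j _ => Finset.sum_congr rfl fun l hl =>
    h j l (Finset.mem_filter.1 hl).2]
  simp only [Finset.sum_add_distrib, sumLT, sumGT, Finset.sum_filter]
  congr 1
  · congr 1
    rw [Finset.sum_eq_single k (fun j _ hj => by simp [hj]) (by simp)]
    simp
  · refine Finset.sum_congr rfl fun j _ => ?_
    rw [Finset.sum_eq_single k (fun l _ hl => by simp [hl]) (by simp)]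
    simp

theorem sum_finRange_map (f : Fin n → ℤ) : ((List.finRange n).map f).sum = ∑ j, f j :=
  (Fin.sum_univ_def f).symm

/-- Passing the letters left of column k costs q^{-2} each, and the normalizing exponent grows by
`sumLT` + `sumGT`; the difference is what remains. -/
theorem Z_mul_rowMonomial (r k : Fin n) (a : Fin n → ℕ) :
    Z r k * rowMonomial r a =
      q ^ (sumGT a k - sumLT a k) • rowMonomial r (a + Pi.single k 1) := by
  rw [rowMonomial, rowMonomial, mul_smul_comm,
    Z_mul_list_prod r k a (List.pairwise_lt_finRange n) (List.mem_finRange k), smul_smul, smul_smul,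
    ← zpow_add₀ q_ne_zero, ← zpow_add₀ q_ne_zero, pairSum_add_single, sum_finRange_map,
    ← Finset.sum_filter]
  change q ^ (_ + -2 * sumLT a k) • _ = _
  congr 2
  ring

theorem rowMonomial_mul_Z (r k : Fin n) (a : Fin n → ℕ) :
    rowMonomial r a * Z r k =
      q ^ (sumLT a k - sumGT a k) • rowMonomial r (a + Pi.single k 1) := by
  rw [rowMonomial, rowMonomial, smul_mul_assoc,
    list_prod_mul_Z r k a (List.pairwise_lt_finRange n) (List.mem_finRange k), smul_smul, smul_smul,
    ← zpow_add₀ q_ne_zero, ← zpow_add₀ q_ne_zero, pairSum_add_single, sum_finRange_map,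
    ← Finset.sum_filter]
  change q ^ (_ + -2 * sumGT a k) • _ = _
  congr 2
  ring

theorem rowMonomial_zero (r : Fin n) : rowMonomial r 0 = 1 := by
  simp [rowMonomial, pairSum]

/-- Induction on an exponent vector. -/
theorem exponent_induction {P : (Fin n → ℕ) → Prop} (h0 : P 0)
    (h1 : ∀ a k, (∀ l, k < l → a l = 0) → P a → P (a + Pi.single k 1)) (a : Fin n → ℕ) : P a := by
  induction hs : ∑ l, a l generalizing a with
  | zero =>
    have : a = 0 := by
      funext l
      exact (Finset.sum_eq_zero_iff.1 hs) l (Finset.mem_univ l)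
    exact this ▸ h0
  | succ m ih =>
    have hne : (Finset.univ.filter fun l => a l ≠ 0).Nonempty := by
      by_contra h
      rw [Finset.not_nonempty_iff_eq_empty, Finset.filter_eq_empty_iff] at h
      rw [Finset.sum_eq_zero fun l hl => not_not.1 (h hl)] at hs
      omega
    obtain ⟨k, hk, hmax⟩ := Finset.exists_max_image _ id hne
    have hk0 := (Finset.mem_filter.1 hk).2
    have ha : a = (a - Pi.single k 1) + Pi.single k 1 := by
      funext l
      by_cases h : l = k
      · subst h; simp; omega
      · simp [h]
    rw [ha]
    apply h1
    · intro l hl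
      have : a l = 0 := by
        by_contra h
        exact (hmax l (by simp [h])).not_gt hl
      simp [this]
    · apply ih
      rw [ha] at hs
      simp only [Pi.add_apply, Finset.sum_add_distrib, Finset.sum_pi_single', Finset.mem_univ,
        if_true] at hs
      omega

/-- Left and right multiplication by a letter have mutually inverse coefficients, and bar
interchanges the two. -/
theorem bar_rowMonomial (r : Fin n) (a : Fin n → ℕ) :
    bar (rowMonomial r a) = rowMonomial r a := by
  induction a using exponent_induction with
  | h0 => rw [rowMonomial_zero, bar_one]
  | h1 a k _ ih =>
    have h := congrArg bar (Z_mul_rowMonomial r k a)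
    rw [bar_mul, bar_smul, bar_Z, ih, rowMonomial_mul_Z, map_zpow₀, barK_q, inv_zpow', neg_sub] at h
    exact (smul_right_injective (Oq n) (zpow_ne_zero _ q_ne_zero) h).symm

end
end QuantumMatrix

/-! ### Building normalized monomials row by row -/

namespace QuantumMatrix
noncomputable section

variable {n : ℕ}

/-- The rows of `A` before row `r` vanish. -/
def RowsGE (r : ℕ) (A : Mat n) : Prop := ∀ i j : Fin n, i.val < r → A i j = 0

theorem rowsGE_zero (A : Mat n) : RowsGE 0 A := fun _ _ h => absurd h (Nat.not_lt_zero _)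

theorem RowsGE.eq_zero {A : Mat n} (h : RowsGE n A) : A = 0 := by
  ext i j
  exact h i j i.2

theorem RowsGE.updateRow {r : Fin n} {A : Mat n} (h : RowsGE (r.val + 1) A) (a : Fin n → ℕ) :
    RowsGE r.val (A.updateRow r a) := by
  intro i j hi
  have : i ≠ r := fun e => by subst e; exact lt_irrefl _ hi
  rw [Matrix.updateRow_ne this]
  exact h i j (by omega)

theorem RowsGE.updateRow_zero {r : Fin n} {A : Mat n} (h : RowsGE r.val A) :
    RowsGE (r.val + 1) (A.updateRow r 0) := by
  intro i j hi
  by_cases hr : i = r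
  · subst hr; rw [Matrix.updateRow_self]; rfl
  · rw [Matrix.updateRow_ne hr]
    have : i.val ≠ r.val := fun e => hr (Fin.ext e)
    exact h i j (by omega)

theorem updateRow_updateRow_self (A : Mat n) (r : Fin n) (a : Fin n → ℕ) :
    (A.updateRow r a).updateRow r (A r) = A := by
  ext i j
  by_cases hr : i = r
  · subst hr; rw [Matrix.updateRow_self]
  · rw [Matrix.updateRow_ne hr, Matrix.updateRow_ne hr]

/-- Induction on matrices, adding rows from the last to the first. -/
theorem rowsGE_induction {P : ℕ → Mat n → Prop} (h0 : P n 0)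
    (h1 : ∀ (r : Fin n) (A : Mat n) (a : Fin n → ℕ), RowsGE (r.val + 1) A → P (r.val + 1) A →
      P r.val (A.updateRow r a)) {r : ℕ} (hr : r ≤ n) {A : Mat n} (hA : RowsGE r A) : P r A := by
  induction hr using Nat.decreasingInduction generalizing A with
  | self => rw [hA.eq_zero]; exact h0
  | of_succ k hk ih =>
    have h := (RowsGE.updateRow_zero (r := ⟨k, hk⟩) hA)
    have := h1 ⟨k, hk⟩ _ (A ⟨k, hk⟩) h (ih h)
    rwa [updateRow_updateRow_self] at this

theorem colSum_updateRow {r : Fin n} {A : Mat n} (h : RowsGE (r.val + 1) A) (a : Fin n → ℕ)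
    (l : Fin n) : colSum (A.updateRow r a) l = a l + colSum A l := by
  have e : ∀ i, A.updateRow r a i l = (if i = r then a l else 0) + A i l := fun i => by
    by_cases hr : i = r
    · subst hr; rw [Matrix.updateRow_self, if_pos rfl, h i l (by omega), add_zero]
    · rw [Matrix.updateRow_ne hr, if_neg hr, zero_add]
  rw [colSum, Finset.sum_congr rfl fun i _ => e i, Finset.sum_add_distrib, Finset.sum_ite_eq',
    if_pos (Finset.mem_univ r), colSum]

theorem rowSum_updateRow_self (r : Fin n) (A : Mat n) (a : Fin n → ℕ) :
    rowSum (A.updateRow r a) r = ∑ l, a l := by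
  rw [rowSum, Matrix.updateRow_self]

theorem rowSum_updateRow_ne {r i : Fin n} (h : i ≠ r) (A : Mat n) (a : Fin n → ℕ) :
    rowSum (A.updateRow r a) i = rowSum A i := by
  rw [rowSum, rowSum, Matrix.updateRow_ne h]

theorem list_prod_update {M : Type*} [Monoid M] (r : Fin n) (f : Fin n → M) (x : M)
    {l : List (Fin n)} (hl : l.Pairwise (· < ·)) (hr : r ∈ l) (hf : ∀ i ≤ r, f i = 1) :
    (l.map (Function.update f r x)).prod = x * (l.map f).prod := by
  induction l with
  | nil => simp at hr
  | cons y l ih =>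
    rw [List.pairwise_cons] at hl
    rw [List.map_cons, List.map_cons, List.prod_cons, List.prod_cons]
    by_cases hy : y = r
    · subst hy
      have : l.map (Function.update f y x) = l.map f := List.map_congr_left fun i hi =>
        Function.update_of_ne (hl.1 i hi).ne' _ _
      rw [this, hf y le_rfl, one_mul, Function.update_self]
    · have hr' : r ∈ l := (List.mem_cons.1 hr).resolve_left fun h => hy h.symm
      rw [Function.update_of_ne hy, hf y (hl.1 r hr').le, one_mul, one_mul, ih hl.2 hr']

theorem monomial_updateRow {r : Fin n} {A : Mat n} (h : RowsGE (r.val + 1) A) (a : Fin n → ℕ) :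
    monomial (A.updateRow r a) =
      ((List.finRange n).map fun j => Z r j ^ a j).prod * monomial A := by
  have e : (fun i => ((List.finRange n).map fun j => (Z i j : Oq n) ^ A.updateRow r a i j).prod) =
      Function.update (fun i => ((List.finRange n).map fun j => (Z i j : Oq n) ^ A i j).prod) r
        ((List.finRange n).map fun j => Z r j ^ a j).prod := by
    funext i
    by_cases hr : i = r
    · subst hr; rw [Function.update_self, Matrix.updateRow_self]
    · rw [Function.update_of_ne hr, Matrix.updateRow_ne hr]
  rw [monomial, e, list_prod_update r _ _ (List.pairwise_lt_finRange n) (List.mem_finRange r)]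
  · rfl
  · intro i hi
    apply List.prod_eq_one
    intro x hx
    obtain ⟨j, -, rfl⟩ := List.mem_map.1 hx
    rw [h i j (by have : i.val ≤ r.val := hi
                  omega), pow_zero]

theorem pairSum_update (f : Fin n → ℕ) (r : Fin n) (m : ℕ) (hf : ∀ l ≤ r, f l = 0) :
    pairSum (f + Pi.single r m) = pairSum f + m * ∑ l, (f l : ℤ) := by
  induction m with
  | zero => simp
  | succ m ih =>
    have hLT : sumLT (f + Pi.single r m) r = 0 := Finset.sum_eq_zero fun l hl => by
      have hl := (Finset.mem_filter.1 hl).2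
      simp [hf l hl.le, hl.ne]
    have hGT : sumGT (f + Pi.single r m) r = ∑ l, (f l : ℤ) := by
      rw [sumGT, Finset.sum_filter]
      refine Finset.sum_congr rfl fun l _ => ?_
      split_ifs with hl
      · simp [hl.ne']
      · simp [hf l (not_lt.1 hl)]
    rw [Pi.single_add, ← add_assoc, pairSum_add_single, hLT, hGT, ih]
    push_cast
    ring

theorem ZN_eq (A : Mat n) :
    ZN A = q ^ (-(∑ i, pairSum (A i)) - ∑ l, pairSum fun i => A i l) • monomial A := rfl

theorem ZN_zero : ZN (0 : Mat n) = 1 := by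
  rw [ZN_eq]
  have : monomial (0 : Mat n) = 1 := by
    rw [monomial]
    apply List.prod_eq_one
    intro x hx
    obtain ⟨i, -, rfl⟩ := List.mem_map.1 hx
    apply List.prod_eq_one
    intro x hx
    obtain ⟨j, -, rfl⟩ := List.mem_map.1 hx
    exact pow_zero _
  simp [pairSum, this]

/-- The recursion for the normalized monomials, row by row. -/
theorem ZN_updateRow {r : Fin n} {A : Mat n} (h : RowsGE (r.val + 1) A) (a : Fin n → ℕ) :
    ZN (A.updateRow r a) =
      q ^ (-∑ l, (a l : ℤ) * colSum A l) • (rowMonomial r a * ZN A) := by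
  have hrow : ∑ i, pairSum (A.updateRow r a i) = pairSum a + ∑ i, pairSum (A i) := by
    have e : ∀ i, pairSum (A.updateRow r a i) = (if i = r then pairSum a else 0) + pairSum (A i) := by
      intro i
      by_cases hr : i = r
      · subst hr
        have : pairSum (A i) = 0 := by
          unfold pairSum
          simp [h i _ (Nat.lt_succ_self _)]
        rw [Matrix.updateRow_self, if_pos rfl, this, add_zero]
      · rw [Matrix.updateRow_ne hr, if_neg hr, zero_add]
    rw [Finset.sum_congr rfl fun i _ => e i, Finset.sum_add_distrib, Finset.sum_ite_eq',
      if_pos (Finset.mem_univ r)]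
  have hcol : ∀ l, (pairSum fun i => A.updateRow r a i l) =
      (pairSum fun i => A i l) + a l * colSum A l := by
    intro l
    have e : (fun i => A.updateRow r a i l) = (fun i => A i l) + Pi.single r (a l) := by
      funext i
      by_cases hr : i = r
      · subst hr; simp [h i l (Nat.lt_succ_self _)]
      · simp [hr]
    rw [e, pairSum_update _ _ _ fun i (hi : i.val ≤ r.val) => h i l (by omega), colSum]
    push_cast
    rfl
  rw [ZN_eq, ZN_eq, monomial_updateRow h, rowMonomial, hrow, Finset.sum_congr rfl fun l _ => hcol l,
    Finset.sum_add_distrib, smul_mul_assoc, mul_smul_comm, smul_smul, smul_smul,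
    ← zpow_add₀ q_ne_zero, ← zpow_add₀ q_ne_zero]
  congr 2
  ring

theorem rowMonomial_mul_ZN {r : Fin n} {A : Mat n} (h : RowsGE (r.val + 1) A) (a : Fin n → ℕ) :
    rowMonomial r a * ZN A =
      q ^ (∑ l, (a l : ℤ) * colSum A l) • ZN (A.updateRow r a) := by
  rw [ZN_updateRow h, smul_smul, ← zpow_add₀ q_ne_zero, add_neg_cancel, zpow_zero, one_smul]

end
end QuantumMatrix

/-! ### Moving a minor past a monomial in its first row -/

namespace QuantumMatrix
noncomputable section

variable {n : ℕ}

theorem q_mem_Zq : q ∈ Zq := Algebra.subset_adjoin rfl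

theorem zpow_mem_Zq {e : ℤ} (he : 0 ≤ e) : q ^ e ∈ Zq := by
  lift e to ℕ using he
  rw [zpow_natCast]
  exact pow_mem q_mem_Zq e

theorem Zq_smul_mem {S : Submodule Zq (Oq n)} {c : K} {x : Oq n} (hc : c ∈ Zq) (hx : x ∈ S) :
    c • x ∈ S :=
  S.smul_mem (⟨c, hc⟩ : Zq) hx

/-- `∑_{l ∉ J} a_l`. -/
def sumNot (J : Finset (Fin n)) (a : Fin n → ℕ) : ℤ := ∑ l ∈ Jᶜ, (a l : ℤ)

/-- The indicator vector of a set of columns. -/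
def ind (J : Finset (Fin n)) : Fin n → ℕ := fun l => if l ∈ J then 1 else 0

theorem sumLT_add (a b : Fin n → ℕ) (k : Fin n) : sumLT (a + b) k = sumLT a k + sumLT b k := by
  simp [sumLT, Finset.sum_add_distrib]

theorem sumGT_add (a b : Fin n → ℕ) (k : Fin n) : sumGT (a + b) k = sumGT a k + sumGT b k := by
  simp [sumGT, Finset.sum_add_distrib]

theorem sumNot_add (J : Finset (Fin n)) (a b : Fin n → ℕ) :
    sumNot J (a + b) = sumNot J a + sumNot J b := by
  simp [sumNot, Finset.sum_add_distrib]

theorem sumNot_single (J : Finset (Fin n)) (k : Fin n) :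
    sumNot J (Pi.single k 1) = if k ∈ J then 0 else 1 := by
  by_cases h : k ∈ J <;> simp [sumNot, Pi.single_apply, Finset.sum_ite_eq', h]

theorem sum_ind (J : Finset (Fin n)) : ∑ l, (ind J l : ℤ) = J.card := by
  simp [ind]

/-- The `ℤ[q]`-span of the suitably normalized products `R(a) M_J` of given content. -/
def minorSpan (I : Finset (Fin n)) (r : Fin n) (c : Fin n → ℕ) : Submodule Zq (Oq n) :=
  Submodule.span Zq {x | ∃ (a : Fin n → ℕ) (J : Finset (Fin n)), a + ind J = c ∧ J.card = I.card ∧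
    x = q ^ sumNot J a • (rowMonomial r a * minor I J)}

/-- Equality of the contents a' + ind J' = a + ind J, together with |J'| = |J|, gives `sumGT a' j -
sumLT a' j` in terms of a and J. With the bound on e, the power of q left over is at least 2·`sumGT
a' j`, hence nonnegative. -/
theorem Z_mul_mem_minorSpan {I J : Finset (Fin n)} {r j : Fin n} {a : Fin n → ℕ}
    (ha : ∀ l, j < l → a l = 0) (hJ : J.card = I.card) {e : ℤ}
    (he : sumLT a j + (if j ∈ J then 0 else 1) ≤ e) {y : Oq n}
    (hy : y ∈ minorSpan I r (a + ind J)) :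
    q ^ e • (Z r j * y) ∈ minorSpan I r (a + ind J + Pi.single j 1) := by
  induction hy using Submodule.span_induction with
  | zero => simp
  | add x y _ _ hx hy => rw [mul_add, smul_add]; exact add_mem hx hy
  | smul c x _ hx =>
    have : q ^ e • (Z r j * c • x) = c • q ^ e • (Z r j * x) := by
      rw [mul_smul_comm, smul_comm]
    rw [this]
    exact Submodule.smul_mem _ _ hx
  | mem x hx =>
    obtain ⟨a', J', hc, hJ', rfl⟩ := hx
    have h₁ := congrArg (sumLT · j) hc
    have h₂ := congrArg (sumGT · j) hc
    have h₃ := sumLT_add_sumGT (ind J) j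
    have h₄ := sumLT_add_sumGT (ind J') j
    rw [sum_ind, hJ] at h₃
    rw [sum_ind, hJ'] at h₄
    simp only [sumLT_add, sumGT_add] at h₁ h₂
    have h₅ : sumGT a j = 0 := Finset.sum_eq_zero fun l hl => by
      rw [ha l (Finset.mem_filter.1 hl).2]; rfl
    have h₆ := sumGT_nonneg a' j
    have h₇ : (ind J j : ℤ) = if j ∈ J then 1 else 0 := by simp [ind]
    have h₈ : (ind J' j : ℤ) = if j ∈ J' then 1 else 0 := by simp [ind]
    have h₉ : q ^ e • (Z r j * q ^ sumNot J' a' • (rowMonomial r a' * minor I J')) =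
        q ^ (e + (sumGT a' j - sumLT a' j) - if j ∈ J' then 0 else 1) •
          q ^ sumNot J' (a' + Pi.single j 1) •
            (rowMonomial r (a' + Pi.single j 1) * minor I J') := by
      rw [mul_smul_comm, ← mul_assoc, Z_mul_rowMonomial, smul_mul_assoc, smul_smul, smul_smul,
        smul_smul, ← zpow_add₀ q_ne_zero, ← zpow_add₀ q_ne_zero, ← zpow_add₀ q_ne_zero, sumNot_add,
        sumNot_single]
      congr 2
      ring
    rw [h₉]
    refine Zq_smul_mem (zpow_mem_Zq ?_) (Submodule.subset_span ⟨_, _, ?_, hJ', rfl⟩)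
    · split_ifs at * <;> linarith
    · rw [← hc, add_right_comm]

/-- Moving a quantum minor past a monomial in the entries of its first row. -/
theorem minor_mul_rowMonomial_mem {I : Finset (Fin n)} {r : Fin n} (hr : ∀ s ∈ I, r < s)
    {J : Finset (Fin n)} (hJ : J.card = (insert r I).card) (a : Fin n → ℕ) :
    q ^ sumNot J a • (minor (insert r I) J * rowMonomial r a) ∈
      minorSpan (insert r I) r (a + ind J) := by
  induction a using exponent_induction generalizing J with
  | h0 =>
    refine Submodule.subset_span ⟨0, J, rfl, hJ, ?_⟩
    rw [rowMonomial_zero, one_mul, mul_one]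
  | h1 a k ha ih =>
    have hGT : sumGT a k = 0 := Finset.sum_eq_zero fun l hl => by
      rw [ha l (Finset.mem_filter.1 hl).2]; rfl
    have hR : rowMonomial r (a + Pi.single k 1) = q ^ sumLT a k • (Z r k * rowMonomial r a) := by
      rw [Z_mul_rowMonomial, smul_smul, ← zpow_add₀ q_ne_zero, hGT]
      simp
    rw [hR, sumNot_add, sumNot_single, mul_smul_comm, ← mul_assoc, add_right_comm]
    -- A column of the minor commutes past it; for any other column the exchange rule trades k for
    -- columns j > k of J.
    by_cases hk : k ∈ J
    · have h := Z_mul_mem_minorSpan (e := sumLT a k) ha hJ (by simp [hk]) (ih hJ)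
      rw [minor_commute (Finset.mem_insert_self r I) hk, mul_assoc, if_pos hk, add_zero, smul_smul,
        mul_comm, ← smul_smul, ← mul_smul_comm]
      exact h
    · have h₁ := exchange_insert_min hr (insert k J) k (Finset.mem_insert_self k J)
      rw [Finset.erase_insert hk] at h₁
      rw [h₁, exchangeR, if_neg hk, add_mul, smul_add, smul_add]
      refine Submodule.add_mem _ ?_ ?_
      -- The 3 is 1 from the change of `sumNot` and 2 from the factor q² of the exchange rule.
      · have h := Z_mul_mem_minorSpan (e := sumLT a k + 3) ha hJ (by rw [if_neg hk]; linarith)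
          (ih hJ)
        convert h using 1
        simp only [smul_mul_assoc, mul_smul_comm, smul_smul]
        rw [mul_assoc (Z r k), ← zpow_natCast q 2, ← zpow_add₀ q_ne_zero, ← zpow_add₀ q_ne_zero,
          ← zpow_add₀ q_ne_zero]
        congr 2
        push_cast
        ring
      · rw [smul_mul_assoc, Finset.sum_mul, Finset.smul_sum, Finset.smul_sum, Finset.smul_sum]
        refine Submodule.sum_mem _ fun j hj => ?_
        obtain ⟨hj, hkj⟩ := Finset.mem_filter.1 hj
        have hjJ : j ∈ J := (Finset.mem_insert.1 hj).resolve_left hkj.ne'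
        have hJ₁ : ((insert k J).erase j).card = (insert r I).card := by
          rw [Finset.card_erase_of_mem hj, Finset.card_insert_of_notMem hk, hJ, Nat.add_sub_cancel]
        have hLT : sumLT a j = sumLT a k + a k := by
          have h₁ := sumLT_add_sumGT a k
          have h₂ := sumLT_add_sumGT a j
          have h₃ : sumGT a j = 0 := Finset.sum_eq_zero fun l hl => by
            rw [ha l (hkj.trans (Finset.mem_filter.1 hl).2)]; rfl
          have h₄ := ha j hkj
          rw [h₄] at h₂
          push_cast at h₂
          linarith
        -- J loses j and gains k. As a_j = 0, `sumNot` drops by a_k, which is also the excess of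
        -- `sumLT` at j over its value at k; the required bound is met with equality.
        have h := Z_mul_mem_minorSpan (e := sumLT a k + a k + 1) (fun l hl => ha l (hkj.trans hl))
          hJ₁ (by rw [if_neg (Finset.notMem_erase j _), hLT]) (ih hJ₁)
        have hNot : sumNot ((insert k J).erase j) a + a k = sumNot J a := by
          have h₁ : (((insert k J).erase j)ᶜ : Finset (Fin n)) = insert j (Jᶜ.erase k) := by
            ext l; simp
          rw [sumNot, h₁, Finset.sum_insert (by simp [hjJ]), ha j hkj, sumNot,
            ← Finset.sum_erase_add _ _ (Finset.mem_compl.2 hk)]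
          simp
        have hc : a + ind ((insert k J).erase j) + Pi.single j 1 = a + ind J + Pi.single k 1 := by
          rw [add_assoc, add_assoc]
          congr 1
          funext l
          by_cases h₁ : l = j
          · subst h₁; simp [ind, hjJ, hkj.ne']
          · by_cases h₂ : l = k
            · subst h₂; simp [ind, hk, hkj.ne]
            · simp [ind, h₁, h₂]
        rw [hc] at h
        have hmem : (1 - q ^ 4) * (-q ^ 2) ^ ((insert k J).filter fun x => k < x ∧ x < j).card ∈ Zq :=
          mul_mem (sub_mem (one_mem _) (pow_mem q_mem_Zq 4)) (pow_mem (neg_mem (pow_mem q_mem_Zq 2)) _)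
        convert Zq_smul_mem hmem h using 1
        simp only [smul_mul_assoc, mul_smul_comm, smul_smul]
        rw [mul_assoc (Z r j), ← hNot, zpow_add₀ q_ne_zero, zpow_add₀ q_ne_zero, zpow_add₀ q_ne_zero,
          zpow_add₀ q_ne_zero]
        congr 1
        ring

end
end QuantumMatrix

/-! ### Products of minors with normalized monomials stay in the lattice -/

namespace QuantumMatrix
noncomputable section

variable {n : ℕ}

/-- The rows `r, …, t - 1`. -/
def rowBlock (n r t : ℕ) : Finset (Fin n) := Finset.univ.filter fun i => r ≤ i.val ∧ i.val < t

theorem mem_rowBlock {r t : ℕ} {i : Fin n} : i ∈ rowBlock n r t ↔ r ≤ i.val ∧ i.val < t := by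
  simp [rowBlock]

theorem rowBlock_self (n t : ℕ) : rowBlock n t t = ∅ :=
  Finset.filter_eq_empty_iff.2 fun _ _ h => by omega

theorem rowBlock_eq_insert {t : ℕ} (i : Fin n) (hi : i.val < t) :
    rowBlock n i.val t = insert i (rowBlock n (i.val + 1) t) := by
  ext x
  simp only [mem_rowBlock, Finset.mem_insert, Fin.ext_iff]
  omega

theorem lt_of_mem_rowBlock {t : ℕ} {i : Fin n} : ∀ s ∈ rowBlock n (i.val + 1) t, i < s := by
  intro s hs
  have := (mem_rowBlock.1 hs).1
  exact Fin.lt_def.2 (by omega)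

/-- The `ℤ[q]`-span of the `Z(B)` with given column sums and vanishing rows before row `r`. -/
def latticeGE (r : ℕ) (c : Fin n → ℕ) : Submodule Zq (Oq n) :=
  Submodule.span Zq {x | ∃ B : Mat n, RowsGE r B ∧ colSum B = c ∧ x = ZN B}

theorem sum_mem_add_sumNot (J : Finset (Fin n)) (a : Fin n → ℕ) :
    ∑ l ∈ J, (a l : ℤ) + sumNot J a = ∑ l, (a l : ℤ) :=
  Finset.sum_add_sum_compl J _

theorem sum_mul_ind (c : Fin n → ℕ) (J : Finset (Fin n)) :
    ∑ l, (ind J l : ℤ) * c l = ∑ l ∈ J, (c l : ℤ) := by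
  simp [ind]

theorem sum_single_mul (j : Fin n) (f : Fin n → ℤ) :
    ∑ l, ((Pi.single j 1 : Fin n → ℕ) l : ℤ) * f l = f j := by
  rw [Finset.sum_eq_single j (fun l _ hl => by simp [hl]) (by simp)]
  simp

theorem sum_add_single_mul_add_ind {J : Finset (Fin n)} {j : Fin n} (hj : j ∈ J)
    (a c : Fin n → ℕ) :
    ∑ l, ((a + Pi.single j 1 : Fin n → ℕ) l : ℤ) * ((c + ind (J.erase j)) l : ℕ) =
      ∑ l, (a l : ℤ) * c l + c j + (∑ l, (a l : ℤ) - sumNot J a) - a j := by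
  have h₁ : ∑ l, (a l : ℤ) * (ind (J.erase j) l : ℕ) = ∑ l ∈ J, (a l : ℤ) - a j := by
    rw [← Finset.sum_erase_add _ _ hj, add_sub_cancel_right, ← sum_mul_ind]
    exact Finset.sum_congr rfl fun l _ => mul_comm _ _
  have h₂ : (ind (J.erase j) j : ℤ) = 0 := by simp [ind]
  simp only [Pi.add_apply, Nat.cast_add, add_mul, mul_add, Finset.sum_add_distrib]
  rw [sum_single_mul j fun l => (c l : ℤ), sum_single_mul j fun l => (ind (J.erase j) l : ℤ), h₁, h₂]
  have := sum_mem_add_sumNot J a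
  linarith

theorem rowMonomial_mul_Z_mul_ZN {r j : Fin n} {J : Finset (Fin n)} (hj : j ∈ J) {B : Mat n}
    (hB : RowsGE (r.val + 1) B) {c : Fin n → ℕ} (hc : colSum B = c + ind (J.erase j))
    (a : Fin n → ℕ) :
    rowMonomial r a * (Z r j * ZN B) =
      q ^ (2 * sumLT a j + ∑ l, (a l : ℤ) * c l + c j - sumNot J a) •
        ZN (B.updateRow r (a + Pi.single j 1)) := by
  rw [← mul_assoc, rowMonomial_mul_Z, smul_mul_assoc, rowMonomial_mul_ZN hB, smul_smul,
    ← zpow_add₀ q_ne_zero, hc, sum_add_single_mul_add_ind hj]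
  congr 2
  have := sumLT_add_sumGT a j
  linarith

theorem add_single_add_ind_erase {J : Finset (Fin n)} {j : Fin n} (hj : j ∈ J) :
    Pi.single j 1 + ind (J.erase j) = ind J := by
  funext l
  by_cases h : l = j
  · subst h; simp [ind, hj]
  · simp [ind, h]

/-- The power of q in `rowMonomial_mul_Z_mul_ZN` depends on the matrix only through its column sums,
so a single condition on e serves the whole span. -/
theorem rowMonomial_mul_Z_mul_mem {r j : Fin n} {J : Finset (Fin n)} (hj : j ∈ J)
    {c : Fin n → ℕ} {a : Fin n → ℕ} {w : Oq n}
    (hw : w ∈ latticeGE (r.val + 1) (c + ind (J.erase j))) {e : ℤ}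
    (he : 0 ≤ e + (2 * sumLT a j + ∑ l, (a l : ℤ) * c l + c j - sumNot J a)) :
    q ^ e • (rowMonomial r a * (Z r j * w)) ∈ latticeGE r.val (a + ind J + c) := by
  induction hw using Submodule.span_induction with
  | zero => simp
  | add x y _ _ hx hy => rw [mul_add, mul_add, smul_add]; exact Submodule.add_mem _ hx hy
  | smul s x _ hx =>
    have : q ^ e • (rowMonomial r a * (Z r j * s • x)) =
        s • q ^ e • (rowMonomial r a * (Z r j * x)) := by
      rw [mul_smul_comm, mul_smul_comm, smul_comm]
    rw [this]
    exact Submodule.smul_mem _ _ hx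
  | mem x hx =>
    obtain ⟨B, hB, hc, rfl⟩ := hx
    rw [rowMonomial_mul_Z_mul_ZN hj hB hc, smul_smul, ← zpow_add₀ q_ne_zero]
    refine Zq_smul_mem (zpow_mem_Zq he) (Submodule.subset_span ⟨_, hB.updateRow _, ?_, rfl⟩)
    funext l
    rw [colSum_updateRow hB, hc, ← add_single_add_ind_erase hj]
    simp only [Pi.add_apply]
    ring

/-- The exponent of `q` in `M_J Z(A)`. -/
def minorExp (r t : ℕ) (J : Finset (Fin n)) (A : Mat n) : ℤ :=
  ∑ l ∈ J, (colSum A l : ℤ) - ∑ i ∈ rowBlock n r t, (rowSum A i : ℤ)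

theorem minorExp_updateRow {t : ℕ} {r : Fin n} (hr : r.val < t) {A : Mat n}
    (hA : RowsGE (r.val + 1) A) (J : Finset (Fin n)) (a : Fin n → ℕ) :
    minorExp r.val t J (A.updateRow r a) = minorExp (r.val + 1) t J A - sumNot J a := by
  have h₁ : r ∉ rowBlock n (r.val + 1) t := fun h => (lt_of_mem_rowBlock r h).false
  rw [minorExp, minorExp, rowBlock_eq_insert r hr, Finset.sum_insert h₁, rowSum_updateRow_self,
    Finset.sum_congr rfl fun l _ => by rw [colSum_updateRow hA],
    Finset.sum_congr (s₁ := rowBlock n (r.val + 1) t) rfl fun i hi => by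
      rw [rowSum_updateRow_ne (lt_of_mem_rowBlock i hi).ne']]
  have := sum_mem_add_sumNot J a
  push_cast
  rw [Finset.sum_add_distrib]
  linarith

theorem minorExp_erase {r t : ℕ} {J : Finset (Fin n)} {j : Fin n} (hj : j ∈ J) (A : Mat n) :
    minorExp r t (J.erase j) A = minorExp r t J A - colSum A j := by
  rw [minorExp, minorExp, ← Finset.sum_erase_add J _ hj]
  ring

/-- Downward induction on r: the row monomial of Z(A) is passed inside `minorSpan`, the minor is
expanded along row r, and the smaller minors act on Z(A') by induction. Arbitrary columns J are
needed because passing the row monomial and expanding both change them. -/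
theorem minor_mul_ZN_mem {t : ℕ} (ht : t ≤ n) {r : ℕ} (hr : r ≤ t) {A : Mat n} (hA : RowsGE r A)
    {J : Finset (Fin n)} (hJ : J.card = (rowBlock n r t).card) :
    q ^ (-minorExp r t J A) • (minor (rowBlock n r t) J * ZN A) ∈
      latticeGE r (colSum A + ind J) := by
  induction hr using Nat.decreasingInduction generalizing A J with
  | self =>
    rw [rowBlock_self, Finset.card_empty, Finset.card_eq_zero] at hJ
    subst hJ
    rw [rowBlock_self, minor_empty, if_pos rfl, one_mul, minorExp, rowBlock_self]
    simp only [Finset.sum_empty, sub_zero, neg_zero, zpow_zero, one_smul]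
    refine Submodule.subset_span ⟨A, hA, ?_, rfl⟩
    funext l
    simp [ind]
  | of_succ k hk ih =>
    obtain ⟨r, rfl⟩ : ∃ r : Fin n, r.val = k := ⟨⟨k, by omega⟩, rfl⟩
    obtain ⟨A', a, hA', rfl⟩ : ∃ (A' : Mat n) (a : Fin n → ℕ), RowsGE (r.val + 1) A' ∧
        A = A'.updateRow r a := ⟨_, A r, hA.updateRow_zero, (updateRow_updateRow_self A r 0).symm⟩
    have hr : r.val < t := hk
    have hcol : colSum (A'.updateRow r a) + ind J = a + ind J + colSum A' := by
      funext l
      simp only [Pi.add_apply, colSum_updateRow hA']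
      ring
    have key : ∀ y ∈ minorSpan (rowBlock n r.val t) r (a + ind J),
        q ^ (-minorExp (r.val + 1) t J A' - ∑ l, (a l : ℤ) * colSum A' l) • (y * ZN A') ∈
          latticeGE r.val (a + ind J + colSum A') := by
      intro y hy
      induction hy using Submodule.span_induction with
      | zero => simp
      | add x y _ _ hx hy => rw [add_mul, smul_add]; exact Submodule.add_mem _ hx hy
      | smul s x _ hx =>
        rw [smul_mul_assoc, smul_comm]
        exact Submodule.smul_mem _ _ hx
      | mem x hx =>
        obtain ⟨a', J', hc, hJ', rfl⟩ := hx
        rw [rowBlock_eq_insert r hr, minor_insert_min lt_of_mem_rowBlock, wedgeL, ← hc,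
          smul_mul_assoc, mul_assoc, Finset.sum_mul, Finset.mul_sum, Finset.smul_sum,
          Finset.smul_sum]
        refine Submodule.sum_mem _ fun j hj => ?_
        have hcard : (J'.erase j).card = (rowBlock n (r.val + 1) t).card := by
          rw [Finset.card_erase_of_mem hj, hJ', rowBlock_eq_insert r hr, Finset.card_insert_of_notMem
            fun h => (lt_of_mem_rowBlock r h).false, Nat.add_sub_cancel]
        have hw := ih hA' hcard
        have hsum := congrArg (fun f : Fin n → ℕ => ∑ l, (f l : ℤ) * colSum A' l) hc
        simp only [Pi.add_apply, Nat.cast_add, add_mul, Finset.sum_add_distrib, sum_mul_ind] at hsum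
        -- By equality of contents everything in the required exponent cancels except 2·`sumLT a'
        -- j`.
        have h := rowMonomial_mul_Z_mul_mem (a := a') (e := -minorExp (r.val + 1) t J A' -
          ∑ l, (a l : ℤ) * colSum A' l + sumNot J' a' + minorExp (r.val + 1) t (J'.erase j) A')
          hj hw (by
            rw [minorExp_erase hj, minorExp, minorExp]
            have := sumLT_nonneg a' j
            linarith)
        have hmem : (-q ^ 2) ^ (J'.filter (· < j)).card ∈ Zq :=
          pow_mem (neg_mem (pow_mem q_mem_Zq 2)) _
        convert Zq_smul_mem hmem h using 1
        simp only [smul_mul_assoc, mul_smul_comm, smul_smul]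
        rw [mul_assoc (Z r j), ← zpow_add₀ q_ne_zero, ← mul_assoc (q ^ _),
          ← zpow_add₀ q_ne_zero, mul_comm]
        congr 3
        ring
    rw [hcol, ZN_updateRow hA', minorExp_updateRow hr hA']
    have hJ' := hJ
    rw [rowBlock_eq_insert r hr] at hJ'
    have h := minor_mul_rowMonomial_mem lt_of_mem_rowBlock hJ' a
    rw [← rowBlock_eq_insert r hr] at h
    have h := key _ h
    convert h using 1
    simp only [smul_mul_assoc, mul_smul_comm, smul_smul]
    rw [mul_assoc (minor _ _), ← zpow_add₀ q_ne_zero, ← zpow_add₀ q_ne_zero]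
    congr 2
    ring

end
end QuantumMatrix

/-! ### The leading term for the last columns -/

namespace QuantumMatrix
noncomputable section

variable {n : ℕ}

/-- For the last columns no exchange terms arise: a column of J commutes with the minor, and a
column outside J lies to the left of all of J and q-commutes. -/
theorem minor_mul_rowMonomial_of_last {I J : Finset (Fin n)} {r : Fin n} (hr : r ∈ I)
    (hJ : ∀ k ∉ J, ∀ j ∈ J, k < j) (a : Fin n → ℕ) :
    minor I J * rowMonomial r a = q ^ (-2 * sumNot J a) • (rowMonomial r a * minor I J) := by
  induction a using exponent_induction with
  | h0 => simp [rowMonomial_zero, sumNot]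
  | h1 a k _ ih =>
    have hR : rowMonomial r (a + Pi.single k 1) =
        q ^ (sumLT a k - sumGT a k) • (Z r k * rowMonomial r a) := by
      rw [Z_mul_rowMonomial, smul_smul, ← zpow_add₀ q_ne_zero]
      simp
    rw [hR, mul_smul_comm, smul_mul_assoc, smul_comm (q ^ (-2 * _))]
    congr 1
    rw [sumNot_add, sumNot_single, ← mul_assoc]
    by_cases hk : k ∈ J
    · rw [minor_commute hr hk, if_pos hk, mul_assoc, ih, mul_smul_comm, add_zero, mul_assoc]
    · have h := Z_mul_minor_of_lt hr (hJ k hk)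
      have h' : minor I J * Z r k = q ^ (-2 : ℤ) • (Z r k * minor I J) := by
        rw [h, smul_smul, ← zpow_natCast, ← zpow_add₀ q_ne_zero]
        simp
      rw [h', if_neg hk, smul_mul_assoc, mul_assoc, ih, mul_smul_comm, smul_smul,
        ← zpow_add₀ q_ne_zero, mul_assoc]
      congr 2
      ring

/-- The rows of `E n t` from row `r` on. -/
def shiftE (n r t : ℕ) : Mat n :=
  Matrix.of fun i j => if r ≤ i.val ∧ j.val = i.val + (n - t) then 1 else 0

theorem shiftE_zero (n t : ℕ) : shiftE n 0 t = E n t := by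
  ext i j
  simp [shiftE, E]

theorem mem_lastIdx {t : ℕ} {j : Fin n} : j ∈ lastIdx n t ↔ n - t ≤ j.val := by
  simp [lastIdx]

theorem card_rowBlock {r t : ℕ} (hr : r ≤ t) (ht : t ≤ n) : (rowBlock n r t).card = t - r := by
  induction hr using Nat.decreasingInduction with
  | self => simp [rowBlock_self]
  | of_succ k hk ih =>
    have h := rowBlock_eq_insert (n := n) ⟨k, by omega⟩ hk
    simp only at h
    rw [h, Finset.card_insert_of_notMem fun h => (lt_of_mem_rowBlock (i := ⟨k, by omega⟩) _ h).false,
      ih]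
    omega

theorem rowsGE_shiftE (n r t : ℕ) : RowsGE r (shiftE n r t) := fun i j h => by
  have : ¬ r ≤ i.val := by omega
  simp [shiftE, this]

theorem RowsGE.add {r : ℕ} {A B : Mat n} (hA : RowsGE r A) (hB : RowsGE r B) : RowsGE r (A + B) :=
  fun i j h => by rw [Matrix.add_apply, hA i j h, hB i j h]

theorem colSum_add (A B : Mat n) : colSum (A + B) = colSum A + colSum B := by
  funext l
  simp [colSum, Finset.sum_add_distrib]

theorem colSum_shiftE {r t : ℕ} (hr : r ≤ t) (ht : t ≤ n) :
    colSum (shiftE n r t) = ind (lastIdx n (t - r)) := by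
  funext l
  simp only [colSum, shiftE, ind, mem_lastIdx, Matrix.of_apply]
  split_ifs with h
  · rw [Finset.sum_eq_single (⟨l.val - (n - t), by omega⟩ : Fin n)]
    · rw [if_pos]
      simp only
      omega
    · intro i _ hi
      rw [if_neg]
      rintro ⟨h₁, h₂⟩
      apply hi
      ext
      simp only
      omega
    · simp
  · refine Finset.sum_eq_zero fun i _ => if_neg ?_
    rintro ⟨h₁, h₂⟩
    omega

/-- The leading term of the product of a corner minor and a normalized monomial. -/
theorem corner_minor_mul_ZN {t : ℕ} (ht : t ≤ n) {r : ℕ} (hr : r ≤ t) {A : Mat n}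
    (hA : RowsGE r A) :
    q ^ (-1 : ℤ) • (q ^ (-minorExp r t (lastIdx n (t - r)) A) •
        (minor (rowBlock n r t) (lastIdx n (t - r)) * ZN A) - ZN (A + shiftE n r t)) ∈
      latticeGE r (colSum A + ind (lastIdx n (t - r))) := by
  induction hr using Nat.decreasingInduction generalizing A with
  | self =>
    have h₁ : lastIdx n (t - t) = ∅ := Finset.filter_eq_empty_iff.2 fun i _ h => by
      have := i.2
      omega
    have h₂ : shiftE n t t = 0 := by
      ext i j
      simp only [shiftE, Matrix.of_apply, Matrix.zero_apply]
      rw [if_neg]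
      have := j.2
      omega
    rw [h₁, h₂, rowBlock_self, minor_empty, if_pos rfl, one_mul, minorExp, rowBlock_self]
    simp
  | of_succ k hk ih =>
    obtain ⟨r, rfl⟩ : ∃ r : Fin n, r.val = k := ⟨⟨k, by omega⟩, rfl⟩
    obtain ⟨A', a, hA', rfl⟩ : ∃ (A' : Mat n) (a : Fin n → ℕ), RowsGE (r.val + 1) A' ∧
        A = A'.updateRow r a := ⟨_, A r, hA.updateRow_zero, (updateRow_updateRow_self A r 0).symm⟩
    have hr : r.val < t := hk
    have hrn := r.2
    -- m is the column of the 1 in row r of E_t and the smallest column of J.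
    obtain ⟨m, hm⟩ : ∃ m : Fin n, m.val = n - t + r.val := ⟨⟨n - t + r.val, by omega⟩, rfl⟩
    set J := lastIdx n (t - r.val) with hJdef
    have hmJ : m ∈ J := mem_lastIdx.2 (by omega)
    have hmin : ∀ j ∈ J, m ≤ j := fun j hj => by
      have := mem_lastIdx.1 hj
      exact Fin.le_def.2 (by omega)
    have hJm : lastIdx n (t - (r.val + 1)) = J.erase m := by
      ext j
      rw [mem_lastIdx, Finset.mem_erase, mem_lastIdx, ne_eq, Fin.ext_iff]
      omega
    have hlast : ∀ k ∉ J, ∀ j ∈ J, k < j := fun k hk j hj => by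
      rw [mem_lastIdx] at hk hj
      exact Fin.lt_def.2 (by omega)
    have hcol : colSum (A'.updateRow r a) + ind J = a + ind J + colSum A' := by
      funext l
      simp only [Pi.add_apply, colSum_updateRow hA']
      ring
    -- The columns left of m are exactly those outside J; this makes the coefficient of the leading
    -- term exactly 1.
    have hLT : sumLT a m = sumNot J a := by
      rw [sumLT, sumNot]
      congr 1
      ext l
      simp only [Finset.mem_filter, Finset.mem_univ, true_and, Finset.mem_compl, mem_lastIdx,
        hJdef, Fin.lt_def]
      omega
    have hLT' : ∀ j ∈ J, sumNot J a ≤ sumLT a j := fun j hj => by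
      rw [sumLT, sumNot]
      refine Finset.sum_le_sum_of_subset_of_nonneg ?_ fun _ _ _ => Int.natCast_nonneg _
      intro l hl
      simp only [Finset.mem_filter, Finset.mem_univ, true_and]
      exact hlast l (Finset.mem_compl.1 hl) j hj
    set w : Fin n → Oq n := fun j => q ^ (-minorExp (r.val + 1) t (J.erase j) A') •
      (minor (rowBlock n (r.val + 1) t) (J.erase j) * ZN A') with hw
    set e : Fin n → ℤ := fun j =>
      -(∑ l, (a l : ℤ) * colSum A' l) - colSum A' j - sumNot J a with he
    have hexp : q ^ (-minorExp r.val t J (A'.updateRow r a)) •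
        (minor (rowBlock n r.val t) J * ZN (A'.updateRow r a)) =
        ∑ j ∈ J, (-q ^ 2) ^ (J.filter (· < j)).card •
          q ^ e j • (rowMonomial r a * (Z r j * w j)) := by
      rw [ZN_updateRow hA', mul_smul_comm, ← mul_assoc,
        minor_mul_rowMonomial_of_last (mem_rowBlock.2 ⟨le_rfl, hr⟩) hlast, smul_mul_assoc,
        rowBlock_eq_insert r hr, minor_insert_min lt_of_mem_rowBlock, wedgeL, mul_assoc,
        Finset.sum_mul, Finset.mul_sum, Finset.smul_sum, Finset.smul_sum, Finset.smul_sum]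
      refine Finset.sum_congr rfl fun j hj => ?_
      simp only [hw, smul_mul_assoc, mul_smul_comm, smul_smul]
      rw [mul_assoc (Z r j), ← mul_assoc (q ^ _), ← mul_assoc (q ^ _ * q ^ _), mul_comm _ ((-q ^ 2) ^ _),
        ← zpow_add₀ q_ne_zero, ← zpow_add₀ q_ne_zero, ← zpow_add₀ q_ne_zero]
      congr 3
      rw [minorExp_updateRow hr hA', minorExp_erase hj]
      simp only [he]
      ring
    -- For j ≠ m at least one factor -q² is present; it absorbs the q^{-1} and leaves another q.
    have hother : ∀ j ∈ J.erase m, (-q ^ 2) ^ (J.filter (· < j)).card •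
        q ^ (-1 : ℤ) • q ^ e j • (rowMonomial r a * (Z r j * w j)) ∈
          latticeGE r.val (a + ind J + colSum A') := by
      intro j hj
      obtain ⟨hjm, hj⟩ := Finset.mem_erase.1 hj
      have hcard : (J.erase j).card = (rowBlock n (r.val + 1) t).card := by
        rw [Finset.card_erase_of_mem hj, card_lastIdx (by omega), card_rowBlock hk ht]
        omega
      obtain ⟨p, hp⟩ : ∃ p, (J.filter (· < j)).card = p + 1 := Nat.exists_eq_succ_of_ne_zero
        (Finset.card_pos.2 ⟨m, by simp [hmJ, (hmin j hj).lt_of_ne' hjm]⟩).ne'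
      have h := rowMonomial_mul_Z_mul_mem (e := 1 + e j) (a := a) hj
        (minor_mul_ZN_mem ht hk hA' hcard) (by
          have h₁ := hLT' j hj
          simp only [he]
          linarith)
      have hmem : -(-q ^ 2) ^ p ∈ Zq := neg_mem (pow_mem (neg_mem (pow_mem q_mem_Zq 2)) _)
      convert Zq_smul_mem hmem h using 1
      rw [hp, smul_smul, smul_smul, smul_smul, zpow_add₀ q_ne_zero, zpow_one]
      congr 1
      have hq := q_ne_zero
      rw [zpow_neg_one]
      field_simp
      ring
    have hcm : colSum (A' + shiftE n (r.val + 1) t) = colSum A' + ind (J.erase m) := by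
      rw [colSum_add, colSum_shiftE hk ht, hJm]
    have hE : (A' + shiftE n (r.val + 1) t).updateRow r (a + Pi.single m 1) =
        A'.updateRow r a + shiftE n r.val t := by
      ext i j
      by_cases hi : i = r
      · subst hi
        simp only [Matrix.updateRow_self, Matrix.add_apply, Pi.add_apply, shiftE, Matrix.of_apply,
          Pi.single_apply, Fin.ext_iff, hm]
        congr 1
        refine if_congr ?_ rfl rfl
        omega
      · have hi' : i.val ≠ r.val := fun h => hi (Fin.ext h)
        simp only [Matrix.updateRow_ne hi, Matrix.add_apply, shiftE, Matrix.of_apply]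
        congr 1
        refine if_congr ?_ rfl rfl
        omega
    have hlead : q ^ e m • (rowMonomial r a * (Z r m * ZN (A' + shiftE n (r.val + 1) t))) =
        ZN (A'.updateRow r a + shiftE n r.val t) := by
      rw [rowMonomial_mul_Z_mul_ZN hmJ (hA'.add (rowsGE_shiftE n _ t)) hcm, hE, smul_smul,
        ← zpow_add₀ q_ne_zero, hLT]
      have : e m + (2 * sumNot J a + ∑ l, (a l : ℤ) * colSum A' l + colSum A' m - sumNot J a) = 0 := by
        simp only [he]
        ring
      rw [this, zpow_zero, one_smul]
    have hcard0 : (J.filter (· < m)).card = 0 := by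
      rw [Finset.card_eq_zero, Finset.filter_eq_empty_iff]
      exact fun j hj => (hmin j hj).not_gt
    have hm' := ih hA'
    rw [hJm] at hm'
    have hmain := rowMonomial_mul_Z_mul_mem (e := e m) (a := a) hmJ hm' (by
      simp only [he]
      linarith)
    rw [hexp, hcol, ← Finset.add_sum_erase _ _ hmJ, hcard0, pow_zero, one_smul, ← hlead,
      add_sub_right_comm, smul_add, ← smul_sub, ← mul_sub, ← mul_sub, Finset.smul_sum]
    refine Submodule.add_mem _ ?_ (Submodule.sum_mem _ fun j hj => ?_)
    · rw [mul_smul_comm, mul_smul_comm, smul_comm] at hmain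
      exact hmain
    · rw [smul_comm]
      exact hother j hj

end
end QuantumMatrix

/-! ### Straightening words past a row -/

namespace QuantumMatrix
noncomputable section

variable {n : ℕ}

/-- The specialization of Laurent polynomials with integer coefficients to `K`. -/
def laurentHom : LaurentPolynomial ℤ →ₐ[ℤ] K :=
  (LaurentPolynomial.eval₂ (Int.castRingHom K) (Units.mk0 q q_ne_zero)).toIntAlgHom

theorem laurentHom_T (e : ℤ) : laurentHom (LaurentPolynomial.T e) = q ^ e := by
  have : laurentHom (LaurentPolynomial.T e) =
      LaurentPolynomial.eval₂ (Int.castRingHom K) (Units.mk0 q q_ne_zero)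
        (LaurentPolynomial.T e) := rfl
  rw [this, LaurentPolynomial.eval₂_T]
  simp

/-- The subring `ℤ[q, q⁻¹]` of `K`. -/
def Laur : Subalgebra ℤ K := laurentHom.range

theorem zpow_mem_Laur (e : ℤ) : q ^ e ∈ Laur := ⟨LaurentPolynomial.T e, laurentHom_T e⟩

theorem q_sq_sub_mem_Laur : q ^ 2 - (q⁻¹) ^ 2 ∈ Laur := by
  refine sub_mem (by exact_mod_cast zpow_mem_Laur 2) ?_
  rw [inv_pow, ← zpow_natCast, ← zpow_neg]
  exact zpow_mem_Laur _

theorem Laur_smul_mem {S : Submodule Laur (Oq n)} {c : K} {x : Oq n} (hc : c ∈ Laur)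
    (hx : x ∈ S) : c • x ∈ S :=
  S.smul_mem (⟨c, hc⟩ : Laur) hx

/-- The lexicographic order on exponent vectors. -/
def RowLT (a b : Fin n → ℕ) : Prop := ∃ j, (∀ l < j, a l = b l) ∧ a j < b j

theorem RowLT.trans {a b c : Fin n → ℕ} (h₁ : RowLT a b) (h₂ : RowLT b c) : RowLT a c := by
  obtain ⟨j, hj, hj'⟩ := h₁
  obtain ⟨k, hk, hk'⟩ := h₂
  rcases lt_trichotomy j k with h | rfl | h
  · exact ⟨j, fun l hl => (hj l hl).trans (hk l (hl.trans h)), by rwa [← hk j h]⟩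
  · exact ⟨j, fun l hl => (hj l hl).trans (hk l hl), hj'.trans hk'⟩
  · exact ⟨k, fun l hl => (hj l (hl.trans h)).trans (hk l hl), by rwa [hj k h]⟩

theorem RowLT.add_right {a b : Fin n → ℕ} (h : RowLT a b) (c : Fin n → ℕ) :
    RowLT (a + c) (b + c) := by
  obtain ⟨j, hj, hj'⟩ := h
  exact ⟨j, fun l hl => by simp [hj l hl], by simpa using hj'⟩

theorem rowLT_add_single (a : Fin n → ℕ) {j k : Fin n} (h : k < j) :
    RowLT (a + Pi.single j 1) (a + Pi.single k 1) :=
  ⟨k, fun l hl => by simp [hl.ne, (hl.trans h).ne], by simp [h.ne]⟩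

/-- Words in the generators of the rows from `r` on, of given row and column content. -/
inductive IsWord (r : ℕ) : (Fin n → ℕ) → (Fin n → ℕ) → Oq n → Prop
  | one : IsWord r 0 0 1
  | mul {i : Fin n} (j : Fin n) {ρ c : Fin n → ℕ} {x : Oq n} (hi : r ≤ i.val)
      (h : IsWord r ρ c x) : IsWord r (ρ + Pi.single i 1) (c + Pi.single j 1) (Z i j * x)

theorem IsWord.mul_word {r : ℕ} {ρ ρ' c c' : Fin n → ℕ} {x y : Oq n} (hx : IsWord r ρ c x)
    (hy : IsWord r ρ' c' y) : IsWord r (ρ + ρ') (c + c') (x * y) := by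
  induction hx with
  | one => simpa using hy
  | mul j hi _ ih =>
    rw [mul_assoc, add_right_comm, add_right_comm _ _ c']
    exact ih.mul j hi

theorem IsWord.succ {r : ℕ} {ρ c : Fin n → ℕ} {x : Oq n} (hx : IsWord (r + 1) ρ c x) :
    IsWord r ρ c x := by
  induction hx with
  | one => exact .one
  | mul j hi _ ih => exact ih.mul j (by omega)

/-- The span of the products `Z_{rj} y`, `j > k`, of the content of `x Z_{rk}`. -/
def letterSpan (r k : Fin n) (ρ c : Fin n → ℕ) : Submodule Laur (Oq n) :=
  Submodule.span Laur {x | ∃ j, k < j ∧ ∃ c' y, c' + Pi.single j 1 = c + Pi.single k 1 ∧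
    IsWord (r.val + 1) ρ c' y ∧ x = Z r j * y}

/-- Bringing the letter of row r to the front can swap columns only when s > j, so that letter never
moves to a smaller column. -/
theorem Z_mul_Z_row {r i : Fin n} (h : r < i) (s j : Fin n) :
    ∃ d : K, d ∈ Laur ∧ (s ≤ j → d = 0) ∧ (Z i s * Z r j : Oq n) =
      q ^ (if s = j then (-2 : ℤ) else 0) • (Z r j * Z i s) + d • (Z r s * Z i j) := by
  rcases lt_trichotomy s j with hs | rfl | hs
  · exact ⟨0, zero_mem _, fun _ => rfl, by simp [Z_anti i s r j h hs, hs.ne]⟩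
  · refine ⟨0, zero_mem _, fun _ => rfl, by simp [Z_col' h]⟩
  · refine ⟨-(q ^ 2 - (q⁻¹) ^ 2), neg_mem q_sq_sub_mem_Laur, fun h' => absurd h' hs.not_ge, ?_⟩
    rw [Z_diag r j i s h hs]
    simp only [hs.ne', if_false, zpow_zero, one_smul]
    module

/-- Each swap moves the letter of row r strictly to the right, so every error term begins with a
letter Z_{rj}, j > k. Without swaps only the c_k letters of column k cost q^{-2} each. -/
theorem IsWord.mul_Z {r : Fin n} {ρ c : Fin n → ℕ} {x : Oq n} (hx : IsWord (r.val + 1) ρ c x)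
    (k : Fin n) : x * Z r k - q ^ (-2 * (c k : ℤ)) • (Z r k * x) ∈ letterSpan r k ρ c := by
  induction hx with
  | one => simp
  | @mul i s ρ c x hi hx ih =>
    have hri : r < i := Fin.lt_def.2 (by omega)
    have hV : ∀ v ∈ letterSpan r k ρ c,
        Z i s * v ∈ letterSpan r k (ρ + Pi.single i 1) (c + Pi.single s 1) := by
      intro v hv
      induction hv using Submodule.span_induction with
      | zero => simp
      | add x y _ _ hx hy => rw [mul_add]; exact Submodule.add_mem _ hx hy
      | smul a x _ hx => rw [mul_smul_comm]; exact Submodule.smul_mem _ _ hx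
      | mem v hv =>
        obtain ⟨j, hj, c', y, hc, hy, rfl⟩ := hv
        obtain ⟨d, hd, hd0, e⟩ := Z_mul_Z_row hri s j
        rw [← mul_assoc, e, add_mul, smul_mul_assoc, smul_mul_assoc, mul_assoc, mul_assoc]
        refine Submodule.add_mem _ ?_ ?_
        · refine Laur_smul_mem (zpow_mem_Laur _) (Submodule.subset_span
            ⟨j, hj, _, _, ?_, hy.mul s hi, rfl⟩)
          rw [add_right_comm, hc, add_right_comm]
        · rcases le_or_gt s j with h | h
          · rw [hd0 h, zero_smul]
            exact zero_mem _
          · refine Laur_smul_mem hd (Submodule.subset_span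
              ⟨s, hj.trans h, _, _, ?_, hy.mul j hi, rfl⟩)
            rw [hc, add_right_comm]
    obtain ⟨d, hd, hd0, e⟩ := Z_mul_Z_row hri s k
    have h₁ : Z i s * x * Z r k - q ^ (-2 * (((c + Pi.single s 1 : Fin n → ℕ) k : ℕ) : ℤ)) •
        (Z r k * (Z i s * x)) = Z i s * (x * Z r k - q ^ (-2 * (c k : ℤ)) • (Z r k * x)) +
          (q ^ (-2 * (c k : ℤ)) * d) • (Z r s * (Z i k * x)) := by
      have h₂ : q ^ (-2 * (((c + Pi.single s 1 : Fin n → ℕ) k : ℕ) : ℤ)) =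
          q ^ (-2 * (c k : ℤ)) * q ^ (if s = k then (-2 : ℤ) else 0) := by
        rw [← zpow_add₀ q_ne_zero]
        congr 1
        by_cases h : s = k
        · subst h; simp; ring
        · simp [h, Ne.symm h]
      rw [mul_sub, mul_smul_comm, ← mul_assoc (Z i s) (Z r k), e, h₂, add_mul]
      simp only [smul_mul_assoc, mul_assoc]
      module
    rw [h₁]
    refine Submodule.add_mem _ (hV _ ih) ?_
    rcases le_or_gt s k with h | h
    · rw [hd0 h, mul_zero, zero_smul]
      exact zero_mem _
    · exact Laur_smul_mem (mul_mem (zpow_mem_Laur _) hd) (Submodule.subset_span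
        ⟨s, h, _, _, by rw [add_right_comm], hx.mul k hi, rfl⟩)

/-- The span of the products `R(a') y`, with `a' < a`, of the content of `x R(a)`. -/
def lowerSpan (r : Fin n) (a ρ c : Fin n → ℕ) : Submodule Laur (Oq n) :=
  Submodule.span Laur {x | ∃ a' c' y, RowLT a' a ∧ ∑ l, a' l = ∑ l, a l ∧ a' + c' = a + c ∧
    IsWord (r.val + 1) ρ c' y ∧ x = rowMonomial r a' * y}

theorem rowMonomial_add_single (r k : Fin n) (a : Fin n → ℕ) :
    rowMonomial r (a + Pi.single k 1) = q ^ (sumLT a k - sumGT a k) • (Z r k * rowMonomial r a) := by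
  rw [Z_mul_rowMonomial, smul_smul, ← zpow_add₀ q_ne_zero]
  simp

/-- Adding a letter in column j ≥ k instead of k makes the exponent vector no larger
lexicographically, so the strict inequality in `lowerSpan` survives. -/
theorem Z_mul_mem_lowerSpan {r j k : Fin n} (hjk : k ≤ j) {a ρ c c' : Fin n → ℕ}
    (hc : c' + Pi.single j 1 = c + Pi.single k 1) {v : Oq n}
    (hv : v ∈ lowerSpan r a ρ c') : Z r j * v ∈ lowerSpan r (a + Pi.single k 1) ρ c := by
  induction hv using Submodule.span_induction with
  | zero => simp
  | add x y _ _ hx hy => rw [mul_add]; exact Submodule.add_mem _ hx hy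
  | smul a x _ hx => rw [mul_smul_comm]; exact Submodule.smul_mem _ _ hx
  | mem v hv =>
    obtain ⟨a', c'', y, hlt, hs, ha, hy, rfl⟩ := hv
    rw [← mul_assoc, Z_mul_rowMonomial, smul_mul_assoc]
    refine Laur_smul_mem (zpow_mem_Laur _) (Submodule.subset_span ⟨_, _, _, ?_, ?_, ?_, hy, rfl⟩)
    · have h := hlt.add_right (Pi.single j 1)
      rcases hjk.lt_or_eq with h' | rfl
      · exact h.trans (rowLT_add_single a h')
      · exact h
    · simp [Finset.sum_add_distrib, hs]
    · rw [add_right_comm, ha, add_assoc, hc, add_assoc, add_comm c]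

/-- Moving a word past a monomial in the entries of an earlier row. -/
theorem IsWord.mul_rowMonomial {r : Fin n} (a : Fin n → ℕ) {ρ c : Fin n → ℕ} {x : Oq n}
    (hx : IsWord (r.val + 1) ρ c x) :
    x * rowMonomial r a - q ^ (-2 * ∑ l, (a l : ℤ) * c l) • (rowMonomial r a * x) ∈
      lowerSpan r a ρ c := by
  induction a using exponent_induction generalizing c x with
  | h0 => simp [rowMonomial_zero]
  | h1 a k _ ih =>
    -- The error terms of `mul_Z` start with j > k, and a + e_j < a + e_k, so even their leading
    -- terms are lower.
    have hV : ∀ v ∈ letterSpan r k ρ c,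
        v * rowMonomial r a ∈ lowerSpan r (a + Pi.single k 1) ρ c := by
      intro v hv
      induction hv using Submodule.span_induction with
      | zero => simp
      | add x y _ _ hx hy => rw [add_mul]; exact Submodule.add_mem _ hx hy
      | smul a x _ hx => rw [smul_mul_assoc]; exact Submodule.smul_mem _ _ hx
      | mem v hv =>
        obtain ⟨j, hj, c', y, hc, hy, rfl⟩ := hv
        have h := Z_mul_mem_lowerSpan hj.le hc (ih hy)
        rw [mul_sub, mul_smul_comm, ← mul_assoc, ← mul_assoc, Z_mul_rowMonomial, smul_mul_assoc,
          smul_smul] at h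
        have h' : rowMonomial r (a + Pi.single j 1) * y ∈ lowerSpan r (a + Pi.single k 1) ρ c := by
          refine Submodule.subset_span ⟨_, _, _, rowLT_add_single a hj, ?_, ?_, hy, rfl⟩
          · simp [Finset.sum_add_distrib]
          · rw [add_assoc, add_comm _ c', hc, add_assoc, add_comm c]
        have h₂ := Submodule.add_mem _ h (Laur_smul_mem (mul_mem
          (zpow_mem_Laur (-2 * ∑ l, (a l : ℤ) * c' l)) (zpow_mem_Laur (sumGT a j - sumLT a j))) h')
        rwa [sub_add_cancel] at h₂
    have h₁ := hV _ (hx.mul_Z k)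
    have h₂ := Z_mul_mem_lowerSpan (le_refl k) rfl (ih hx)
    have h₃ := Submodule.add_mem _ h₁
      (Laur_smul_mem (zpow_mem_Laur (-2 * (c k : ℤ))) h₂)
    have h₄ := Laur_smul_mem (zpow_mem_Laur (sumLT a k - sumGT a k)) h₃
    convert h₄ using 1
    have h₅ : ∑ l, ((a + Pi.single k 1 : Fin n → ℕ) l : ℤ) * c l = ∑ l, (a l : ℤ) * c l + c k := by
      simp only [Pi.add_apply, Nat.cast_add, add_mul, Finset.sum_add_distrib]
      rw [sum_single_mul k fun l => (c l : ℤ)]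
    rw [rowMonomial_add_single, h₅, mul_add, zpow_add₀ q_ne_zero]
    simp only [mul_sub, sub_mul, mul_smul_comm, smul_mul_assoc, mul_assoc]
    module

end
end QuantumMatrix

/-! ### Bar is unitriangular on normalized monomials -/

namespace QuantumMatrix
noncomputable section

variable {n : ℕ}

/-- The span over `ℤ[q, q⁻¹]` of the `Z(B)` with given row and column sums. -/
def laurSpan (r : ℕ) (ρ c : Fin n → ℕ) : Submodule Laur (Oq n) :=
  Submodule.span Laur {x | ∃ B : Mat n, RowsGE r B ∧ rowSum B = ρ ∧ colSum B = c ∧ x = ZN B}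

/-- The span of the products `R(a) y` of given content. -/
def rowWordSpan (r : Fin n) (ρ c : Fin n → ℕ) : Submodule Laur (Oq n) :=
  Submodule.span Laur {x | ∃ a ρ' c' y, ρ' + Pi.single r (∑ l, a l) = ρ ∧ a + c' = c ∧
    IsWord (r.val + 1) ρ' c' y ∧ x = rowMonomial r a * y}

/-- Letters of row r are gathered on the left one at a time; only spanning matters here, so the
order information of `mul_rowMonomial` is dropped. -/
theorem IsWord.mem_rowWordSpan {r : Fin n} {ρ c : Fin n → ℕ} {x : Oq n}
    (hx : IsWord r.val ρ c x) : x ∈ rowWordSpan r ρ c := by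
  induction hx with
  | one => exact Submodule.subset_span ⟨0, 0, 0, 1, by simp, by simp, .one, by
      rw [rowMonomial_zero, mul_one]⟩
  | @mul i s ρ c x hi hx ih =>
    clear hx
    induction ih using Submodule.span_induction with
    | zero => simp
    | add x y _ _ hx hy => rw [mul_add]; exact Submodule.add_mem _ hx hy
    | smul a x _ hx => rw [mul_smul_comm]; exact Submodule.smul_mem _ _ hx
    | mem v hv =>
      obtain ⟨a, ρ', c', y, hρ, hc, hy, rfl⟩ := hv
      rcases hi.eq_or_lt with h | h
      · obtain rfl : r = i := Fin.ext h
        rw [← mul_assoc, Z_mul_rowMonomial, smul_mul_assoc]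
        refine Laur_smul_mem (zpow_mem_Laur _)
          (Submodule.subset_span ⟨_, _, _, _, ?_, ?_, hy, rfl⟩)
        · rw [← hρ, add_assoc, ← Pi.single_add]
          simp [Finset.sum_add_distrib]
        · rw [← hc, add_right_comm]
      · have hw : IsWord (r.val + 1) (0 + Pi.single i 1) (0 + Pi.single s 1) (Z i s * 1 : Oq n) :=
          IsWord.mul s h .one
        have h₁ := hw.mul_rowMonomial a
        rw [mul_one, zero_add, zero_add] at h₁
        have h₂ : ∀ v ∈ lowerSpan r a (Pi.single i 1) (Pi.single s 1),
            v * y ∈ rowWordSpan r (ρ + Pi.single i 1) (c + Pi.single s 1) := by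
          intro v hv
          induction hv using Submodule.span_induction with
          | zero => simp
          | add x y _ _ hx hy => rw [add_mul]; exact Submodule.add_mem _ hx hy
          | smul a x _ hx => rw [smul_mul_assoc]; exact Submodule.smul_mem _ _ hx
          | mem v hv =>
            obtain ⟨a', c'', z, -, hs, ha, hz, rfl⟩ := hv
            refine Submodule.subset_span ⟨a', _, _, _, ?_, ?_, hz.mul_word hy, mul_assoc _ _ _⟩
            · rw [hs, ← hρ]; abel
            · rw [← add_assoc, ha, ← hc]; abel
        have h₃ : rowMonomial r a * (Z i s * y) ∈
            rowWordSpan r (ρ + Pi.single i 1) (c + Pi.single s 1) := by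
          refine Submodule.subset_span ⟨a, _, _, _, ?_, ?_, hy.mul s h, rfl⟩
          · rw [← hρ]; abel
          · rw [← hc]; abel
        have h₄ := Submodule.add_mem _ (h₂ _ h₁) (Laur_smul_mem (zpow_mem_Laur (-2 * ∑ l, (a l : ℤ) *
          ((Pi.single s 1 : Fin n → ℕ) l : ℕ))) h₃)
        rwa [sub_mul, smul_mul_assoc, mul_assoc, mul_assoc, sub_add_cancel] at h₄

theorem rowMonomial_mul_mem_laurSpan {r : Fin n} (a : Fin n → ℕ) {ρ c : Fin n → ℕ} {y : Oq n}
    (hy : y ∈ laurSpan (r.val + 1) ρ c) :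
    rowMonomial r a * y ∈ laurSpan r.val (ρ + Pi.single r (∑ l, a l)) (a + c) := by
  induction hy using Submodule.span_induction with
  | zero => simp
  | add x y _ _ hx hy => rw [mul_add]; exact Submodule.add_mem _ hx hy
  | smul a x _ hx => rw [mul_smul_comm]; exact Submodule.smul_mem _ _ hx
  | mem v hv =>
    obtain ⟨B, hB, hρ, hc, rfl⟩ := hv
    rw [rowMonomial_mul_ZN hB]
    refine Laur_smul_mem (zpow_mem_Laur _)
      (Submodule.subset_span ⟨_, hB.updateRow a, ?_, ?_, rfl⟩)
    · funext i
      by_cases hi : i = r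
      · subst hi
        rw [rowSum_updateRow_self, Pi.add_apply, Pi.single_eq_same, ← hρ, rowSum]
        simp [hB i _ (Nat.lt_succ_self _)]
      · rw [rowSum_updateRow_ne hi, hρ]
        simp [hi]
    · funext l
      rw [colSum_updateRow hB, hc, Pi.add_apply]

/-- Straightening: words are combinations of normalized monomials of the same content. -/
theorem IsWord.mem_laurSpan {r : ℕ} (hr : r ≤ n) {ρ c : Fin n → ℕ} {x : Oq n}
    (hx : IsWord r ρ c x) : x ∈ laurSpan r ρ c := by
  induction hr using Nat.decreasingInduction generalizing ρ c x with
  | self =>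
    cases hx with
    | one =>
      refine Submodule.subset_span ⟨0, fun _ _ _ => rfl, ?_, ?_, ZN_zero.symm⟩ <;>
        funext <;> simp [rowSum, colSum]
    | @mul i _ _ _ _ hi _ => have := i.2; omega
  | of_succ k hk ih =>
    obtain ⟨r, rfl⟩ : ∃ r : Fin n, r.val = k := ⟨⟨k, hk⟩, rfl⟩
    refine Submodule.span_le.2 ?_ hx.mem_rowWordSpan
    rintro _ ⟨a, ρ', c', y, rfl, rfl, hy, rfl⟩
    exact rowMonomial_mul_mem_laurSpan a (ih hy)

/-- The span of the words of given content. -/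
def wordSpan (r : ℕ) (ρ c : Fin n → ℕ) : Submodule Laur (Oq n) :=
  Submodule.span Laur {x | IsWord r ρ c x}

theorem rowMonomial_mul_mem_wordSpan {r : Fin n} (a : Fin n → ℕ) {ρ c : Fin n → ℕ} {y : Oq n}
    (hy : y ∈ wordSpan (r.val + 1) ρ c) :
    rowMonomial r a * y ∈ wordSpan r.val (ρ + Pi.single r (∑ l, a l)) (a + c) := by
  induction a using exponent_induction with
  | h0 =>
    rw [rowMonomial_zero, one_mul, zero_add]
    simp only [Pi.zero_apply, Finset.sum_const_zero, Pi.single_zero, add_zero]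
    exact Submodule.span_mono (fun x hx => IsWord.succ hx) hy
  | h1 a k _ ih =>
    have h : ∀ v ∈ wordSpan r.val (ρ + Pi.single r (∑ l, a l)) (a + c), Z r k * v ∈
        wordSpan r.val (ρ + Pi.single r (∑ l, a l) + Pi.single r 1) (a + c + Pi.single k 1) := by
      intro v hv
      induction hv using Submodule.span_induction with
      | zero => simp
      | add x y _ _ hx hy => rw [mul_add]; exact Submodule.add_mem _ hx hy
      | smul a x _ hx => rw [mul_smul_comm]; exact Submodule.smul_mem _ _ hx
      | mem v hv => exact Submodule.subset_span (IsWord.mul k le_rfl hv)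
    have h₁ := h _ ih
    rw [add_assoc, ← Pi.single_add] at h₁
    rw [rowMonomial_add_single, smul_mul_assoc, mul_assoc, add_right_comm]
    simp only [Pi.add_apply, Finset.sum_add_distrib, Finset.sum_pi_single', Finset.mem_univ,
      if_true]
    exact Laur_smul_mem (zpow_mem_Laur _) h₁

theorem rowSum_updateRow {r : Fin n} {A : Mat n} (hA : RowsGE (r.val + 1) A) (a : Fin n → ℕ) :
    rowSum (A.updateRow r a) = rowSum A + Pi.single r (∑ l, a l) := by
  funext i
  by_cases hi : i = r
  · subst hi
    rw [rowSum_updateRow_self, Pi.add_apply, Pi.single_eq_same, rowSum]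
    simp [hA i _ (Nat.lt_succ_self _)]
  · rw [rowSum_updateRow_ne hi]
    simp [hi]

/-- Through this, statements proved letter by letter for words of a given content apply to
normalized monomials. -/
theorem ZN_mem_wordSpan {r : ℕ} (hr : r ≤ n) {A : Mat n} (hA : RowsGE r A) :
    ZN A ∈ wordSpan r (rowSum A) (colSum A) := by
  refine rowsGE_induction (P := fun r A => ZN A ∈ wordSpan r (rowSum A) (colSum A)) ?_ ?_ hr hA
  · rw [ZN_zero]
    have h : rowSum (0 : Mat n) = 0 := by funext; simp [rowSum]
    have h' : colSum (0 : Mat n) = 0 := by funext; simp [colSum]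
    rw [h, h']
    exact Submodule.subset_span .one
  · intro r A a hA ih
    rw [ZN_updateRow hA, rowSum_updateRow hA]
    have h' : colSum (A.updateRow r a) = a + colSum A := funext fun l => colSum_updateRow hA a l
    rw [h']
    exact Laur_smul_mem (zpow_mem_Laur _) (rowMonomial_mul_mem_wordSpan a ih)

/-- The span of the `Z(B)`, `B < A`, with the row and column sums of `A`. -/
def belowSpan (r : ℕ) (A : Mat n) : Submodule Laur (Oq n) :=
  Submodule.span Laur {x | ∃ B : Mat n, RowsGE r B ∧ LexLT B A ∧ rowSum B = rowSum A ∧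
    colSum B = colSum A ∧ x = ZN B}

theorem lexLT_updateRow_of_rowLT {r : Fin n} {A B : Mat n} (hA : RowsGE (r.val + 1) A)
    (hB : RowsGE (r.val + 1) B) {a b : Fin n → ℕ} (h : RowLT b a) :
    LexLT (B.updateRow r b) (A.updateRow r a) := by
  obtain ⟨j, hj, hj'⟩ := h
  refine ⟨r, j, by simpa using hj', ?_⟩
  rintro i' j' (h | ⟨rfl, h⟩)
  · rw [hA.updateRow a i' j' h, hB.updateRow b i' j' h]
  · simpa using hj j' h

theorem LexLT.updateRow {r : Fin n} {A B : Mat n} (hA : RowsGE (r.val + 1) A)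
    (hB : RowsGE (r.val + 1) B) (a : Fin n → ℕ) (h : LexLT B A) :
    LexLT (B.updateRow r a) (A.updateRow r a) := by
  obtain ⟨i, j, hij, h⟩ := h
  have hi : i ≠ r := fun e => by
    subst e
    rw [hA i j (Nat.lt_succ_self _)] at hij
    exact Nat.not_lt_zero _ hij
  refine ⟨i, j, by rwa [Matrix.updateRow_ne hi, Matrix.updateRow_ne hi], fun i' j' h' => ?_⟩
  by_cases hi' : i' = r
  · subst hi'; simp
  · rw [Matrix.updateRow_ne hi', Matrix.updateRow_ne hi', h i' j' h']

/-- The words in the error terms are straightened. Since the rows before r vanish, a smaller row r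
makes the whole matrix smaller, whatever the later rows are. -/
theorem wordSpan_mul_rowMonomial {r : Fin n} (a : Fin n → ℕ) {A : Mat n}
    (hA : RowsGE (r.val + 1) A) {x : Oq n}
    (hx : x ∈ wordSpan (r.val + 1) (rowSum A) (colSum A)) :
    x * rowMonomial r a - q ^ (-2 * ∑ l, (a l : ℤ) * colSum A l) • (rowMonomial r a * x) ∈
      belowSpan r.val (A.updateRow r a) := by
  induction hx using Submodule.span_induction with
  | zero => simp
  | add x y _ _ hx hy =>
    convert Submodule.add_mem _ hx hy using 1
    rw [add_mul, mul_add]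
    module
  | smul s x _ hx =>
    convert Submodule.smul_mem _ s hx using 1
    rw [smul_mul_assoc, mul_smul_comm, smul_sub, smul_comm s]
  | mem x hx =>
    refine Submodule.span_le.2 ?_ (hx.mul_rowMonomial a)
    rintro _ ⟨a', c', y, hlt, hs, hc, hy, rfl⟩
    have hcol : colSum (A.updateRow r a) = a + colSum A := funext fun l => colSum_updateRow hA a l
    have h := hy.mem_laurSpan r.2
    clear hy
    induction h using Submodule.span_induction with
    | zero => simp
    | add x y _ _ hx hy => rw [mul_add]; exact Submodule.add_mem _ hx hy
    | smul a x _ hx => rw [mul_smul_comm]; exact Submodule.smul_mem _ _ hx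
    | mem v hv =>
      obtain ⟨B, hB, hρ, hcB, rfl⟩ := hv
      rw [rowMonomial_mul_ZN hB]
      refine Laur_smul_mem (zpow_mem_Laur _) (Submodule.subset_span
        ⟨_, hB.updateRow a', lexLT_updateRow_of_rowLT hA hB hlt, ?_, ?_, rfl⟩)
      · rw [rowSum_updateRow hA, rowSum_updateRow hB, hρ, hs]
      · rw [hcol, ← hc, ← hcB]
        exact funext fun l => colSum_updateRow hB a' l

/-- The bar map is unitriangular on the normalized monomials. -/
theorem bar_ZN_sub_mem {r : ℕ} (hr : r ≤ n) {A : Mat n} (hA : RowsGE r A) :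
    bar (ZN A) - ZN A ∈ belowSpan r A := by
  refine rowsGE_induction (P := fun r A => bar (ZN A) - ZN A ∈ belowSpan r A) ?_ ?_ hr hA
  · rw [ZN_zero, bar_one, sub_self]; exact zero_mem _
  · intro r A a hA ih
    have hcol : ∀ {B : Mat n}, RowsGE (r.val + 1) B → colSum (B.updateRow r a) = a + colSum B :=
      fun hB => funext fun l => colSum_updateRow hB a l
    have hV : ∀ v ∈ belowSpan (r.val + 1) A,
        v * rowMonomial r a ∈ belowSpan r.val (A.updateRow r a) := by
      intro v hv
      induction hv using Submodule.span_induction with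
      | zero => simp
      | add x y _ _ hx hy => rw [add_mul]; exact Submodule.add_mem _ hx hy
      | smul a x _ hx => rw [smul_mul_assoc]; exact Submodule.smul_mem _ _ hx
      | mem v hv =>
        obtain ⟨B, hB, hlt, hρ, hc, rfl⟩ := hv
        have h₁ := ZN_mem_wordSpan r.2 hB
        rw [hρ, hc] at h₁
        have h₂ := wordSpan_mul_rowMonomial a hA h₁
        have h₃ : ZN (B.updateRow r a) ∈ belowSpan r.val (A.updateRow r a) := by
          refine Submodule.subset_span
            ⟨_, hB.updateRow a, hlt.updateRow hA hB a, ?_, ?_, rfl⟩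
          · rw [rowSum_updateRow hA, rowSum_updateRow hB, hρ]
          · rw [hcol hA, hcol hB, hc]
        rw [rowMonomial_mul_ZN hB, smul_smul, ← zpow_add₀ q_ne_zero] at h₂
        have h₄ := Submodule.add_mem _ h₂ (Laur_smul_mem (zpow_mem_Laur (-2 * ∑ l, (a l : ℤ) *
          colSum A l + ∑ l, (a l : ℤ) * colSum B l)) h₃)
        rwa [sub_add_cancel] at h₄
    have h₁ := wordSpan_mul_rowMonomial a hA (ZN_mem_wordSpan r.2 hA)
    have h₂ := Laur_smul_mem (zpow_mem_Laur (∑ l, (a l : ℤ) * colSum A l))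
      (Submodule.add_mem _ (hV _ ih) h₁)
    -- With s = ∑ a_l c_l, bar turns q^{-s} R(a) Z(A') into q^s bar(Z(A')) R(a). Bringing R(a) back
    -- to the front costs q^{-2s}, so the leading term is Z(A) with coefficient 1.
    convert h₂ using 1
    rw [ZN_updateRow hA, bar_smul, bar_mul, bar_rowMonomial, map_zpow₀, barK_q, inv_zpow', neg_neg,
      sub_mul, sub_add_sub_cancel, smul_sub, smul_smul, ← zpow_add₀ q_ne_zero]
    congr 3
    ring

end
end QuantumMatrix

/-! ### Laurent polynomials under q ↦ q^{-1} -/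

namespace QuantumMatrix
noncomputable section

open LaurentPolynomial in
theorem laurentHom_C_mul_T (a : ℤ) (e : ℤ) : laurentHom (C a * T e) = a * q ^ e := by
  rw [map_mul, laurentHom_T, eq_intCast (LaurentPolynomial.C : ℤ →+* LaurentPolynomial ℤ), map_intCast]

/-- A power of T clears the negative exponents, and X satisfies no polynomial equation in ℚ(X).
Elements of ℤ[q, q^{-1}] can thus be compared coefficient by coefficient. -/
theorem laurentHom_injective : Function.Injective laurentHom := by
  rw [injective_iff_map_eq_zero]
  intro g hg
  obtain ⟨m, p, hp⟩ := g.exists_T_pow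
  have h₁ : laurentHom (Polynomial.toLaurent p) = 0 := by rw [hp, map_mul, hg, zero_mul]
  have h₂ : Polynomial.eval₂ (Int.castRingHom (RatFunc ℚ)) RatFunc.X p = 0 := by
    have : laurentHom (Polynomial.toLaurent p) =
        LaurentPolynomial.eval₂ (Int.castRingHom K) (Units.mk0 q q_ne_zero)
          (Polynomial.toLaurent p) := rfl
    rw [this, LaurentPolynomial.eval₂_toLaurent] at h₁
    exact h₁
  have h₃ : p.map (Int.castRingHom ℚ) = 0 := by
    apply RatFunc.algebraMap_injective ℚ
    have e : Polynomial.eval₂RingHom (Int.castRingHom (RatFunc ℚ)) RatFunc.X =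
        (algebraMap (Polynomial ℚ) (RatFunc ℚ)).comp (Polynomial.mapRingHom (Int.castRingHom ℚ)) :=
      Polynomial.ringHom_ext (by simp) (by simp)
    have h := RingHom.congr_fun e p
    rw [Polynomial.coe_eval₂RingHom, h₂] at h
    rw [map_zero]
    exact h.symm
  have h₄ : p = 0 := by
    rwa [Polynomial.map_eq_zero_iff (Int.castRingHom ℚ).injective_int] at h₃
  rw [h₄, map_zero] at hp
  have h₅ := congrArg (· * LaurentPolynomial.T (-(m : ℤ))) hp
  simp only [zero_mul, mul_assoc, ← LaurentPolynomial.T_add, add_neg_cancel,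
    LaurentPolynomial.T_zero, mul_one] at h₅
  exact h₅.symm

theorem barK_laurentHom (g : LaurentPolynomial ℤ) :
    barK (laurentHom g) = laurentHom (LaurentPolynomial.invert g) := by
  induction g using LaurentPolynomial.induction_on' with
  | add p r hp hr => rw [map_add, map_add, hp, hr, map_add, map_add]
  | C_mul_T m a =>
    rw [laurentHom_C_mul_T, map_mul, map_intCast, map_zpow₀, barK_q, map_mul,
      LaurentPolynomial.invert_C, LaurentPolynomial.invert_T, laurentHom_C_mul_T, inv_zpow']

/-- Membership in `q ℤ[q]`. -/
def InqZq (c : K) : Prop := ∃ d ∈ Zq, c = q * d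

theorem InqZq.zero : InqZq 0 := ⟨0, zero_mem _, (mul_zero q).symm⟩

theorem InqZq.add {c d : K} (hc : InqZq c) (hd : InqZq d) : InqZq (c + d) := by
  obtain ⟨a, ha, rfl⟩ := hc
  obtain ⟨b, hb, rfl⟩ := hd
  exact ⟨a + b, add_mem ha hb, (mul_add _ _ _).symm⟩

theorem InqZq.neg {c : K} (hc : InqZq c) : InqZq (-c) := by
  obtain ⟨a, ha, rfl⟩ := hc
  exact ⟨-a, neg_mem ha, (mul_neg _ _).symm⟩

theorem InqZq.sum {ι : Type*} (s : Finset ι) {f : ι → K} (h : ∀ i ∈ s, InqZq (f i)) :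
    InqZq (∑ i ∈ s, f i) :=
  Finset.sum_induction f InqZq (fun _ _ => InqZq.add) InqZq.zero h

theorem InqZq.mem_Zq {c : K} (hc : InqZq c) : c ∈ Zq := by
  obtain ⟨a, ha, rfl⟩ := hc
  exact mul_mem q_mem_Zq ha

theorem Zq_le_Laur : Zq ≤ Laur := by
  refine Algebra.adjoin_le ?_
  rintro _ rfl
  have := zpow_mem_Laur 1
  rwa [zpow_one] at this

theorem InqZq.mem_Laur {c : K} (hc : InqZq c) : c ∈ Laur := Zq_le_Laur hc.mem_Zq

theorem barK_mem_Laur {c : K} (hc : c ∈ Laur) : barK c ∈ Laur := by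
  obtain ⟨g, rfl⟩ := hc
  exact ⟨_, (barK_laurentHom g).symm⟩

theorem InqZq.exists_laurent {c : K} (hc : InqZq c) :
    ∃ g, laurentHom g = c ∧ ∀ m ≤ 0, g.coeff m = 0 := by
  obtain ⟨d, hd, rfl⟩ := hc
  rw [Zq, Algebra.adjoin_singleton_eq_range_aeval] at hd
  obtain ⟨p, rfl⟩ := hd
  refine ⟨∑ i ∈ p.support, LaurentPolynomial.C (p.coeff i) * LaurentPolynomial.T (i + 1 : ℤ),
    ?_, ?_⟩
  · rw [map_sum]
    change _ = q * Polynomial.aeval q p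
    rw [Polynomial.aeval_eq_sum_range' (Nat.lt_succ_self _), Finset.mul_sum]
    rw [Finset.sum_subset (s₂ := Finset.range (p.natDegree.succ))]
    · refine Finset.sum_congr rfl fun i _ => ?_
      rw [laurentHom_C_mul_T, zpow_add_one₀ q_ne_zero, zpow_natCast, zsmul_eq_mul]
      ring
    · intro i hi
      rw [Finset.mem_range]
      exact Nat.lt_succ_of_le (Polynomial.le_natDegree_of_mem_supp i hi)
    · intro i _ hi
      rw [Polynomial.notMem_support_iff.1 hi]
      simp
  · intro m hm
    rw [AddMonoidAlgebra.coeff_sum, Finsupp.finsetSum_apply]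
    refine Finset.sum_eq_zero fun i _ => ?_
    rw [← LaurentPolynomial.single_eq_C_mul_T, AddMonoidAlgebra.coeff_single,
      Finsupp.single_apply, if_neg]
    omega

/-- Only positive exponents occur in c and only negative ones in its conjugate. -/
theorem inqZq_eq_zero_of_barK {c : K} (hc : InqZq c) (h : barK c = c) : c = 0 := by
  obtain ⟨g, rfl, hg⟩ := hc.exists_laurent
  rw [barK_laurentHom] at h
  have h' := laurentHom_injective h
  have : g = 0 := by
    ext m
    rcases le_or_gt m 0 with hm | hm
    · rw [hg m hm]; rfl
    · rw [← h', LaurentPolynomial.invert_apply, hg _ (by omega)]; rfl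
  rw [this, map_zero]

/-- An element of `ℤ[q, q⁻¹]` that changes sign under `q ↦ q⁻¹` is split by `q ℤ[q]`. -/
theorem exists_sub_barK {c : K} (hc : c ∈ Laur) (h : barK c = -c) :
    ∃ d, InqZq d ∧ c = d - barK d := by
  obtain ⟨g, rfl⟩ := hc
  change barK (laurentHom g) = -laurentHom g at h
  change ∃ d, InqZq d ∧ laurentHom g = d - barK d
  rw [barK_laurentHom, ← map_neg] at h
  have h' := laurentHom_injective h
  have hcoeff : ∀ m, g.coeff (-m) = -g.coeff m := fun m => by
    rw [← LaurentPolynomial.invert_apply, h']; rfl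
  -- The part with positive exponents; the constant coefficient vanishes because it equals its own
  -- negative.
  set p : LaurentPolynomial ℤ := ∑ m ∈ g.coeff.support.filter (0 < ·),
    LaurentPolynomial.C (g.coeff m) * LaurentPolynomial.T m with hp
  have hpc : ∀ m, p.coeff m = if 0 < m then g.coeff m else 0 := by
    intro m
    rw [hp, AddMonoidAlgebra.coeff_sum, Finsupp.finsetSum_apply]
    simp only [← LaurentPolynomial.single_eq_C_mul_T, AddMonoidAlgebra.coeff_single,
      Finsupp.single_apply]
    rw [Finset.sum_ite_eq']
    simp only [Finset.mem_filter, Finsupp.mem_support_iff]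
    by_cases h₁ : 0 < m <;> by_cases h₂ : g.coeff m = 0 <;> simp [h₁, h₂]
  refine ⟨laurentHom p, ?_, ?_⟩
  · rw [hp, map_sum]
    refine InqZq.sum _ fun m hm => ?_
    have hm := (Finset.mem_filter.1 hm).2
    refine ⟨(g.coeff m : K) * q ^ (m - 1), mul_mem (intCast_mem _ _) (zpow_mem_Zq (by omega)), ?_⟩
    rw [laurentHom_C_mul_T, zpow_sub_one₀ q_ne_zero]
    have := q_ne_zero
    field_simp
  · rw [barK_laurentHom, ← map_sub]
    congr 1
    ext m
    change g.coeff m = p.coeff m - (LaurentPolynomial.invert p).coeff m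
    rw [LaurentPolynomial.invert_apply, hpc, hpc]
    have h₁ := hcoeff m
    rcases lt_trichotomy m 0 with hm | rfl | hm
    · rw [if_neg (by omega), if_pos (by omega), h₁]; ring
    · simp at h₁ ⊢; omega
    · rw [if_pos hm, if_neg (by omega), sub_zero]

theorem barK_barK {c : K} (hc : c ∈ Laur) : barK (barK c) = c := by
  obtain ⟨g, rfl⟩ := hc
  change barK (barK (laurentHom g)) = laurentHom g
  rw [barK_laurentHom, barK_laurentHom, LaurentPolynomial.involutive_invert]

end
end QuantumMatrix

/-! ### Existence, uniqueness and recognition of the dual canonical basis -/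

namespace QuantumMatrix
noncomputable section

variable {n : ℕ}

/-- Matrices with the lexicographic order of the entries. -/
def matOrd (A : Mat n) : Lex (Fin n → Lex (Fin n → ℕ)) := toLex fun i => toLex (A i)

theorem matOrd_injective : Function.Injective (matOrd (n := n)) := fun _ _ h => h

theorem lexLT_iff {A B : Mat n} : LexLT B A ↔ matOrd B < matOrd A := by
  constructor
  · rintro ⟨i, j, hij, h⟩
    refine ⟨i, fun i' hi' => ?_, j, fun j' hj' => h i j' (Or.inr ⟨rfl, hj'⟩), hij⟩
    exact funext fun j' => h i' j' (Or.inl hi')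
  · rintro ⟨i, hi, j, hj, hij⟩
    refine ⟨i, j, hij, ?_⟩
    rintro i' j' (h | ⟨rfl, h⟩)
    · exact congrFun (hi i' h) j'
    · exact hj j' h

theorem lexLT_irrefl (A : Mat n) : ¬ LexLT A A := fun h => lt_irrefl _ (lexLT_iff.1 h)

theorem LexLT.trans {A B C : Mat n} (h₁ : LexLT A B) (h₂ : LexLT B C) : LexLT A C :=
  lexLT_iff.2 ((lexLT_iff.1 h₁).trans (lexLT_iff.1 h₂))

theorem wellFounded_lexLT : WellFounded (LexLT (n := n)) := by
  have : LexLT (n := n) = InvImage (· < ·) matOrd := by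
    funext A B
    exact propext lexLT_iff
  rw [this]
  exact InvImage.wf _ wellFounded_lt

theorem exists_lexLT_max {s : Finset (Mat n)} (hs : s.Nonempty) :
    ∃ A ∈ s, ∀ B ∈ s, B = A ∨ LexLT B A := by
  obtain ⟨A, hA, h⟩ := Finset.exists_max_image s matOrd hs
  refine ⟨A, hA, fun B hB => ?_⟩
  rcases (h B hB).eq_or_lt with h' | h'
  · exact Or.inl (matOrd_injective h')
  · exact Or.inr (lexLT_iff.2 h')

theorem D_ne_zero (A : Mat n) : D A ≠ 0 := zpow_ne_zero _ q_ne_zero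

theorem linearIndependent_ZN : LinearIndependent K (ZN (n := n)) := by
  obtain ⟨Ψ, hΨ⟩ := exists_coeff_monomial n
  have h₁ : LinearIndependent K (monomial (n := n)) := by
    apply LinearIndependent.of_comp Ψ
    have : (Ψ ∘ monomial) = fun A : Mat n => Finsupp.single A (1 : K) := funext hΨ
    rw [this]
    exact Finsupp.linearIndependent_single_one K (Mat n)
  exact h₁.units_smul fun A => Units.mk0 (D A) (D_ne_zero A)

/-- The combination of the normalized monomials with given coefficients. -/
def ofCoeffs : (Mat n →₀ K) →ₗ[K] Oq n := Finsupp.linearCombination K ZN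

theorem ofCoeffs_injective : Function.Injective (ofCoeffs (n := n)) := linearIndependent_ZN

theorem ofCoeffs_single (A : Mat n) (c : K) : ofCoeffs (Finsupp.single A c) = c • ZN A :=
  Finsupp.linearCombination_single K c A

theorem ofCoeffs_apply (f : Mat n →₀ K) : ofCoeffs f = f.sum fun B c => c • ZN B := rfl

theorem exists_ofCoeffs {S : Subalgebra ℤ K} {T : Mat n → Prop} {x : Oq n}
    (hx : x ∈ Submodule.span S {x | ∃ B, T B ∧ x = ZN B}) :
    ∃ f : Mat n →₀ K, (∀ B, f B ∈ S) ∧ (∀ B ∈ f.support, T B) ∧ x = ofCoeffs f := by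
  induction hx using Submodule.span_induction with
  | zero => exact ⟨0, fun _ => zero_mem S, by simp, by simp⟩
  | add x y _ _ hx hy =>
    obtain ⟨f, hf, hfT, rfl⟩ := hx
    obtain ⟨g, hg, hgT, rfl⟩ := hy
    refine ⟨f + g, fun B => add_mem (hf B) (hg B), fun B hB => ?_, (map_add _ _ _).symm⟩
    rcases Finset.mem_union.1 (Finsupp.support_add hB) with h | h
    · exact hfT B h
    · exact hgT B h
  | smul s x _ hx =>
    obtain ⟨f, hf, hfT, rfl⟩ := hx
    exact ⟨(s : K) • f, fun B => mul_mem s.2 (hf B), fun B hB => hfT B (Finsupp.support_smul hB),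
      (map_smul ofCoeffs (s : K) f).symm⟩
  | mem x hx =>
    obtain ⟨B, hB, rfl⟩ := hx
    refine ⟨Finsupp.single B 1, fun C => ?_, fun C hC => ?_, by rw [ofCoeffs_single, one_smul]⟩
    · rw [Finsupp.single_apply]
      split_ifs
      · exact one_mem S
      · exact zero_mem S
    · rw [Finsupp.mem_support_iff, Finsupp.single_apply_ne_zero] at hC
      exact hC.1 ▸ hB

theorem exists_bar_ZN (A : Mat n) : ∃ f : Mat n →₀ K, (∀ B, f B ∈ Laur) ∧
    (∀ B ∈ f.support, LexLT B A ∧ rowSum B = rowSum A ∧ colSum B = colSum A) ∧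
    bar (ZN A) = ZN A + ofCoeffs f := by
  have h := bar_ZN_sub_mem (Nat.zero_le n) (rowsGE_zero A)
  have h' : bar (ZN A) - ZN A ∈ Submodule.span Laur {x | ∃ B : Mat n,
      (LexLT B A ∧ rowSum B = rowSum A ∧ colSum B = colSum A) ∧ x = ZN B} := by
    refine Submodule.span_mono ?_ h
    rintro _ ⟨B, -, h₁, h₂, h₃, rfl⟩
    exact ⟨B, ⟨h₁, h₂, h₃⟩, rfl⟩
  obtain ⟨f, hf, hfT, e⟩ := exists_ofCoeffs h'
  exact ⟨f, hf, hfT, by rw [← e, add_sub_cancel]⟩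

/-- The coefficients of `bar Z(A) - Z(A)`. -/
def barCoeffs (A : Mat n) : Mat n →₀ K := (exists_bar_ZN A).choose

theorem barCoeffs_mem (A B : Mat n) : barCoeffs A B ∈ Laur := (exists_bar_ZN A).choose_spec.1 B

theorem barCoeffs_support {A B : Mat n} (h : B ∈ (barCoeffs A).support) :
    LexLT B A ∧ rowSum B = rowSum A ∧ colSum B = colSum A :=
  (exists_bar_ZN A).choose_spec.2.1 B h

theorem bar_ZN (A : Mat n) : bar (ZN A) = ZN A + ofCoeffs (barCoeffs A) :=
  (exists_bar_ZN A).choose_spec.2.2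

theorem barCoeffs_eq_zero {A B : Mat n} (h : ¬ LexLT B A) : barCoeffs A B = 0 := by
  by_contra h'
  exact h (barCoeffs_support (Finsupp.mem_support_iff.2 h')).1

theorem bar_ofCoeffs (f : Mat n →₀ K) : bar (ofCoeffs f) =
    ofCoeffs (f.sum fun B c => barK c • (Finsupp.single B 1 + barCoeffs B)) := by
  rw [ofCoeffs_apply, Finsupp.sum, bar_sum, Finsupp.sum, map_sum]
  refine Finset.sum_congr rfl fun B _ => ?_
  rw [bar_smul, bar_ZN, map_smul, map_add, ofCoeffs_single, one_smul]

/-- The leading coefficient of the image under the bar map. -/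
theorem bar_leading_coeff {f g : Mat n →₀ K} (h : bar (ofCoeffs f) = ofCoeffs g) {A : Mat n}
    (hA : ∀ B ∈ f.support, B = A ∨ LexLT B A) : g A = barK (f A) := by
  rw [bar_ofCoeffs] at h
  rw [← ofCoeffs_injective h, Finsupp.sum, Finsupp.finsetSum_apply]
  have h₁ : ∀ B ∈ f.support, (barK (f B) • (Finsupp.single B 1 + barCoeffs B) : Mat n →₀ K) A =
      if B = A then barK (f A) else 0 := by
    intro B hB
    rw [Finsupp.smul_apply, Finsupp.add_apply, Finsupp.single_apply]
    rcases hA B hB with rfl | h'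
    · rw [if_pos rfl, if_pos rfl, barCoeffs_eq_zero (lexLT_irrefl B)]
      simp
    · have hne : B ≠ A := by rintro rfl; exact lexLT_irrefl B h'
      rw [if_neg hne, if_neg hne, barCoeffs_eq_zero fun h'' => lexLT_irrefl _ (h'.trans h'')]
      simp
  rw [Finset.sum_congr rfl h₁, Finset.sum_ite_eq']
  split_ifs with h₂
  · rfl
  · rw [Finsupp.notMem_support_iff.1 h₂, map_zero]

/-- Bar-invariant elements are determined modulo `q L^*`. -/
theorem eq_zero_of_bar_eq {f : Mat n →₀ K} (hf : ∀ B, InqZq (f B))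
    (h : bar (ofCoeffs f) = ofCoeffs f) : f = 0 := by
  by_contra hne
  -- At a maximal matrix of the support bar acts by `barK` alone, so that coefficient is a bar-fixed
  -- element of qℤ[q].
  obtain ⟨A, hA, hmax⟩ := exists_lexLT_max (Finsupp.support_nonempty_iff.2 hne)
  exact Finsupp.mem_support_iff.1 hA
    (inqZq_eq_zero_of_barK (hf A) (bar_leading_coeff h hmax).symm)

/-- On the span of words bar is an involution: it fixes the letters and reverses products twice, and
`barK` is an involution on Laurent coefficients. -/
theorem bar_bar_ZN (A : Mat n) : bar (bar (ZN A)) = ZN A := by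
  have h := ZN_mem_wordSpan (Nat.zero_le n) (rowsGE_zero A)
  generalize ZN A = x at h ⊢
  induction h using Submodule.span_induction with
  | zero => rw [bar_zero, bar_zero]
  | add x y _ _ hx hy => rw [bar_add, bar_add, hx, hy]
  | smul s x _ hx =>
    have : s • x = (s : K) • x := rfl
    rw [this, bar_smul, bar_smul, hx, barK_barK s.2]
  | mem x hx =>
    replace hx : IsWord 0 (rowSum A) (colSum A) x := hx
    generalize rowSum A = ρ, colSum A = c at hx
    induction hx with
    | one => rw [bar_one, bar_one]
    | mul j _ _ ih => rw [bar_mul, bar_mul, bar_Z, bar_Z, ih]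

theorem bar_sub (x y : Oq n) : bar (x - y) = bar x - bar y := by simp [bar]

/-- Well-founded induction on a strict upper bound A of the support. The coefficient at the largest
matrix A' is antisymmetric, hence d - \bar d with d in qℤ[q]. Subtracting d Z(A') - bar(d Z(A'))
cancels it and leaves an antisymmetric element supported below A'. -/
theorem exists_split {A : Mat n} {ρ c : Fin n → ℕ} {f : Mat n →₀ K} (hf : ∀ B, f B ∈ Laur)
    (hs : ∀ B ∈ f.support, LexLT B A ∧ rowSum B = ρ ∧ colSum B = c)
    (h : bar (ofCoeffs f) = -ofCoeffs f) :
    ∃ g : Mat n →₀ K, (∀ B, InqZq (g B)) ∧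
      (∀ B ∈ g.support, LexLT B A ∧ rowSum B = ρ ∧ colSum B = c) ∧
      ofCoeffs f = ofCoeffs g - bar (ofCoeffs g) := by
  induction A using wellFounded_lexLT.induction generalizing f with
  | _ A ih =>
  by_cases hne : f = 0
  · exact ⟨0, fun _ => InqZq.zero, by simp, by rw [hne]; simp [bar_zero]⟩
  obtain ⟨A', hA', hmax⟩ := exists_lexLT_max (Finsupp.support_nonempty_iff.2 hne)
  obtain ⟨hlt, hρ, hc⟩ := hs A' hA'
  have hlead : barK (f A') = -f A' := by
    rw [← map_neg] at h
    exact (bar_leading_coeff h hmax).symm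
  obtain ⟨d, hd, hfd⟩ := exists_sub_barK (hf A') hlead
  set f' : Mat n →₀ K :=
    f - Finsupp.single A' d + barK d • (Finsupp.single A' 1 + barCoeffs A') with hf'
  have e : ofCoeffs f' = ofCoeffs f - d • ZN A' + bar (d • ZN A') := by
    rw [hf', map_add, map_sub, ofCoeffs_single, map_smul, map_add, ofCoeffs_single, one_smul,
      bar_smul, bar_ZN]
  have hbar : bar (ofCoeffs f') = -ofCoeffs f' := by
    rw [e, bar_add, bar_sub, h, bar_smul, bar_smul, bar_bar_ZN, barK_barK hd.mem_Laur]
    abel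
  have happ : ∀ B, f' B = f B - (if A' = B then d else 0) +
      barK d * ((if A' = B then 1 else 0) + barCoeffs A' B) := fun B => by
    rw [hf']
    split_ifs with hB <;> simp [hB]
    ring
  have hcoeff : ∀ B, f' B ∈ Laur := fun B => by
    rw [happ]
    refine add_mem (sub_mem (hf B) ?_) (mul_mem (barK_mem_Laur hd.mem_Laur)
      (add_mem ?_ (barCoeffs_mem A' B))) <;> split_ifs
    · exact hd.mem_Laur
    · exact zero_mem _
    · exact one_mem _
    · exact zero_mem _
  have hsupp : ∀ B ∈ f'.support, LexLT B A' ∧ rowSum B = ρ ∧ colSum B = c := by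
    intro B hB
    rw [Finsupp.mem_support_iff, happ] at hB
    by_cases hBA : A' = B
    · subst hBA
      rw [if_pos rfl, if_pos rfl, barCoeffs_eq_zero (lexLT_irrefl A')] at hB
      exact absurd (by rw [hfd]; ring) hB
    · by_cases hfB : f B = 0
      · have : B ∈ (barCoeffs A').support := by
          rw [Finsupp.mem_support_iff]
          intro h0
          apply hB
          simp [hBA, hfB, h0]
        obtain ⟨h₁, h₂, h₃⟩ := barCoeffs_support this
        exact ⟨h₁, h₂.trans hρ, h₃.trans hc⟩
      · have hB' := Finsupp.mem_support_iff.2 hfB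
        exact ⟨(hmax B hB').resolve_left (Ne.symm hBA), (hs B hB').2⟩
  obtain ⟨g, hg, hgs, hge⟩ := ih A' hlt hcoeff hsupp hbar
  refine ⟨g + Finsupp.single A' d, fun B => ?_, fun B hB => ?_, ?_⟩
  · rw [Finsupp.add_apply, Finsupp.single_apply]
    refine (hg B).add ?_
    split_ifs
    · exact hd
    · exact InqZq.zero
  · rcases Finset.mem_union.1 (Finsupp.support_add hB) with h' | h'
    · exact ⟨(hgs B h').1.trans hlt, (hgs B h').2⟩
    · rw [Finsupp.mem_support_iff, Finsupp.single_apply_ne_zero] at h'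
      rw [h'.1]
      exact ⟨hlt, hρ, hc⟩
  · rw [map_add, ofCoeffs_single, bar_add]
    rw [e] at hge
    rw [sub_add, sub_eq_iff_eq_add] at hge
    rw [hge]
    abel

/-- The element x = bar Z(A) - Z(A) changes sign under bar; writing x = y - bar y makes Z(A) + y
invariant. -/
theorem exists_dual_canonical (A : Mat n) : ∃ h : Mat n →₀ K,
    (∀ B ∈ h.support, LexLT B A ∧ rowSum B = rowSum A ∧ colSum B = colSum A) ∧
    (∀ B, InqZq (h B)) ∧ bar (ZN A + ofCoeffs h) = ZN A + ofCoeffs h := by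
  have e : ofCoeffs (barCoeffs A) = bar (ZN A) - ZN A := by rw [bar_ZN, add_sub_cancel_left]
  obtain ⟨g, hg, hgs, hge⟩ := exists_split (f := barCoeffs A) (fun B => barCoeffs_mem A B)
    (fun B => barCoeffs_support) (by rw [e, bar_sub, bar_bar_ZN, neg_sub])
  refine ⟨g, hgs, hg, ?_⟩
  rw [bar_add, bar_ZN, hge]
  abel

theorem linearIndependent_of_expansion {b : Mat n → Oq n} {h : Mat n → Mat n →₀ K}
    (hs : ∀ A, ∀ B ∈ (h A).support, LexLT B A) (hb : ∀ A, b A = ZN A + ofCoeffs (h A)) :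
    LinearIndependent Zq b := by
  have h₁ : LinearIndependent K b := by
    rw [linearIndependent_iff]
    intro l hl
    by_contra hne
    obtain ⟨A, hA, hmax⟩ := exists_lexLT_max (Finsupp.support_nonempty_iff.2 hne)
    have h₂ : ofCoeffs (l.sum fun B c => c • (Finsupp.single B 1 + h B)) = 0 := by
      rw [← hl, Finsupp.linearCombination_apply, Finsupp.sum, Finsupp.sum, map_sum]
      refine Finset.sum_congr rfl fun B _ => ?_
      rw [map_smul, map_add, ofCoeffs_single, one_smul, hb]
    have h₃ := (map_eq_zero_iff _ ofCoeffs_injective).1 h₂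
    have h₄ := DFunLike.congr_fun h₃ A
    rw [Finsupp.sum, Finsupp.finsetSum_apply, Finset.sum_eq_single_of_mem A hA] at h₄
    · have h₅ : h A A = 0 := by
        by_contra h'
        exact lexLT_irrefl A (hs A A (Finsupp.mem_support_iff.2 h'))
      apply Finsupp.mem_support_iff.1 hA
      simpa [h₅] using h₄
    · intro B hB hBA
      have h₅ : h B A = 0 := by
        by_contra h'
        exact lexLT_irrefl A ((hs B A (Finsupp.mem_support_iff.2 h')).trans
          ((hmax B hB).resolve_left hBA))
      simp [h₅, hBA]
  refine h₁.restrict_scalars ?_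
  intro c d hcd
  simpa [Subalgebra.smul_def] using hcd

theorem span_eq_of_expansion {b : Mat n → Oq n} {h : Mat n → Mat n →₀ K}
    (hs : ∀ A, ∀ B ∈ (h A).support, LexLT B A) (hq : ∀ A B, h A B ∈ Zq)
    (hb : ∀ A, b A = ZN A + ofCoeffs (h A)) :
    Submodule.span Zq (Set.range b) = Lstar n := by
  apply le_antisymm
  · rw [Submodule.span_le]
    rintro _ ⟨A, rfl⟩
    rw [hb]
    refine Submodule.add_mem _ (Submodule.subset_span ⟨A, rfl⟩)
      (Submodule.sum_mem _ fun B _ => Zq_smul_mem (hq A B) (Submodule.subset_span ⟨B, rfl⟩))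
  · rw [Lstar, Submodule.span_le]
    rintro _ ⟨A, rfl⟩
    induction A using wellFounded_lexLT.induction with
    | _ A ih =>
    have : ZN A = b A - ofCoeffs (h A) := by rw [hb, add_sub_cancel_right]
    rw [this]
    exact Submodule.sub_mem _ (Submodule.subset_span ⟨A, rfl⟩)
      (Submodule.sum_mem _ fun B hB => Zq_smul_mem (hq A B) (ih B (hs A B hB)))

/-- Existence of the dual canonical basis. -/
theorem exists_isDualCanonicalBasis (n : ℕ) : ∃ b : Mat n → Oq n, IsDualCanonicalBasis b := by
  choose h hs hq hbar using exists_dual_canonical (n := n)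
  refine ⟨fun A => ZN A + ofCoeffs (h A),
    linearIndependent_of_expansion (fun A B hB => (hs A B hB).1) fun _ => rfl,
    span_eq_of_expansion (fun A B hB => (hs A B hB).1) (fun A B => (hq A B).mem_Zq) fun _ => rfl,
    hbar, fun A => ⟨h A, fun B hB => ?_, rfl⟩⟩
  obtain ⟨h₁, h₂, h₃⟩ := hs A B hB
  exact ⟨h₁, h₂, h₃, hq A B⟩

/-- Bar-invariant elements congruent to `Z(A)` modulo `q L^*` belong to the basis. -/
theorem IsDualCanonicalBasis.eq_of_bar_eq {b : Mat n → Oq n} (hb : IsDualCanonicalBasis b)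
    {A : Mat n} {f : Mat n →₀ K} (hf : ∀ B, InqZq (f B))
    (h : bar (ZN A + ofCoeffs f) = ZN A + ofCoeffs f) : ZN A + ofCoeffs f = b A := by
  obtain ⟨g, hg, e⟩ := hb.expansion A
  change b A = ZN A + ofCoeffs g at e
  have hgq : ∀ B, InqZq (g B) := fun B => by
    by_cases hB : B ∈ g.support
    · exact (hg B hB).2.2.2
    · rw [Finsupp.notMem_support_iff.1 hB]
      exact InqZq.zero
  have hbar := hb.bar_eq A
  rw [e] at hbar ⊢
  have h₁ : f - g = 0 := by
    refine eq_zero_of_bar_eq (fun B => ?_) ?_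
    · rw [Finsupp.sub_apply, sub_eq_add_neg]
      exact (hf B).add (hgq B).neg
    · have e₁ : ofCoeffs (f - g) = (ZN A + ofCoeffs f) - (ZN A + ofCoeffs g) := by
        rw [map_sub]; abel
      rw [e₁, bar_sub, h, hbar]
  rw [sub_eq_zero.1 h₁]

/-- Only congruence modulo qL^* is asked for, so the lexicographic condition need not be checked for
products or transposes. -/
theorem IsDualCanonicalBasis.eq_of_sub_mem {b : Mat n → Oq n} (hb : IsDualCanonicalBasis b)
    {A : Mat n} {x : Oq n} (hx : q ^ (-1 : ℤ) • (x - ZN A) ∈ Lstar n) (h : bar x = x) :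
    x = b A := by
  have h' : q ^ (-1 : ℤ) • (x - ZN A) ∈ Submodule.span Zq {x | ∃ B : Mat n, True ∧ x = ZN B} := by
    refine Submodule.span_mono ?_ hx
    rintro _ ⟨B, rfl⟩
    exact ⟨B, trivial, rfl⟩
  obtain ⟨f, hf, -, e⟩ := exists_ofCoeffs h'
  have e₁ : x = ZN A + ofCoeffs (q • f) := by
    rw [map_smul, ← e, smul_smul, zpow_neg_one, mul_inv_cancel₀ q_ne_zero, one_smul,
      add_sub_cancel]
  rw [e₁] at h ⊢
  exact hb.eq_of_bar_eq (fun B => ⟨f B, hf B, rfl⟩) h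

theorem IsDualCanonicalBasis.unique {b b' : Mat n → Oq n} (hb : IsDualCanonicalBasis b)
    (hb' : IsDualCanonicalBasis b') : b = b' := by
  funext A
  obtain ⟨g, hg, e⟩ := hb.expansion A
  change b A = ZN A + ofCoeffs g at e
  have h := hb.bar_eq A
  rw [e] at h ⊢
  refine hb'.eq_of_bar_eq (fun B => ?_) h
  by_cases hB : B ∈ g.support
  · exact (hg B hB).2.2.2
  · rw [Finsupp.notMem_support_iff.1 hB]
    exact InqZq.zero

end
end QuantumMatrix

/-! ### The permutation formula for minors -/

namespace QuantumMatrix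
noncomputable section

variable {n m : ℕ}

/-- The permutation of `{0, …, m}` with `0 ↦ p` that is order isomorphic to `e` on the rest. -/
def consPerm (p : Fin (m + 1)) (e : Equiv.Perm (Fin m)) : Equiv.Perm (Fin (m + 1)) :=
  ((finSuccEquiv' 0).trans (Equiv.optionCongr e)).trans (finSuccEquiv' p).symm

theorem consPerm_zero (p : Fin (m + 1)) (e : Equiv.Perm (Fin m)) : consPerm p e 0 = p := by
  simp [consPerm]

theorem consPerm_succ (p : Fin (m + 1)) (e : Equiv.Perm (Fin m)) (k : Fin m) :
    consPerm p e k.succ = p.succAbove (e k) := by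
  have h : finSuccEquiv' (0 : Fin (m + 1)) k.succ = some k := by
    rw [← Fin.succAbove_zero_apply, finSuccEquiv'_succAbove]
  simp [consPerm, h]

theorem consPerm_bijective :
    Function.Bijective fun x : Fin (m + 1) × Equiv.Perm (Fin m) => consPerm x.1 x.2 := by
  rw [Fintype.bijective_iff_injective_and_card]
  constructor
  · rintro ⟨p, e⟩ ⟨p', e'⟩ h
    have hp : p = p' := by
      have := Equiv.congr_fun h 0
      rwa [consPerm_zero, consPerm_zero] at this
    subst hp
    refine Prod.ext rfl (Equiv.ext fun k => ?_)
    have := Equiv.congr_fun h k.succ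
    rw [consPerm_succ, consPerm_succ] at this
    exact Fin.succAbove_right_injective this
  · rw [Fintype.card_prod, Fintype.card_perm, Fintype.card_perm, Fintype.card_fin,
      Fintype.card_fin, Nat.factorial_succ]

/-- The first value p forms an inversion with each of the p smaller values; the other inversions are
those of e, since `succAbove` is increasing. -/
theorem permLength_consPerm (p : Fin (m + 1)) (e : Equiv.Perm (Fin m)) :
    permLength (consPerm p e) = p.val + permLength e := by
  have h₁ : ∑ k : Fin m, (if p.succAbove (e k) < p then 1 else 0) = p.val := by
    rw [Equiv.sum_comp e fun k => if p.succAbove k < p then 1 else 0, ← Finset.card_filter]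
    have : (Finset.univ.filter fun k : Fin m => p.succAbove k < p) =
        Finset.univ.filter fun k : Fin m => k.val < p.val := by
      refine Finset.filter_congr fun k _ => ?_
      rw [Fin.succAbove_lt_iff_castSucc_lt, Fin.lt_def, Fin.val_castSucc]
    rw [this, Fin.card_filter_val_lt, min_eq_right (Nat.lt_succ_iff.1 p.2)]
  simp only [permLength, Finset.card_filter, Fintype.sum_prod_type, Fin.sum_univ_succ,
    consPerm_zero, consPerm_succ, false_and, if_false, Fin.succ_pos, true_and,
    Fin.not_lt_zero, zero_add, Fin.succ_lt_succ_iff, Fin.succAbove_lt_succAbove_iff]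
  rw [h₁]

theorem orderEmbOfFin_erase {J : Finset (Fin n)} (hJ : J.card = m + 1) (p : Fin (m + 1))
    (h : (J.erase (J.orderEmbOfFin hJ p)).card = m) (k : Fin m) :
    (J.erase (J.orderEmbOfFin hJ p)).orderEmbOfFin h k = J.orderEmbOfFin hJ (p.succAbove k) := by
  have := Finset.orderEmbOfFin_unique h (f := fun k => J.orderEmbOfFin hJ (p.succAbove k))
    (fun k => Finset.mem_erase.2 ⟨fun e => Fin.succAbove_ne p k
      ((J.orderEmbOfFin hJ).injective e), Finset.orderEmbOfFin_mem _ _ _⟩)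
    ((J.orderEmbOfFin hJ).strictMono.comp (Fin.strictMono_succAbove p))
  exact (congrFun this k).symm

theorem card_filter_lt_orderEmbOfFin {J : Finset (Fin n)} (hJ : J.card = m) (p : Fin m) :
    (J.filter (· < J.orderEmbOfFin hJ p)).card = p.val := by
  have h : ∀ y, J.filter (· < y) = (Finset.univ.filter fun k => J.orderEmbOfFin hJ k < y).map
      (J.orderEmbOfFin hJ).toEmbedding := fun y => by
    conv_lhs => rw [← Finset.map_orderEmbOfFin_univ J hJ, Finset.filter_map]
    rfl
  have h' : (Finset.univ.filter fun k => J.orderEmbOfFin hJ k < J.orderEmbOfFin hJ p) =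
      Finset.Iio p := by
    ext k
    simp
  rw [h, Finset.card_map, h', Fin.card_Iio]

/-- The explicit formula for the quantum minors. -/
theorem quantumMinor_eq_minor {I J : Finset (Fin n)} (hI : I.card = m) (hJ : J.card = m) :
    quantumMinor I J hI hJ = minor I J := by
  induction m generalizing I J with
  | zero =>
    obtain rfl := Finset.card_eq_zero.1 hI
    obtain rfl := Finset.card_eq_zero.1 hJ
    simp [quantumMinor, minor_empty, permLength]
  | succ m ih =>
    set a := I.orderEmbOfFin hI 0 with ha
    have haI : a ∈ I := Finset.orderEmbOfFin_mem I hI 0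
    have hcI : (I.erase a).card = m := by rw [Finset.card_erase_of_mem haI, hI, Nat.add_sub_cancel]
    have hlt : ∀ b ∈ I.erase a, a < b := by
      intro b hb
      rw [← Finset.mem_coe, ← Finset.range_orderEmbOfFin _ hcI] at hb
      obtain ⟨k, rfl⟩ := hb
      rw [orderEmbOfFin_erase hI 0 hcI, ha]
      exact (I.orderEmbOfFin hI).strictMono (by rw [Fin.succAbove_zero_apply]; exact Fin.succ_pos k)
    have hcJ : ∀ p, (J.erase (J.orderEmbOfFin hJ p)).card = m := fun p => by
      rw [Finset.card_erase_of_mem (Finset.orderEmbOfFin_mem J hJ p), hJ, Nat.add_sub_cancel]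
    have hR : minor I J = ∑ p : Fin (m + 1), (-q ^ 2) ^ p.val •
        (Z a (J.orderEmbOfFin hJ p) * minor (I.erase a) (J.erase (J.orderEmbOfFin hJ p))) := by
      conv_lhs => rw [← Finset.insert_erase haI, minor_insert_min hlt, wedgeL]
      have h : ∀ f : Fin n → Oq n, ∑ j ∈ J, f j = ∑ p, f (J.orderEmbOfFin hJ p) := fun f => by
        conv_lhs => rw [← Finset.map_orderEmbOfFin_univ J hJ, Finset.sum_map]
        rfl
      rw [h]
      exact Finset.sum_congr rfl fun p _ => by rw [card_filter_lt_orderEmbOfFin]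
    -- Grouping the permutations by their value at 0 produces the expansion along the first row.
    rw [hR, quantumMinor, ← consPerm_bijective.sum_comp, Fintype.sum_prod_type]
    refine Finset.sum_congr rfl fun p _ => ?_
    rw [← ih hcI (hcJ p), quantumMinor, Finset.mul_sum, Finset.smul_sum]
    refine Finset.sum_congr rfl fun e _ => ?_
    rw [permLength_consPerm, List.finRange_succ, List.map_cons, List.prod_cons, consPerm_zero,
      mul_smul_comm, smul_smul, ← pow_add, List.map_map]
    congr 3
    refine List.map_congr_left fun k _ => ?_
    rw [orderEmbOfFin_erase hI 0 hcI, orderEmbOfFin_erase hJ p (hcJ p), Fin.succAbove_zero_apply,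
      Function.comp_apply, consPerm_succ]

end
end QuantumMatrix

/-! ### Transposition of the basis and multiplication by the corner minors -/

namespace QuantumMatrix
noncomputable section

variable {n : ℕ}

theorem list_prod_mul_distrib {M ι : Type*} [Monoid M] [LinearOrder ι] {F G : ι → M} {l : List ι}
    (hl : l.Pairwise (· < ·)) (h : ∀ j' ∈ l, ∀ j ∈ l, j' < j → Commute (G j') (F j)) :
    (l.map fun j => F j * G j).prod = (l.map F).prod * (l.map G).prod := by
  induction l with
  | nil => simp
  | cons x l ih =>
    rw [List.pairwise_cons] at hl
    have hc : Commute (G x) (l.map F).prod := by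
      refine Commute.list_prod_right _ _ fun y hy => ?_
      obtain ⟨j, hj, rfl⟩ := List.mem_map.1 hy
      exact h x (by simp) j (by simp [hj]) (hl.1 j hj)
    simp only [List.map_cons, List.prod_cons]
    rw [ih hl.2 fun j' hj' j hj => h j' (by simp [hj']) j (by simp [hj]), mul_assoc,
      ← mul_assoc (G x), hc.eq]
    simp only [mul_assoc]

/-- Passing from reading by rows to reading by columns only interchanges factors in antidiagonal
position. -/
theorem list_prod_comm {M ι : Type*} [Monoid M] [LinearOrder ι] {f : ι → ι → M} {l l' : List ι}
    (hl : l.Pairwise (· < ·)) (hl' : l'.Pairwise (· < ·))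
    (h : ∀ i i' j j', i < i' → j' < j → Commute (f i' j') (f i j)) :
    (l.map fun i => (l'.map fun j => f i j).prod).prod =
      (l'.map fun j => (l.map fun i => f i j).prod).prod := by
  induction l with
  | nil => simp
  | cons x l ih =>
    rw [List.pairwise_cons] at hl
    simp only [List.map_cons, List.prod_cons]
    rw [ih hl.2, list_prod_mul_distrib hl']
    intro j' _ j _ hj
    refine Commute.list_prod_left _ _ fun y hy => ?_
    obtain ⟨i, hi, rfl⟩ := List.mem_map.1 hy
    exact h x i j j' (hl.1 i hi) hj

theorem sigma_monomial (A : Mat n) : sigma n (monomial A) = monomial A.transpose := by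
  have h : monomial A.transpose = ((List.finRange n).map fun j =>
      ((List.finRange n).map fun i => (Z i j : Oq n) ^ A.transpose i j).prod).prod :=
    list_prod_comm (List.pairwise_lt_finRange n) (List.pairwise_lt_finRange n)
      fun i i' j j' hi hj => Commute.pow_pow (Z_anti i' j' i j hi hj) _ _
  rw [h, monomial, map_list_prod, List.map_map]
  congr 1
  refine List.map_congr_left fun i _ => ?_
  rw [Function.comp_apply, map_list_prod, List.map_map]
  congr 1
  refine List.map_congr_left fun j _ => ?_
  rw [Function.comp_apply, map_pow, sigma_Z]
  rfl

theorem sigma_ZN (A : Mat n) : sigma n (ZN A) = ZN A.transpose := by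
  have h : D A.transpose = D A := by
    rw [D, D]
    congr 1
    rw [neg_sub_comm]
    rfl
  rw [ZN, map_smul, sigma_monomial, ZN, h]

theorem sigma_bar (x : Oq n) : sigma n (bar x) = bar (sigma n x) := by
  obtain ⟨y, rfl⟩ := mk_surjective n x
  induction y using FreeAlgebra.induction with
  | grade0 c =>
    rw [Algebra.algebraMap_eq_smul_one, map_smul, map_one, bar_smul, bar_one, map_smul, map_smul,
      map_one, bar_smul, bar_one]
  | grade1 p =>
    change sigma n (bar (Z p.1 p.2)) = bar (sigma n (Z p.1 p.2))
    rw [bar_Z, sigma_Z, bar_Z]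
  | mul x y hx hy => rw [map_mul, bar_mul, map_mul, map_mul, bar_mul, hx, hy]
  | add x y hx hy => rw [map_add, bar_add, map_add, map_add, bar_add, hx, hy]

/-- σ commutes with bar and permutes the Z(A), so it preserves qL^*. Transposition does not preserve
the lexicographic order, but the congruence criterion does not require it. -/
theorem IsDualCanonicalBasis.sigma_eq {b : Mat n → Oq n} (hb : IsDualCanonicalBasis b)
    (A : Mat n) : sigma n (b A) = b A.transpose := by
  obtain ⟨h, hh, e⟩ := hb.expansion A
  have hbar : bar (sigma n (b A)) = sigma n (b A) := by rw [← sigma_bar, hb.bar_eq]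
  refine hb.eq_of_sub_mem ?_ hbar
  rw [e, map_add, sigma_ZN, add_sub_cancel_left, Finsupp.sum, map_sum, Finset.smul_sum]
  refine Submodule.sum_mem _ fun B hB => ?_
  obtain ⟨-, -, -, c, hc, hcB⟩ := hh B hB
  rw [map_smul, sigma_ZN, hcB, smul_smul, ← mul_assoc, zpow_neg_one, inv_mul_cancel₀ q_ne_zero,
    one_mul]
  exact Zq_smul_mem hc (Submodule.subset_span ⟨_, rfl⟩)

/-- The sum of the entries of `ρ` over `I`. -/
def sumOver (I : Finset (Fin n)) (ρ : Fin n → ℕ) : ℤ := ∑ i ∈ I, (ρ i : ℤ)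

theorem sumOver_add_single (I : Finset (Fin n)) (ρ : Fin n → ℕ) (i : Fin n) :
    sumOver I (ρ + Pi.single i 1) = sumOver I ρ + if i ∈ I then 1 else 0 := by
  have h : ∑ l ∈ I, ((Pi.single i 1 : Fin n → ℕ) l : ℤ) = if i ∈ I then 1 else 0 := by
    by_cases h : i ∈ I <;> simp [Pi.single_apply, h]
  rw [sumOver, ← h, sumOver, ← Finset.sum_add_distrib]
  exact Finset.sum_congr rfl fun l _ => by simp

/-- A row outside I lies below I and a column outside J lies to the left of J, so each of the four
cases is a plain q-commutation. -/
theorem corner_minor_mul_Z {I J : Finset (Fin n)} (hI : ∀ i ∉ I, ∀ s ∈ I, s < i)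
    (hJ : ∀ k ∉ J, ∀ j ∈ J, k < j) (i k : Fin n) :
    minor I J * Z i k = q ^ (2 * ((if k ∈ J then (1 : ℤ) else 0) - if i ∈ I then 1 else 0)) •
      (Z i k * minor I J) := by
  by_cases hi : i ∈ I <;> by_cases hk : k ∈ J
  · simp [hi, hk, minor_commute hi hk]
  · rw [if_neg hk, if_pos hi, Z_mul_minor_of_lt hi (hJ k hk), smul_smul, ← zpow_natCast,
      ← zpow_add₀ q_ne_zero]
    simp
  · rw [if_pos hk, if_neg hi, minor_mul_Z_of_row_gt hk (hI i hi)]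
    norm_cast
  · simp [hi, hk, minor_commute_of_anti (hI i hi) (hJ k hk)]

/-- The exponents for the letters add up, so the total depends only on the row and column content of
the word. -/
theorem IsWord.corner_minor_mul {I J : Finset (Fin n)} (hI : ∀ i ∉ I, ∀ s ∈ I, s < i)
    (hJ : ∀ k ∉ J, ∀ j ∈ J, k < j) {r : ℕ} {ρ c : Fin n → ℕ} {x : Oq n} (hx : IsWord r ρ c x) :
    minor I J * x = q ^ (2 * (sumOver J c - sumOver I ρ)) • (x * minor I J) := by
  induction hx with
  | one => simp [sumOver]
  | mul j _ _ ih =>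
    rw [← mul_assoc, corner_minor_mul_Z hI hJ, smul_mul_assoc, mul_assoc, ih, mul_smul_comm,
      smul_smul, ← zpow_add₀ q_ne_zero, sumOver_add_single, sumOver_add_single, mul_assoc]
    congr 2
    ring

theorem corner_minor_mul_ZN_eq {I J : Finset (Fin n)} (hI : ∀ i ∉ I, ∀ s ∈ I, s < i)
    (hJ : ∀ k ∉ J, ∀ j ∈ J, k < j) (A : Mat n) :
    minor I J * ZN A =
      q ^ (2 * (sumOver J (colSum A) - sumOver I (rowSum A))) • (ZN A * minor I J) := by
  have h := ZN_mem_wordSpan (Nat.zero_le n) (rowsGE_zero A)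
  generalize ZN A = x at h ⊢
  induction h using Submodule.span_induction with
  | zero => simp
  | add x y _ _ hx hy => rw [mul_add, add_mul, smul_add, hx, hy]
  | smul s x _ hx => rw [mul_smul_comm, smul_mul_assoc, hx, smul_comm]
  | mem x hx => exact hx.corner_minor_mul hI hJ

theorem firstIdx_eq_rowBlock (n t : ℕ) : firstIdx n t = rowBlock n 0 t := by
  ext i
  simp [firstIdx, rowBlock]

theorem detq_eq_minor {t : ℕ} (ht : t ≤ n) : detq n t ht = minor (firstIdx n t) (lastIdx n t) :=
  quantumMinor_eq_minor _ _

/-- The exponent of `q` in the product of `det_q(t)` and `b(A)`. -/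
def detExp (t : ℕ) (A : Mat n) : ℤ :=
  ∑ j ∈ lastIdx n t, (colSum A j : ℤ) - ∑ i ∈ firstIdx n t, (rowSum A i : ℤ)

theorem minorExp_zero (t : ℕ) (A : Mat n) : minorExp 0 t (lastIdx n t) A = detExp t A := by
  rw [minorExp, detExp, firstIdx_eq_rowBlock]

theorem latticeGE_le (r : ℕ) (c : Fin n → ℕ) : latticeGE r c ≤ Lstar n := by
  refine Submodule.span_mono ?_
  rintro _ ⟨B, -, -, rfl⟩
  exact ⟨B, rfl⟩

/-- All Z(B) in b(A) have the row and column sums of A, so the same scalar applies to each. -/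
theorem IsDualCanonicalBasis.detq_mul_commute {b : Mat n → Oq n} (hb : IsDualCanonicalBasis b)
    {t : ℕ} (ht : t ≤ n) (A : Mat n) :
    detq n t ht * b A = q ^ (2 * detExp t A) • (b A * detq n t ht) := by
  have hI : ∀ i ∉ firstIdx n t, ∀ s ∈ firstIdx n t, s < i := by
    intro i hi s hs
    simp only [firstIdx, Finset.mem_filter, Finset.mem_univ, true_and] at hi hs
    exact Fin.lt_def.2 (by omega)
  have hJ : ∀ k ∉ lastIdx n t, ∀ j ∈ lastIdx n t, k < j := by
    intro k hk j hj
    rw [mem_lastIdx] at hk hj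
    exact Fin.lt_def.2 (by omega)
  have key : ∀ B : Mat n, rowSum B = rowSum A → colSum B = colSum A →
      minor (firstIdx n t) (lastIdx n t) * ZN B =
        q ^ (2 * detExp t A) • (ZN B * minor (firstIdx n t) (lastIdx n t)) := by
    intro B hr hc
    rw [corner_minor_mul_ZN_eq hI hJ, hr, hc]
    rfl
  obtain ⟨h, hh, e⟩ := hb.expansion A
  rw [detq_eq_minor, e, mul_add, add_mul, smul_add, key A rfl rfl, Finsupp.sum, Finset.mul_sum,
    Finset.sum_mul, Finset.smul_sum]
  congr 1
  refine Finset.sum_congr rfl fun B hB => ?_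
  obtain ⟨-, hr, hc, -⟩ := hh B hB
  rw [mul_smul_comm, key B hr hc, smul_mul_assoc, smul_comm]

theorem IsDualCanonicalBasis.detq_mul {b : Mat n → Oq n} (hb : IsDualCanonicalBasis b)
    {t : ℕ} (ht : t ≤ n) (A : Mat n) :
    detq n t ht * b A = q ^ detExp t A • b (A + E n t) := by
  -- With e = `detExp t A`, both sides equal q^e b(A) det_q(t): bar reverses the factors on the
  -- left, and q-commutation by q^{2e} reverses them on the right.
  have hbar : bar (q ^ (-detExp t A) • (detq n t ht * b A)) =
      q ^ (-detExp t A) • (detq n t ht * b A) := by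
    rw [bar_smul, bar_mul, hb.bar_eq, map_zpow₀, barK_q, inv_zpow', neg_neg,
      hb.detq_mul_commute ht A, smul_smul, ← zpow_add₀ q_ne_zero, detq_eq_minor, bar_minor]
    congr 2
    ring
  have hmem : q ^ (-1 : ℤ) • (q ^ (-detExp t A) • (detq n t ht * b A) - ZN (A + E n t)) ∈
      Lstar n := by
    obtain ⟨h, hh, e⟩ := hb.expansion A
    have h₁ := latticeGE_le _ _ (corner_minor_mul_ZN ht (Nat.zero_le t) (rowsGE_zero A))
    rw [Nat.sub_zero, minorExp_zero, ← firstIdx_eq_rowBlock, shiftE_zero] at h₁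
    rw [e, mul_add, smul_add, add_sub_right_comm, smul_add, detq_eq_minor]
    refine Submodule.add_mem _ h₁ ?_
    rw [Finsupp.sum, Finset.mul_sum, Finset.smul_sum, Finset.smul_sum]
    -- For the lower terms the normalizing exponent is the same, because the sums of B and A agree,
    -- and their coefficients are divisible by q; membership in the lattice is then enough.
    refine Submodule.sum_mem _ fun B hB => ?_
    obtain ⟨-, hr, hc, c, hcZ, hcB⟩ := hh B hB
    have h₂ := latticeGE_le _ _ (minor_mul_ZN_mem ht (Nat.zero_le t) (rowsGE_zero B)
      (J := lastIdx n t) (by rw [card_lastIdx ht, card_rowBlock (Nat.zero_le t) ht, Nat.sub_zero]))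
    have hE : detExp t B = detExp t A := by rw [detExp, detExp, hr, hc]
    rw [minorExp_zero, ← firstIdx_eq_rowBlock, hE] at h₂
    convert Zq_smul_mem hcZ h₂ using 1
    rw [mul_smul_comm, hcB, smul_smul, smul_smul, smul_smul]
    congr 1
    rw [zpow_neg_one]
    have := q_ne_zero
    field_simp
  rw [← hb.eq_of_sub_mem hmem hbar, smul_smul, ← zpow_add₀ q_ne_zero, add_neg_cancel, zpow_zero,
    one_smul]

theorem IsDualCanonicalBasis.mul_detq {b : Mat n → Oq n} (hb : IsDualCanonicalBasis b)
    {t : ℕ} (ht : t ≤ n) (A : Mat n) :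
    b A * detq n t ht = q ^ (-detExp t A) • b (A + E n t) := by
  have h : b A * detq n t ht = q ^ (-(2 * detExp t A)) • (detq n t ht * b A) := by
    rw [hb.detq_mul_commute ht A, smul_smul, ← zpow_add₀ q_ne_zero, neg_add_cancel, zpow_zero,
      one_smul]
  rw [h, hb.detq_mul, smul_smul, ← zpow_add₀ q_ne_zero]
  congr 2
  ring

theorem IsDualCanonicalBasis.mul_sigma_detq {b : Mat n → Oq n} (hb : IsDualCanonicalBasis b)
    {t : ℕ} (ht : t ≤ n) (A : Mat n) :
    b A * sigma n (detq n t ht) =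
      q ^ (-detExp t A.transpose) • b (A + (E n t).transpose) := by
  have h := congrArg (sigma n) (hb.mul_detq ht A.transpose)
  rwa [map_mul, map_smul, hb.sigma_eq, hb.sigma_eq, Matrix.transpose_add,
    Matrix.transpose_transpose] at h

theorem IsDualCanonicalBasis.sigma_detq_mul {b : Mat n → Oq n} (hb : IsDualCanonicalBasis b)
    {t : ℕ} (ht : t ≤ n) (A : Mat n) :
    sigma n (detq n t ht) * b A =
      q ^ detExp t A.transpose • b (A + (E n t).transpose) := by
  have h := congrArg (sigma n) (hb.detq_mul ht A.transpose)
  rwa [map_mul, map_smul, hb.sigma_eq, hb.sigma_eq, Matrix.transpose_add,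
    Matrix.transpose_transpose] at h

theorem smul_mem_qPowMul (b : Mat n → Oq n) (a e : ℤ) (A : Mat n) :
    q ^ a • q ^ e • b A ∈ qPowMul b :=
  ⟨a + e, A, by rw [smul_smul, ← zpow_add₀ q_ne_zero]⟩

end
end QuantumMatrix

theorem theorem5p2 (n : ℕ) :
    (∃! b : QuantumMatrix.Mat n → QuantumMatrix.Oq n, QuantumMatrix.IsDualCanonicalBasis b) ∧
    ∀ b : QuantumMatrix.Mat n → QuantumMatrix.Oq n, QuantumMatrix.IsDualCanonicalBasis b →
      ∀ (t : ℕ) (_ : 1 ≤ t) (ht : t ≤ n),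
        (∀ x ∈ QuantumMatrix.qPowMul b,
          x * QuantumMatrix.detq n t ht ∈ QuantumMatrix.qPowMul b ∧
          QuantumMatrix.detq n t ht * x ∈ QuantumMatrix.qPowMul b ∧
          x * QuantumMatrix.sigma n (QuantumMatrix.detq n t ht) ∈ QuantumMatrix.qPowMul b ∧
          QuantumMatrix.sigma n (QuantumMatrix.detq n t ht) * x ∈ QuantumMatrix.qPowMul b) ∧
        ∀ A : QuantumMatrix.Mat n,
          b A * QuantumMatrix.detq n t ht =
            QuantumMatrix.q ^
              ((∑ i ∈ QuantumMatrix.firstIdx n t, (QuantumMatrix.rowSum A i : ℤ))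
                - ∑ j ∈ QuantumMatrix.lastIdx n t, (QuantumMatrix.colSum A j : ℤ)) •
              b (A + QuantumMatrix.E n t) ∧
          b A * QuantumMatrix.sigma n (QuantumMatrix.detq n t ht) =
            QuantumMatrix.q ^
              ((∑ j ∈ QuantumMatrix.firstIdx n t, (QuantumMatrix.colSum A j : ℤ))
                - ∑ i ∈ QuantumMatrix.lastIdx n t, (QuantumMatrix.rowSum A i : ℤ)) •
              b (A + (QuantumMatrix.E n t).transpose) := by
  obtain ⟨b₀, hb₀⟩ := QuantumMatrix.exists_isDualCanonicalBasis n
  refine ⟨⟨b₀, hb₀, fun b hb => hb.unique hb₀⟩, fun b hb t _ ht => ⟨?_, fun A => ⟨?_, ?_⟩⟩⟩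
  · rintro _ ⟨a, A, rfl⟩
    rw [smul_mul_assoc, smul_mul_assoc, mul_smul_comm, mul_smul_comm, hb.mul_detq, hb.detq_mul,
      hb.mul_sigma_detq, hb.sigma_detq_mul]
    exact ⟨QuantumMatrix.smul_mem_qPowMul _ _ _ _, QuantumMatrix.smul_mem_qPowMul _ _ _ _,
      QuantumMatrix.smul_mem_qPowMul _ _ _ _, QuantumMatrix.smul_mem_qPowMul _ _ _ _⟩
  · rw [hb.mul_detq, QuantumMatrix.detExp, neg_sub]
  -- Transposition exchanges row and column sums by definition.
  · rw [hb.mul_sigma_detq, QuantumMatrix.detExp, neg_sub]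
    rfl
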